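/- Let $d\ge 1$, $T>0$, $a=(a_1,\dots,a_d)\in\mathbb R^d$, let $e_1,\dots,e_d$ be the canonical basis of $\mathbb Z^d$, let $\Omega=\mathbb R^{\mathbb Z^d}$ with elements $p=(p_x)_{x\in\mathbb Z^d}$, and let $\mu_T=\langle\cdot\rangle$ be the product of the centred Gaussian measures with variance $T$. The Asymmetric Energy Model has the generator $L=S+A$, which acts on smooth local functions (smooth functions of finitely many $p_x$) by $$Sf=\sum_{i=1}^d\sum_{x\in\mathbb Z^d}(p_{x+e_i}\partial_{p_x}-p_x\partial_{p_{x+e_i}})^2f,\qquad Af=\sum_{i=1}^d a_i\sum_{x\in\mathbb Z^d}p_xp_{x+e_i}(p_{x+e_i}\partial_{p_x}-p_x\partial_{p_{x+e_i}})f .$$ Assume that the infinite-volume dynamics is well defined: the operator $L$, with domain the smooth local $f$ such that $f,Lf\in\mathbb L^2(\mu_T)$, is closable in $\mathbb L^2(\mu_T)$, and its closure, also denoted by $L$, is the generator of a strongly continuous Markov semigroup on $\mathbb L^2(\mu_T)$ with stationary measure $\mu_T$. Let $E_x=p_x^2$, and let $w_i=2(E_{e_i}-E_0)+2a_iE_0E_{e_i}-2a_iT^2-4a_iT(E_0-T)$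 be the normalized current in direction $e_i$. With $(\tau_zf)(p)=f((p_{x+z})_x)$ put $$\ll f,g\gg\;=\sum_{z\in\mathbb Z^d}\big(\langle \tau_zf\,g\rangle-\langle f\rangle\langle g\rangle\big),$$ extended to $f,g\in\mathbb L^2(\mu_T)$ through the box averages $$Q_k(f,g)=(2k+1)^{-d}\Big\langle \sum_{|x|_\infty\le k}\tau_x(f-\langle f\rangle)\,\sum_{|x|_\infty\le k}\tau_x(g-\langle g\rangle)\Big\rangle .$$ Here $\ll f,g\gg\,\ge b$ means that $\liminf_kQ_k(f,g)\ge b$, and that the sum of the series is at least $b$ if it converges absolutely; $\ll f,g\gg\,\le b$ means that $\limsup_kQ_k(f,g)\le b$, and that the sum of the series is at most $b$ if it converges absolutely. Then there is a constant $C>0$, depending only on $d$, $T$ and $a$, such that for every $i$ and every $\lambda>0$ the equation $(\lambda-L)u=w_i$ has a unique solution $u=(\lambda-L)^{-1}w_i$ in the domain of $L$, and the following holds. If $a_i\ne0$ and $0<\lambda\le1$, then $$\ll w_i,(\lambda-L)^{-1}w_i\gg\;\ge\;\begin{cases}C\lambda^{-1/4},&d=1,\\ C|\log\lambda|^{1/2},&d=2,\\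 C,&d\ge3.\end{cases}$$ If $d\ge3$, then for every $\lambda>0$ (and every value of $a_i$) $$\ll w_i,(\lambda-L)^{-1}w_i\gg\;\le\;C^{-1}.$$ -/

import Mathlib

open MeasureTheory ProbabilityTheory Filter Topology
open scoped NNReal ENNReal ContDiff

namespace AEM

/-- The lattice `ℤ^d`. -/
abbrev Site (d : ℕ) := Fin d → ℤ

/-- Momentum configurations `p = (p_x)`, the elements of `Ω = ℝ^(ℤ^d)`. -/
abbrev Config (d : ℕ) := Site d → ℝ

/-- The canonical basis vector `e_i`. -/
def e {d : ℕ} (i : Fin d) : Site d := Pi.single i 1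

/-- The Gaussian product measure `μ_T` with temperature `T`: the momenta are independent, centred
and Gaussian with variance `T`. -/
noncomputable def gibbs (d : ℕ) (T : ℝ) : Measure (Config d) :=
  Measure.infinitePi (fun _ : Site d => gaussianReal 0 T.toNNReal)

/-- The Hilbert space `𝕃²(Ω, μ_T)`. -/
noncomputable abbrev L2 (d : ℕ) (T : ℝ) := Lp ℝ 2 (gibbs d T)

/-- The partial derivative `∂f/∂p_x`. -/
noncomputable def partialDeriv {d : ℕ} (x : Site d) (f : Config d → ℝ) (p : Config d) : ℝ :=
  deriv (fun s : ℝ => f (Function.update p x s)) (p x)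

/-- The vector field `p_y ∂_{p_x} - p_x ∂_{p_y}`. -/
noncomputable def rot {d : ℕ} (x y : Site d) (f : Config d → ℝ) (p : Config d) : ℝ :=
  p y * partialDeriv x f p - p x * partialDeriv y f p

/-- `f` is a smooth local function: a smooth function of finitely many momenta. -/
def IsLocalSmooth {d : ℕ} (f : Config d → ℝ) : Prop :=
  ∃ (Λ : Finset (Site d)) (φ : (Λ → ℝ) → ℝ), ContDiff ℝ ∞ φ ∧ f = fun p => φ (fun x => p x)

/-- The symmetric part `S` of the generator. For a local function only finitely many terms of
the sum over `x` are nonzero. -/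
noncomputable def genS {d : ℕ} (f : Config d → ℝ) (p : Config d) : ℝ :=
  ∑ i : Fin d, ∑ᶠ x : Site d, rot x (x + e i) (rot x (x + e i) f) p

/-- The antisymmetric part `A` of the generator, with asymmetry parameters `a_i`. -/
noncomputable def genA {d : ℕ} (a : Fin d → ℝ) (f : Config d → ℝ) (p : Config d) : ℝ :=
  ∑ i : Fin d, a i * ∑ᶠ x : Site d, p x * p (x + e i) * rot x (x + e i) f p

/-- The formal generator `L = S + A` of the asymmetric energy model. -/
noncomputable def gen {d : ℕ} (a : Fin d → ℝ) (f : Config d → ℝ) (p : Config d) : ℝ :=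
  genS f p + genA a f p

/-- The graph, in `𝕃² × 𝕃²`, of `L` on its initial domain: the smooth local functions `f` with
`f ∈ 𝕃²` and `L f ∈ 𝕃²`. -/
def preGraph (d : ℕ) (T : ℝ) (a : Fin d → ℝ) : Set (L2 d T × L2 d T) :=
  {q | ∃ f : Config d → ℝ, IsLocalSmooth f ∧
    (q.1 : Config d → ℝ) =ᵐ[gibbs d T] f ∧ (q.2 : Config d → ℝ) =ᵐ[gibbs d T] gen a f}

/-- The graph of the closure of `L`. -/
def closedGraph (d : ℕ) (T : ℝ) (a : Fin d → ℝ) : Set (L2 d T × L2 d T) :=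
  closure (preGraph d T a)

/-- `P` is a strongly continuous Markov semigroup on `𝕃²(μ_T)` for which `μ_T` is stationary. -/
structure IsMarkovSemigroup {d : ℕ} {T : ℝ} (P : ℝ≥0 → L2 d T →L[ℝ] L2 d T) : Prop where
  zero : P 0 = ContinuousLinearMap.id ℝ (L2 d T)
  add : ∀ s t, P (s + t) = (P s).comp (P t)
  continuous : ∀ f, Tendsto (fun t => P t f) (𝓝 0) (𝓝 f)
  contraction : ∀ t f, ‖P t f‖ ≤ ‖f‖
  nonneg : ∀ t f, 0 ≤ f → 0 ≤ P t f
  one : ∀ t (f : L2 d T), ((f : Config d → ℝ) =ᵐ[gibbs d T] fun _ => 1) → P t f = f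
  stationary : ∀ t f, ∫ p, P t f p ∂gibbs d T = ∫ p, f p ∂gibbs d T

/-- `f` is in the domain of the infinitesimal generator of `P`, and `g` is its image. -/
def IsGeneratorPair {d : ℕ} {T : ℝ} (P : ℝ≥0 → L2 d T →L[ℝ] L2 d T) (f g : L2 d T) : Prop :=
  Tendsto (fun t : ℝ≥0 => (t : ℝ)⁻¹ • (P t f - f)) (𝓝[>] 0) (𝓝 g)

/-- The standing assumption of the model: `L`, defined on the smooth local functions, is closable
in `𝕃²(μ_T)`, and its closure is the generator of a stationary Markov dynamics (the initial domain
is thus a core). Closability is contained in the equality of the two graphs. -/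
def DynamicsWellDefined (d : ℕ) (T : ℝ) (a : Fin d → ℝ) : Prop :=
  ∃ P : ℝ≥0 → L2 d T →L[ℝ] L2 d T, IsMarkovSemigroup P ∧
    ∀ f g : L2 d T, (f, g) ∈ closedGraph d T a ↔ IsGeneratorPair P f g

/-- `u = (lam - L)⁻¹ w`, for the closure `L`: `u` is in its domain and `lam u - L u = w`. -/
def IsResolvent {d : ℕ} {T : ℝ} (a : Fin d → ℝ) (lam : ℝ) (w : Config d → ℝ) (u : L2 d T) : Prop :=
  ∃ g : L2 d T, (u, g) ∈ closedGraph d T a ∧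
    ((lam • u - g : L2 d T) : Config d → ℝ) =ᵐ[gibbs d T] w

/-- The energy `E_x = p_x²`. -/
def energy {d : ℕ} (x : Site d) (p : Config d) : ℝ := p x ^ 2

/-- The microscopic current `j_{x,x+e_i} = 2 (E_{x+e_i} - E_x) + 2 a_i E_x E_{x+e_i}`. -/
def current {d : ℕ} (a : Fin d → ℝ) (i : Fin d) (x : Site d) (p : Config d) : ℝ :=
  2 * (energy (x + e i) p - energy x p) + 2 * a i * energy x p * energy (x + e i) p

/-- The normalized current `w_i = j_{0,e_i} - j_i(T) - j_i'(T) (p_0² - T)`, in which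
`j_i(T) = 2 a_i T²` is the mean current at temperature `T` and `j_i'(T) = 4 a_i T`. -/
def normCurrent {d : ℕ} (T : ℝ) (a : Fin d → ℝ) (i : Fin d) (p : Config d) : ℝ :=
  current a i 0 p - 2 * a i * T ^ 2 - 4 * a i * T * (energy 0 p - T)

/-- The shift of a configuration by `z`. -/
def shift {d : ℕ} (z : Site d) (p : Config d) : Config d := fun x => p (x + z)

/-- The mean `⟨f⟩` under `μ_T`. -/
noncomputable def mean {d : ℕ} (T : ℝ) (f : Config d → ℝ) : ℝ := ∫ p, f p ∂gibbs d T

/-- The term `⟨τ_z f g⟩ - ⟨f⟩⟨g⟩` of the series `≪f, g≫ = ∑_z (⟨τ_z f g⟩ - ⟨f⟩⟨g⟩)`. -/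
noncomputable def shiftCov {d : ℕ} (T : ℝ) (f g : Config d → ℝ) (z : Site d) : ℝ :=
  mean T (fun p => f (shift z p) * g p) - mean T f * mean T g

/-- The box `{x : |x| ≤ k}`, which has `(2k+1)^d` sites. -/
noncomputable def box (d k : ℕ) : Finset (Site d) :=
  Fintype.piFinset (fun _ => Finset.Icc (-(k : ℤ)) (k : ℤ))

/-- The box average `(2k+1)^{-d} ⟨∑_{|x| ≤ k} τ_x (f - ⟨f⟩), ∑_{|x| ≤ k} τ_x (g - ⟨g⟩)⟩`. Its limit
as `k → ∞` is `≪f, g≫` whenever the series that defines `≪f, g≫` converges absolutely, in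
particular for local functions. -/
noncomputable def boxPairing {d : ℕ} (T : ℝ) (f g : Config d → ℝ) (k : ℕ) : ℝ :=
  ((2 * (k : ℝ) + 1) ^ d)⁻¹ *
    mean T (fun p => (∑ x ∈ box d k, (f (shift x p) - mean T f)) *
      (∑ x ∈ box d k, (g (shift x p) - mean T g)))

/-- `≪f, g≫ ≥ b`, without presupposing that `≪f, g≫` exists: the lower limit of the box averages
is at least `b`, and so is the sum of the series if it converges. -/
def PairingGE {d : ℕ} (T : ℝ) (f g : Config d → ℝ) (b : ℝ) : Prop :=
  (b : EReal) ≤ liminf (fun k : ℕ => (boxPairing T f g k : EReal)) atTop ∧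
    ∀ s : ℝ, HasSum (shiftCov T f g) s → b ≤ s

/-- `≪f, g≫ ≤ b`, without presupposing that `≪f, g≫` exists: the upper limit of the box averages
is at most `b`, and so is the sum of the series if it converges. -/
def PairingLE {d : ℕ} (T : ℝ) (f g : Config d → ℝ) (b : ℝ) : Prop :=
  limsup (fun k : ℕ => (boxPairing T f g k : EReal)) atTop ≤ (b : EReal) ∧
    ∀ s : ℝ, HasSum (shiftCov T f g) s → s ≤ b

end AEM

/-! Let `W_k` be the sum of the shifted currents over the box of radius `k`, with `N` sites, and
`u_k` the same sum of shifts of `u`. The dynamics commutes with shifts, so `(λ - L) u_k = W_k`, and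
the box average is `N⁻¹⟨W_k, u_k⟩ = N⁻¹(λ‖u_k‖² - ⟨u_k, L u_k⟩)` (`boxPairing_eq`). Everything is a
two-sided estimate of this `energyNorm` by a constant times `N`. It dominates `λ‖u‖²` and the
Dirichlet form, so there are two ways to bound a functional `⟨P, u⟩` by its square root: by the norm
of `P`, at the price `λ^(-1/2)` (`HBound.of_norm`), or by writing `P` as a sum of terms `rot G`
(`HBound.of_rot`).

Lower bound. For a polynomial `F`, `⟨F, W_k⟩ = ⟨(λ - S + A) F, u_k⟩`, so `energyNorm` is at least
`⟨F, W_k⟩²` divided by the squared dual norm of `(λ - S + A) F`. Take `F = ∑ f(x - v) :p_x² p_v²:`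
over the box. Then `⟨F, W_k⟩` is about `16 T⁴ a_i f(e_i) N`. `S F` is of the form `rot G` with the
gradient of `f` as coefficient. `A F` has parts of degrees six, four and two in the momenta;
translation invariance reduces the last two to boundary terms, and the coefficient of the first is,
up to further `rot G` terms, the drift `∑ a_j (f(z) - f(z + e_j))`, reweighted near the origin
(`fockA_pairPol`). In that part one squared momentum is transported to a box of side `2^m` by a
dyadic flow (`exists_flow`, `HBound.flow`). This costs `Γ = flowEnergy + 1/(2^(md) λ)`, which for
the best `m` is of order `λ^(-1/2)`, `1 + |log λ|`, `1` in dimensions one, two, at least three. The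
result, `exists_lower_bound`, is a bound per site of order `(a_i f(e_i))² / (λ‖f‖² + ‖∇f‖² + Γ‖drift
f‖²)`.

It remains to choose `f`. For `d ≥ 3` the indicator of `±e_i` suffices. For `d = 1` a tent of slope
of order `λ^(3/4)` makes the denominator of order `λ^(1/4)`. For `d = 2` a truncated logarithm of a
quadratic form that is flat along the drift, with anisotropy `M` of order `|log λ|`, has `f(e_i)` of
order `|log λ|` and denominator of order `|log λ|^(3/2)`.

Upper bound. For `d ≥ 3` the flows have bounded energy, so `W_k` itself, a gradient plus a sum of
squared momenta to be transported, has dual norm of order `√N` (`exists_upper_bound`).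

The analytic input is `dirichlet_le` and `integral_pev_mul_gen`: integration by parts for smooth
local functions, justified by radial cutoffs, which the fields `p_y ∂_{p_x} - p_x ∂_{p_y}`
annihilate. The consequences pass to the closure of `L` by continuity, and Wick ordering turns `L² `
norms of polynomials into norms of their coefficients. -/

namespace AEM

/-! ### Invariance of the Gaussian product measure under shifts and rotations -/

section Measure

variable {d : ℕ} {T : ℝ}

instance : IsProbabilityMeasure (gibbs d T) := by
  unfold gibbs; infer_instance

lemma e_ne_zero (i : Fin d) : (e i : Site d) ≠ 0 := by
  simp [e]

lemma add_e_ne (x : Site d) (i : Fin d) : x + e i ≠ x := by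
  simp [e_ne_zero]

lemma ne_add_e (x : Site d) (i : Fin d) : x ≠ x + e i := (add_e_ne x i).symm

lemma measurePreserving_shift (z : Site d) :
    MeasurePreserving (shift z) (gibbs d T) (gibbs d T) := by
  refine ⟨by unfold shift; fun_prop, ?_⟩
  exact Measure.map_infinitePi_infinitePi_of_inj
    (P := fun _ : Site d => gaussianReal 0 T.toNNReal) (add_left_injective z)

lemma shift_shift (y z : Site d) (p : Config d) : shift y (shift z p) = shift (y + z) p := by
  funext x; simp [shift, add_assoc]

/-- Rotation by the angle `s` in the plane of the momenta `p_x`, `p_y`. -/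
noncomputable def rotate (x y : Site d) (s : ℝ) (p : Config d) : Config d := fun z =>
  if z = x then Real.cos s * p x + Real.sin s * p y
  else if z = y then -Real.sin s * p x + Real.cos s * p y else p z

lemma measurable_rotate_uncurry (x y : Site d) :
    Measurable (fun q : ℝ × Config d => rotate x y q.1 q.2) := by
  refine measurable_pi_lambda _ fun z => ?_
  unfold rotate
  split_ifs <;> fun_prop

lemma measurable_rotate (x y : Site d) (s : ℝ) : Measurable (rotate x y s) := by
  refine measurable_pi_lambda _ fun z => ?_
  unfold rotate
  split_ifs <;> fun_prop

lemma iIndepFun_eval :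
    iIndepFun (fun (x : Site d) (p : Config d) => p x) (gibbs d T) :=
  iIndepFun_infinitePi (P := fun _ : Site d => gaussianReal 0 T.toNNReal)
    (X := fun _ t => t) (fun _ => measurable_id)

lemma measurePreserving_eval (x : Site d) :
    MeasurePreserving (fun p : Config d => p x) (gibbs d T) (gaussianReal 0 T.toNNReal) :=
  measurePreserving_eval_infinitePi (fun _ : Site d => gaussianReal 0 T.toNNReal) x

lemma map_rotation_gaussianReal (v : ℝ≥0) (s : ℝ) :
    ((gaussianReal 0 v).prod (gaussianReal 0 v)).map (ContinuousLinearMap.rotation s) =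
      (gaussianReal 0 v).prod (gaussianReal 0 v) := by
  refine IsGaussian.map_rotation_eq_self_of_forall_strongDual_eq_zero (fun L => ?_) s
  rw [integral_continuousLinearMap_gaussianReal]; simp

/-- Only two coordinates move. They are independent of the others and have the rotation invariant
law `γ ⊗ γ`; it is enough to compare the measures of cylinder sets. -/
lemma measurePreserving_rotate {x y : Site d} (hxy : x ≠ y) (s : ℝ) :
    MeasurePreserving (rotate x y s) (gibbs d T) (gibbs d T) := by
  classical
  refine ⟨measurable_rotate x y s, ?_⟩
  set γ := gaussianReal 0 T.toNNReal with hγ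
  refine Measure.eq_infinitePi (fun _ : Site d => γ) fun S t ht => ?_
  have huniv : ∀ z, MeasurableSet (if z ∈ S then t z else Set.univ) := by
    intro z; split_ifs
    · exact ht z
    · exact .univ
  -- The sites `x`, `y` need not belong to `S`; filling in the whole line lets both be treated as
  -- constrained.
  set t' : Site d → Set ℝ := fun z => if z ∈ S then t z else Set.univ with ht'
  set R : Finset (Site d) := (S.erase x).erase y with hR
  set P2 : Finset (Site d) := {x, y} with hP2
  have hdisj : Disjoint P2 R := by
    rw [Finset.disjoint_left]; intro z hz
    simp only [hP2, Finset.mem_insert, Finset.mem_singleton] at hz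
    rcases hz with rfl | rfl <;> simp [hR]
  have hind := (iIndepFun_eval (d := d) (T := T)).indepFun_finset P2 R hdisj
    (fun z => measurable_pi_apply z)
  have hx2 : x ∈ P2 := by simp [hP2]
  have hy2 : y ∈ P2 := by simp [hP2]
  let A : Set (P2 → ℝ) := {q | (ContinuousLinearMap.rotation s (q ⟨x, hx2⟩, q ⟨y, hy2⟩) : ℝ × ℝ)
      ∈ t' x ×ˢ t' y}
  let B : Set (R → ℝ) := {q | ∀ z : R, q z ∈ t z}
  have hA : MeasurableSet A := by
    refine MeasurableSet.preimage ((huniv x).prod (huniv y)) ?_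
    exact (ContinuousLinearMap.rotation s : ℝ × ℝ →L[ℝ] ℝ × ℝ).continuous.measurable.comp
      ((measurable_pi_apply _).prodMk (measurable_pi_apply _))
  have hB : MeasurableSet B := by
    have : B = ⋂ z : R, {q | q z ∈ t z} := by ext q; simp [B]
    rw [this]
    exact MeasurableSet.iInter fun z => measurableSet_preimage (measurable_pi_apply z) (ht z)
  have key := hind.measure_inter_preimage_eq_mul A B hA hB
  rw [Measure.map_apply (measurable_rotate x y s) (.pi (Finset.countable_toSet S) fun z _ => ht z)]
  have hset : rotate x y s ⁻¹' (Set.pi S t) =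
      (fun (a : Config d) (i : P2) => a i) ⁻¹' A ∩ (fun (a : Config d) (i : R) => a i) ⁻¹' B := by
    ext p
    simp only [Set.mem_preimage, Set.mem_pi, Set.mem_inter_iff, A, B, Set.mem_ofPred_eq,
      ContinuousLinearMap.rotation_apply, Set.mem_prod, smul_eq_mul, ht', rotate]
    constructor
    · intro h
      refine ⟨⟨?_, ?_⟩, fun z => ?_⟩
      · split_ifs with hxS
        · simpa using h x hxS
        · trivial
      · split_ifs with hyS
        · simpa [hxy.symm] using h y hyS
        · trivial
      · have hz := z.2
        simp only [hR, Finset.mem_erase] at hz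
        simpa [hz.1, hz.2.1] using h z hz.2.2
    · rintro ⟨⟨h1, h2⟩, h3⟩ z hz
      have hz' : z ∈ S := hz
      by_cases hzx : z = x
      · subst hzx; simpa [hz'] using h1
      by_cases hzy : z = y
      · subst hzy; simpa [hz', hzx] using h2
      simpa [hzx, hzy] using h3 ⟨z, by simp [hR, hzx, hzy, hz']⟩
  rw [hset, key]
  have h1 : gibbs d T ((fun (a : Config d) (i : P2) => a i) ⁻¹' A) = γ (t' x) * γ (t' y) := by
    have hmap : (gibbs d T).map (fun p => (p x, p y)) = γ.prod γ :=
      Measure.infinitePi_map_eval_prod (P := fun _ : Site d => γ) hxy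
    have : ((fun (a : Config d) (i : P2) => a i) ⁻¹' A) = (fun p : Config d => (p x, p y)) ⁻¹'
        ((ContinuousLinearMap.rotation s : ℝ × ℝ →L[ℝ] ℝ × ℝ) ⁻¹' (t' x ×ˢ t' y)) := rfl
    have hm : MeasurableSet (t' x ×ˢ t' y) := (huniv x).prod (huniv y)
    have hrm : Measurable (ContinuousLinearMap.rotation s : ℝ × ℝ →L[ℝ] ℝ × ℝ) :=
      (ContinuousLinearMap.rotation s : ℝ × ℝ →L[ℝ] ℝ × ℝ).continuous.measurable
    rw [this, ← Measure.map_apply (by fun_prop) (hrm hm), hmap, ← Measure.map_apply hrm hm,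
      map_rotation_gaussianReal, Measure.prod_prod]
  have h2 : gibbs d T ((fun (a : Config d) (i : R) => a i) ⁻¹' B) = ∏ z ∈ R, γ (t z) := by
    have : ((fun (a : Config d) (i : R) => a i) ⁻¹' B) = Set.pi R t := by
      ext p; simp [B, Set.mem_pi]
    rw [this]
    exact Measure.infinitePi_pi (fun _ : Site d => γ) fun z _ => ht z
  rw [h1, h2]
  have h3 : ∏ z ∈ S, γ (t z) = ∏ z ∈ insert x (insert y R), γ (t' z) := by
    have h4 : ∏ z ∈ S, γ (t z) = ∏ z ∈ S, γ (t' z) :=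
      Finset.prod_congr rfl fun z hz => by simp only [ht', if_pos hz]
    rw [h4]
    refine Finset.prod_subset (fun z hz => ?_) fun z _ hz => ?_
    · by_cases hzx : z = x
      · simp [hzx]
      by_cases hzy : z = y
      · simp [hzy]
      simp [hR, hzx, hzy, hz]
    · simp only [ht', if_neg hz]
      exact measure_univ
  rw [h3, Finset.prod_insert (by simp [hR, hxy]), Finset.prod_insert (by simp [hR]), mul_assoc]
  congr 2
  refine Finset.prod_congr rfl fun z hz => ?_
  simp only [hR, Finset.mem_erase] at hz
  simp [ht', hz.2.2]

end Measure

/-! ### Differential calculus of smooth local functions and integration along rotations -/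

section Calculus

variable {d : ℕ} {T : ℝ} {Λ Λ' : Finset (Site d)} {f g : Config d → ℝ}

/-- `f` is a smooth function of the momenta in `Λ`. -/
def SmoothOn (Λ : Finset (Site d)) (f : Config d → ℝ) : Prop :=
  ∃ φ : (Λ → ℝ) → ℝ, ContDiff ℝ ∞ φ ∧ f = fun p => φ (fun x => p x)

namespace SmoothOn

lemma mono (h : SmoothOn Λ f) (hΛ : Λ ⊆ Λ') : SmoothOn Λ' f := by
  obtain ⟨φ, hφ, rfl⟩ := h
  refine ⟨fun q => φ fun x => q ⟨x, hΛ x.2⟩, hφ.comp ?_, rfl⟩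
  exact contDiff_pi.2 fun x => contDiff_apply ℝ ℝ _

lemma const (c : ℝ) : SmoothOn Λ (fun _ => c) := ⟨fun _ => c, contDiff_const, rfl⟩

lemma coord {x : Site d} (hx : x ∈ Λ) : SmoothOn Λ (fun p => p x) :=
  ⟨fun q => q ⟨x, hx⟩, contDiff_apply ℝ ℝ _, rfl⟩

lemma add (hf : SmoothOn Λ f) (hg : SmoothOn Λ g) : SmoothOn Λ (fun p => f p + g p) := by
  obtain ⟨φ, hφ, rfl⟩ := hf
  obtain ⟨ψ, hψ, rfl⟩ := hg
  exact ⟨fun q => φ q + ψ q, hφ.add hψ, rfl⟩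

lemma sub (hf : SmoothOn Λ f) (hg : SmoothOn Λ g) : SmoothOn Λ (fun p => f p - g p) := by
  obtain ⟨φ, hφ, rfl⟩ := hf
  obtain ⟨ψ, hψ, rfl⟩ := hg
  exact ⟨fun q => φ q - ψ q, hφ.sub hψ, rfl⟩

lemma mul (hf : SmoothOn Λ f) (hg : SmoothOn Λ g) : SmoothOn Λ (fun p => f p * g p) := by
  obtain ⟨φ, hφ, rfl⟩ := hf
  obtain ⟨ψ, hψ, rfl⟩ := hg
  exact ⟨fun q => φ q * ψ q, hφ.mul hψ, rfl⟩

lemma sum {ι : Type*} {s : Finset ι} {F : ι → Config d → ℝ} (h : ∀ i ∈ s, SmoothOn Λ (F i)) :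
    SmoothOn Λ (fun p => ∑ i ∈ s, F i p) := by
  classical
  induction s using Finset.induction_on with
  | empty => simpa using const 0
  | insert a s ha ih =>
    simp only [Finset.sum_insert ha]
    exact (h a (Finset.mem_insert_self a s)).add
      (ih fun i hi => h i (Finset.mem_insert_of_mem hi))

lemma comp_real {u : ℝ → ℝ} (hu : ContDiff ℝ ∞ u) (hf : SmoothOn Λ f) :
    SmoothOn Λ (fun p => u (f p)) := by
  obtain ⟨φ, hφ, rfl⟩ := hf
  exact ⟨fun q => u (φ q), hu.comp hφ, rfl⟩

lemma continuous (hf : SmoothOn Λ f) : Continuous f := by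
  obtain ⟨φ, hφ, rfl⟩ := hf
  exact hφ.continuous.comp (by fun_prop)

lemma measurable (hf : SmoothOn Λ f) : Measurable f := by
  obtain ⟨φ, hφ, rfl⟩ := hf
  exact hφ.continuous.measurable.comp (by fun_prop)

lemma aestronglyMeasurable (hf : SmoothOn Λ f) {μ : Measure (Config d)} :
    AEStronglyMeasurable f μ := hf.measurable.aestronglyMeasurable

/-- The chain rule along a curve; the partial derivatives are again smooth. -/
lemma exists_partial (hf : SmoothOn Λ f) : ∃ D : Site d → Config d → ℝ,
    (∀ z, SmoothOn Λ (D z)) ∧ ∀ (c : ℝ → Config d) (v : Config d) (s : ℝ),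
      (∀ z ∈ Λ, HasDerivAt (fun r => c r z) (v z) s) →
        HasDerivAt (fun r => f (c r)) (∑ z ∈ Λ, v z * D z (c s)) s := by
  classical
  obtain ⟨φ, hφ, rfl⟩ := hf
  refine ⟨fun z p => if hz : z ∈ Λ then fderiv ℝ φ (fun x => p x) (Pi.single ⟨z, hz⟩ 1) else 0,
    fun z => ?_, fun c v s hc => ?_⟩
  · by_cases hz : z ∈ Λ
    · refine ⟨fun q => fderiv ℝ φ q (Pi.single ⟨z, hz⟩ 1), ?_, by simp [hz]⟩
      exact (hφ.fderiv_right (m := ∞) (by simp)).clm_apply contDiff_const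
    · simpa [hz] using const 0
  · have h1 : HasDerivAt (fun r => fun x : Λ => c r x) (fun x : Λ => v x) s :=
      hasDerivAt_pi.2 fun x => hc x x.2
    have h2 := (hφ.differentiable (by simp) (fun x : Λ => c s x)).hasFDerivAt.comp_hasDerivAt s h1
    refine h2.congr_deriv ?_
    have h3 : (fun x : Λ => v x) = ∑ x : Λ, v x • (Pi.single x (1 : ℝ) : Λ → ℝ) := by
      ext y
      simp [Finset.sum_apply, Pi.single_apply]
    rw [h3, map_sum, ← Finset.sum_coe_sort Λ]
    refine Finset.sum_congr rfl fun x _ => ?_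
    simp

/-- Testing the chain rule of `exists_partial` on coordinate lines identifies the abstract
derivatives `D` with `partialDeriv`, which is defined through `deriv`. -/
lemma partialDeriv_spec (hf : SmoothOn Λ f) :
    (∀ z, SmoothOn Λ (partialDeriv z f)) ∧ (∀ z ∉ Λ, partialDeriv z f = 0) ∧
    ∀ (c : ℝ → Config d) (v : Config d) (s : ℝ),
      (∀ z ∈ Λ, HasDerivAt (fun r => c r z) (v z) s) →
        HasDerivAt (fun r => f (c r)) (∑ z ∈ Λ, v z * partialDeriv z f (c s)) s := by
  classical
  obtain ⟨D, hD, hchain⟩ := hf.exists_partial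
  have key : ∀ z p, partialDeriv z f p = if z ∈ Λ then D z p else 0 := by
    intro z p
    have h := hchain (fun s => Function.update p z s) (Pi.single z 1) (p z) (fun y _ => by
      by_cases hy : y = z
      · subst hy; simpa using hasDerivAt_id' (p y)
      · simpa [hy] using hasDerivAt_const (p z) (p y))
    rw [partialDeriv, h.deriv]
    simp [Pi.single_apply]
  refine ⟨fun z => ?_, fun z hz => ?_, fun c v s hc => ?_⟩
  · by_cases hz : z ∈ Λ
    · have : partialDeriv z f = D z := by funext p; simp [key, hz]
      rw [this]; exact hD z
    · have : partialDeriv z f = fun _ => 0 := by funext p; simp [key, hz]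
      rw [this]; exact const 0
  · funext p; simp [key, hz]
  · convert hchain c v s hc using 1
    exact Finset.sum_congr rfl fun z hz => by simp [key, hz]

lemma partialDeriv (hf : SmoothOn Λ f) (z : Site d) : SmoothOn Λ (partialDeriv z f) :=
  hf.partialDeriv_spec.1 z

lemma partialDeriv_eq_zero (hf : SmoothOn Λ f) {z : Site d} (hz : z ∉ Λ) :
    AEM.partialDeriv z f = 0 := hf.partialDeriv_spec.2.1 z hz

lemma hasDerivAt_update (hf : SmoothOn Λ f) (z : Site d) (p : Config d) :
    HasDerivAt (fun s => f (Function.update p z s)) (AEM.partialDeriv z f p) (p z) := by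
  classical
  have h := hf.partialDeriv_spec.2.2 (fun s => Function.update p z s) (Pi.single z 1) (p z)
    (fun y _ => by
      by_cases hy : y = z
      · subst hy; simpa using hasDerivAt_id' (p y)
      · simpa [hy] using hasDerivAt_const (p z) (p y))
  exact h.differentiableAt.hasDerivAt

lemma rot {x y : Site d} (hf : SmoothOn Λ f) (hx : x ∈ Λ) (hy : y ∈ Λ) : SmoothOn Λ (rot x y f) :=
  ((coord hy).mul (hf.partialDeriv x)).sub ((coord hx).mul (hf.partialDeriv y))

lemma rot_eq_zero {x y : Site d} (hf : SmoothOn Λ f) (hx : x ∉ Λ) (hy : y ∉ Λ) :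
    AEM.rot x y f = 0 := by
  funext p
  simp [AEM.rot, hf.partialDeriv_eq_zero hx, hf.partialDeriv_eq_zero hy]

end SmoothOn

lemma partialDeriv_mul (hf : SmoothOn Λ f) (hg : SmoothOn Λ' g) (x : Site d) (p : Config d) :
    partialDeriv x (fun p => f p * g p) p = partialDeriv x f p * g p + f p * partialDeriv x g p := by
  have := (hf.hasDerivAt_update x p).mul (hg.hasDerivAt_update x p)
  rw [Function.update_eq_self] at this
  exact this.deriv

lemma rot_mul (hf : SmoothOn Λ f) (hg : SmoothOn Λ' g) (x y : Site d) (p : Config d) :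
    rot x y (fun p => f p * g p) p = rot x y f p * g p + f p * rot x y g p := by
  simp only [rot, partialDeriv_mul hf hg]; ring

lemma partialDeriv_coord_self (x : Site d) (p : Config d) :
    partialDeriv x (fun q => q x) p = 1 := by
  simp [partialDeriv]

lemma partialDeriv_coord_of_ne {x y : Site d} (h : y ≠ x) (p : Config d) :
    partialDeriv x (fun q => q y) p = 0 := by
  simp [partialDeriv, Function.update_of_ne h]

lemma rot_coord_mul {x y : Site d} (h : x ≠ y) (p : Config d) :
    rot x y (fun p => p x * p y) p = energy y p - energy x p := by
  rw [rot_mul (SmoothOn.coord (Λ := {x, y}) (by simp)) (SmoothOn.coord (Λ := {x, y}) (by simp))]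
  simp only [rot, partialDeriv_coord_self, partialDeriv_coord_of_ne h,
    partialDeriv_coord_of_ne h.symm, energy]
  ring

lemma rotate_zero (x y : Site d) (p : Config d) : rotate x y 0 p = p := by
  funext z; unfold rotate; split_ifs with h1 h2 <;> simp [*]

/-- The rotations are the flow of the field `p_y ∂_{p_x} - p_x ∂_{p_y}`; this turns the invariance
of the measure into integration by parts. -/
lemma hasDerivAt_rotate {x y : Site d} (hxy : x ≠ y) (hf : SmoothOn Λ f) (p : Config d) (s : ℝ) :
    HasDerivAt (fun r => f (rotate x y r p)) (rot x y f (rotate x y s p)) s := by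
  classical
  have hf' : SmoothOn (insert x (insert y Λ)) f :=
    hf.mono fun z hz => by simp [hz]
  set q := rotate x y s p with hq
  have h := hf'.partialDeriv_spec.2.2 (fun r => rotate x y r p)
    (Pi.single x (q y) - Pi.single y (q x)) s (fun z _ => by
      have hqx : q x = Real.cos s * p x + Real.sin s * p y := by simp [hq, rotate]
      have hqy : q y = -Real.sin s * p x + Real.cos s * p y := by simp [hq, rotate, hxy.symm]
      by_cases hzx : z = x
      · subst hzx
        have := ((Real.hasDerivAt_cos s).mul_const (p z)).add
          ((Real.hasDerivAt_sin s).mul_const (p y))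
        simp only [rotate, if_true, Pi.sub_apply, Pi.single_eq_same, Pi.single_eq_of_ne hxy, hqy]
        exact this.congr_deriv (by ring)
      by_cases hzy : z = y
      · subst hzy
        have := ((Real.hasDerivAt_sin s).neg.mul_const (p x)).add
          ((Real.hasDerivAt_cos s).mul_const (p z))
        simp only [rotate, if_true, if_neg hzx, Pi.sub_apply, Pi.single_eq_same,
          Pi.single_eq_of_ne hzx, hqx]
        exact this.congr_deriv (by ring)
      · simpa [rotate, hzx, hzy] using hasDerivAt_const s (p z))
  refine h.congr_deriv ?_
  simp only [rot, Pi.sub_apply, sub_mul, Finset.sum_sub_distrib, Pi.single_apply, ite_mul, zero_mul,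
    Finset.sum_ite_eq', Finset.mem_insert, true_or, or_true, if_true, ← hq]

/-- The fields `p_y ∂_{p_x} - p_x ∂_{p_y}` have no divergence with respect to `μ_T`. -/
lemma integral_rot_eq_zero {x y : Site d} (hxy : x ≠ y) (hf : SmoothOn Λ f)
    (hi : Integrable f (gibbs d T)) (hri : Integrable (rot x y f) (gibbs d T)) :
    ∫ p, rot x y f p ∂gibbs d T = 0 := by
  classical
  have hrs : SmoothOn (insert x (insert y Λ)) (rot x y f) :=
    (hf.mono (Λ' := insert x (insert y Λ)) fun z hz => by simp [hz]).rot (by simp) (by simp)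
  set ν : Measure ℝ := volume.restrict (Set.uIoc 0 1) with hν
  have : IsFiniteMeasure ν := by rw [hν, Set.uIoc_of_le zero_le_one]; infer_instance
  -- Integrability of `rot x y f` under the measure alone gives joint integrability in the angle and
  -- the configuration, which Fubini needs.
  have hmp : MeasurePreserving (fun q : ℝ × Config d => (q.1, rotate x y q.1 q.2))
      (ν.prod (gibbs d T)) (ν.prod (gibbs d T)) :=
    (MeasurePreserving.id ν).skew_product (measurable_rotate_uncurry x y)
      (ae_of_all _ fun s => (measurePreserving_rotate hxy s).map_eq)
  have hint : Integrable (fun q : ℝ × Config d => rot x y f (rotate x y q.1 q.2))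
      (ν.prod (gibbs d T)) :=
    hmp.integrable_comp_of_integrable (g := fun q : ℝ × Config d => rot x y f q.2)
      (hri.comp_snd ν)
  have hcomp : ∀ s, ∫ p, rot x y f (rotate x y s p) ∂gibbs d T = ∫ p, rot x y f p ∂gibbs d T :=
    fun s => by
      have := integral_map (μ := gibbs d T) (measurable_rotate x y s).aemeasurable
        (f := rot x y f) hrs.aestronglyMeasurable
      rw [(measurePreserving_rotate hxy s).map_eq] at this
      exact this.symm
  have hf1 : ∫ p, f (rotate x y 1 p) ∂gibbs d T = ∫ p, f p ∂gibbs d T := by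
    have := integral_map (μ := gibbs d T) (measurable_rotate x y 1).aemeasurable
      (f := f) hf.aestronglyMeasurable
    rw [(measurePreserving_rotate hxy 1).map_eq] at this
    exact this.symm
  have hFTC : ∀ p, f (rotate x y 1 p) - f p = ∫ s, rot x y f (rotate x y s p) ∂ν := by
    intro p
    have hd : ∀ s ∈ Set.uIcc (0 : ℝ) 1, HasDerivAt (fun r => f (rotate x y r p))
        (rot x y f (rotate x y s p)) s := fun s _ => hasDerivAt_rotate hxy hf p s
    have hc : Continuous fun s => rot x y f (rotate x y s p) :=
      hrs.continuous.comp (continuous_pi fun z => by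
        unfold rotate; split_ifs <;> fun_prop)
    have := intervalIntegral.integral_eq_sub_of_hasDerivAt hd (hc.intervalIntegrable 0 1)
    rw [rotate_zero] at this
    rw [← this, intervalIntegral.integral_of_le zero_le_one, hν, Set.uIoc_of_le zero_le_one]
  -- By invariance the mean of `f ∘ R_1 - f` is zero; by `hFTC`, Fubini and invariance again it is
  -- also the mean of `rot x y f`.
  have h0 : ∫ p, (f (rotate x y 1 p) - f p) ∂gibbs d T = 0 := by
    have hfr : Integrable (fun p => f (rotate x y 1 p)) (gibbs d T) :=
      (measurePreserving_rotate hxy 1).integrable_comp_of_integrable hi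
    rw [integral_sub hfr hi, hf1, sub_self]
  simp_rw [hFTC] at h0
  rw [integral_integral_swap (f := fun p s => rot x y f (rotate x y s p)) hint.swap] at h0
  simp_rw [hcomp] at h0
  simpa [hν] using h0

end Calculus

/-! ### Polynomials in the momenta and their moments -/

section Polynomials

variable {d : ℕ} {T : ℝ}

/-- Polynomials in the momenta. -/
abbrev Pol (d : ℕ) := MvPolynomial (Site d) ℝ

/-- The function defined by a polynomial. -/
noncomputable def pev (P : Pol d) (p : Config d) : ℝ := MvPolynomial.eval p P

/-- The derivation `X_y ∂_x - X_x ∂_y`. -/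
noncomputable def rotP (x y : Site d) : Derivation ℝ (Pol d) (Pol d) :=
  (MvPolynomial.X y : Pol d) • MvPolynomial.pderiv x -
    (MvPolynomial.X x : Pol d) • MvPolynomial.pderiv y

lemma rotP_apply (x y : Site d) (P : Pol d) :
    rotP x y P = MvPolynomial.X y * MvPolynomial.pderiv x P -
      MvPolynomial.X x * MvPolynomial.pderiv y P := rfl

@[simp] lemma pev_add (P Q : Pol d) (p : Config d) : pev (P + Q) p = pev P p + pev Q p := by
  simp [pev]
@[simp] lemma pev_sub (P Q : Pol d) (p : Config d) : pev (P - Q) p = pev P p - pev Q p := by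
  simp [pev]
@[simp] lemma pev_mul (P Q : Pol d) (p : Config d) : pev (P * Q) p = pev P p * pev Q p := by
  simp [pev]
@[simp] lemma pev_C (c : ℝ) (p : Config d) : pev (MvPolynomial.C c) p = c := by simp [pev]
@[simp] lemma pev_X (x : Site d) (p : Config d) : pev (MvPolynomial.X x) p = p x := by simp [pev]
@[simp] lemma pev_zero (p : Config d) : pev 0 p = 0 := by simp [pev]
@[simp] lemma pev_one (p : Config d) : pev 1 p = 1 := by simp [pev]
@[simp] lemma pev_smul (c : ℝ) (P : Pol d) (p : Config d) : pev (c • P) p = c * pev P p := by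
  simp [pev]
@[simp] lemma pev_pow (P : Pol d) (n : ℕ) (p : Config d) : pev (P ^ n) p = pev P p ^ n := by
  simp [pev]
lemma pev_sum {ι : Type*} (s : Finset ι) (P : ι → Pol d) (p : Config d) :
    pev (∑ i ∈ s, P i) p = ∑ i ∈ s, pev (P i) p := by
  simp [pev]

lemma exists_smoothOn_pev (P : Pol d) : ∃ Λ, SmoothOn Λ (pev P) := by
  classical
  induction P using MvPolynomial.induction_on with
  | C c =>
    have : pev (MvPolynomial.C c : Pol d) = fun _ => c := by funext p; simp
    exact ⟨∅, this ▸ SmoothOn.const c⟩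
  | add P Q hP hQ =>
    obtain ⟨Λ₁, h₁⟩ := hP
    obtain ⟨Λ₂, h₂⟩ := hQ
    refine ⟨Λ₁ ∪ Λ₂, ?_⟩
    have := (h₁.mono (Finset.subset_union_left (s₂ := Λ₂))).add
      (h₂.mono (Finset.subset_union_right (s₁ := Λ₁)))
    simpa only [← pev_add] using this
  | mul_X P x hP =>
    obtain ⟨Λ, h⟩ := hP
    refine ⟨insert x Λ, ?_⟩
    have := (h.mono (Finset.subset_insert x Λ)).mul (SmoothOn.coord (Finset.mem_insert_self x Λ))
    convert this using 2
    simp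

lemma partialDeriv_pev (x : Site d) (P : Pol d) (p : Config d) :
    partialDeriv x (pev P) p = pev (MvPolynomial.pderiv x P) p := by
  classical
  induction P using MvPolynomial.induction_on generalizing p with
  | C c => simp [partialDeriv, pev]
  | add P Q hP hQ =>
    obtain ⟨Λ₁, h₁⟩ := exists_smoothOn_pev P
    obtain ⟨Λ₂, h₂⟩ := exists_smoothOn_pev Q
    have h := (h₁.hasDerivAt_update x p).add (h₂.hasDerivAt_update x p)
    rw [map_add, pev_add, ← hP, ← hQ, ← h.deriv, partialDeriv]
    congr 1
    funext s
    simp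
  | mul_X P y hP =>
    obtain ⟨Λ₁, h₁⟩ := exists_smoothOn_pev P
    have h2 : pev (P * MvPolynomial.X y) = fun p => pev P p * p y := by funext p; simp
    rw [h2, partialDeriv_mul h₁ (SmoothOn.coord (Λ := {y}) (by simp)), hP,
      Derivation.leibniz]
    by_cases hxy : y = x
    · subst hxy; simp [partialDeriv_coord_self]; ring
    · simp [partialDeriv_coord_of_ne hxy, MvPolynomial.pderiv_X_of_ne hxy]; ring

lemma rot_pev (x y : Site d) (P : Pol d) : rot x y (pev P) = pev (rotP x y P) := by
  funext p
  simp [rot, rotP_apply, partialDeriv_pev]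

/-- All exponents are handled in one induction, because a factor `p_y` is removed by Hölder's
inequality at the cost of doubling the exponent. -/
lemma memLp_pev (P : Pol d) (q : ℝ≥0) : MemLp (pev P) q (gibbs d T) := by
  induction P using MvPolynomial.induction_on generalizing q with
  | C c =>
    have : pev (MvPolynomial.C c : Pol d) = fun _ => c := by funext p; simp
    rw [this]; exact memLp_const c
  | add P Q hP hQ =>
    have : pev (P + Q) = pev P + pev Q := by funext p; simp
    rw [this]; exact (hP q).add (hQ q)
  | mul_X P y hP =>
    have : pev (P * MvPolynomial.X y) = fun p => pev P p * p y := by funext p; simp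
    rw [this]
    have h1 := hP (2 * q)
    have h2 : MemLp (fun p : Config d => p y) ((2 * q : ℝ≥0) : ℝ≥0∞) (gibbs d T) :=
      (memLp_id_gaussianReal (μ := 0) (v := T.toNNReal) (2 * q)).comp_measurePreserving
        (measurePreserving_eval y)
    have : ENNReal.HolderTriple ((2 * q : ℝ≥0) : ℝ≥0∞) ((2 * q : ℝ≥0) : ℝ≥0∞) q := by
      constructor
      rcases eq_or_ne q 0 with rfl | hq
      · simp
      rw [ENNReal.coe_mul, ENNReal.mul_inv (by simp) (by simp), ← two_mul, ← mul_assoc]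
      simp [ENNReal.mul_inv_cancel]
    exact h2.mul h1

lemma memLp_two_pev (P : Pol d) : MemLp (pev P) 2 (gibbs d T) := by
  exact_mod_cast memLp_pev P 2

lemma integrable_pev (P : Pol d) : Integrable (pev P) (gibbs d T) := by
  rw [← memLp_one_iff_integrable]; exact_mod_cast memLp_pev P 1

end Polynomials

/-! ### Radial cutoffs that commute with the rotation fields -/

section Cutoff

variable {d : ℕ} {T : ℝ} {Λ Λ' : Finset (Site d)} {f g : Config d → ℝ}

/-- A smooth radial cutoff in the momenta of `Λ`. -/
noncomputable def cutoff (Λ : Finset (Site d)) (n : ℕ) (p : Config d) : ℝ :=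
  Real.smoothTransition (2 - (∑ x ∈ Λ, p x * p x) / (n + 1))

lemma smoothOn_sum_sq (Λ : Finset (Site d)) : SmoothOn Λ (fun p => ∑ x ∈ Λ, p x * p x) :=
  SmoothOn.sum fun _ hx => (SmoothOn.coord hx).mul (SmoothOn.coord hx)

lemma smoothOn_cutoff (Λ : Finset (Site d)) (n : ℕ) : SmoothOn Λ (cutoff Λ n) := by
  refine (smoothOn_sum_sq Λ).comp_real
    (u := fun t => Real.smoothTransition (2 - t / ((n : ℝ) + 1))) ?_
  exact Real.smoothTransition.contDiff.comp (contDiff_const.sub (contDiff_id.div_const _))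

lemma cutoff_nonneg (Λ : Finset (Site d)) (n : ℕ) (p : Config d) : 0 ≤ cutoff Λ n p :=
  Real.smoothTransition.nonneg _

lemma cutoff_le_one (Λ : Finset (Site d)) (n : ℕ) (p : Config d) : cutoff Λ n p ≤ 1 :=
  Real.smoothTransition.le_one _

lemma tendsto_cutoff (Λ : Finset (Site d)) (p : Config d) :
    Tendsto (fun n => cutoff Λ n p) atTop (𝓝 1) := by
  obtain ⟨N, hN⟩ := exists_nat_ge (∑ x ∈ Λ, p x * p x)
  refine tendsto_const_nhds.congr' ?_
  filter_upwards [eventually_ge_atTop N] with n hn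
  refine (Real.smoothTransition.one_of_one_le ?_).symm
  have hn' : (N : ℝ) ≤ n := by exact_mod_cast hn
  have : (∑ x ∈ Λ, p x * p x) / ((n : ℝ) + 1) ≤ 1 := by
    rw [div_le_one (by positivity)]; linarith
  linarith

lemma sum_sq_rotate {x y : Site d} (hxy : x ≠ y) (hx : x ∈ Λ) (hy : y ∈ Λ) (s : ℝ)
    (p : Config d) :
    ∑ z ∈ Λ, rotate x y s p z * rotate x y s p z = ∑ z ∈ Λ, p z * p z := by
  classical
  have hy' : y ∈ Λ.erase x := Finset.mem_erase.2 ⟨hxy.symm, hy⟩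
  rw [← Finset.add_sum_erase Λ _ hx, ← Finset.add_sum_erase _ _ hy',
    ← Finset.add_sum_erase Λ (fun z => p z * p z) hx,
    ← Finset.add_sum_erase (Λ.erase x) (fun z => p z * p z) hy', ← add_assoc, ← add_assoc]
  congr 1
  · simp only [rotate, if_true, if_neg hxy.symm]
    linear_combination (p x * p x + p y * p y) * Real.sin_sq_add_cos_sq s
  · refine Finset.sum_congr rfl fun z hz => ?_
    simp only [Finset.mem_erase] at hz
    simp [rotate, hz.1, hz.2.1]

/-- A radial function is constant along the rotations. The cutoff therefore behaves as a constant
under all the fields in play, and integrations by parts under it leave no error term. -/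
lemma rot_cutoff {x y : Site d} (hxy : x ≠ y) (hx : x ∈ Λ) (hy : y ∈ Λ) (n : ℕ) (p : Config d) :
    rot x y (cutoff Λ n) p = 0 := by
  have h := hasDerivAt_rotate hxy (smoothOn_cutoff Λ n) p 0
  rw [rotate_zero] at h
  refine h.unique ?_
  simp only [cutoff, sum_sq_rotate hxy hx hy]
  exact hasDerivAt_const _ _

lemma exists_bound_cutoff_mul (hg : SmoothOn Λ g) (n : ℕ) :
    ∃ C, ∀ p, ‖cutoff Λ n p * g p‖ ≤ C := by
  obtain ⟨φ, hφ, rfl⟩ := hg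
  -- Beyond this squared radius the argument of the transition function is nonpositive and the
  -- cutoff vanishes.
  set r : ℝ := 2 * (n + 1) with hr
  obtain ⟨C, hC⟩ := (isCompact_closedBall (0 : Λ → ℝ) (r + 1)).exists_bound_of_continuousOn
    hφ.continuous.continuousOn
  refine ⟨max C 0, fun p => ?_⟩
  by_cases h : ∑ x ∈ Λ, p x * p x ≤ r
  · have hmem : (fun x : Λ => p x) ∈ Metric.closedBall (0 : Λ → ℝ) (r + 1) := by
      rw [mem_closedBall_zero_iff, pi_norm_le_iff_of_nonneg (by positivity)]
      intro x
      have h1 : p x * p x ≤ ∑ x ∈ Λ, p x * p x :=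
        Finset.single_le_sum (f := fun x => p x * p x) (fun z _ => mul_self_nonneg (p z)) x.2
      rw [Real.norm_eq_abs]
      nlinarith [abs_mul_abs_self (p x), abs_nonneg (p x), sq_nonneg (|p x| - 1)]
    rw [norm_mul]
    have h2 := hC _ hmem
    have h3 : ‖cutoff Λ n p‖ ≤ 1 := by
      rw [Real.norm_of_nonneg (cutoff_nonneg _ _ _)]; exact cutoff_le_one _ _ _
    calc _ ≤ 1 * C := mul_le_mul h3 h2 (norm_nonneg _) zero_le_one
      _ ≤ _ := by simp
  · have : cutoff Λ n p = 0 := by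
      refine Real.smoothTransition.zero_of_nonpos ?_
      rw [sub_nonpos, le_div_iff₀ (by positivity)]
      exact (not_le.1 h).le
    simp [this]

lemma integrable_cutoff_mul (hg : SmoothOn Λ g) (n : ℕ) :
    Integrable (fun p => cutoff Λ n p * g p) (gibbs d T) := by
  obtain ⟨C, hC⟩ := exists_bound_cutoff_mul hg n
  exact Integrable.of_bound ((smoothOn_cutoff Λ n).mul hg).aestronglyMeasurable C (ae_of_all _ hC)

lemma integral_cutoff_mul_rot {x y : Site d} (hxy : x ≠ y) (hx : x ∈ Λ) (hy : y ∈ Λ)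
    (hg : SmoothOn Λ g) (n : ℕ) :
    ∫ p, cutoff Λ n p * rot x y g p ∂gibbs d T = 0 := by
  have h : rot x y (fun p => cutoff Λ n p * g p) = fun p => cutoff Λ n p * rot x y g p := by
    funext p
    rw [rot_mul (smoothOn_cutoff Λ n) hg, rot_cutoff hxy hx hy]; ring
  rw [← h]
  refine integral_rot_eq_zero hxy ((smoothOn_cutoff Λ n).mul hg) (integrable_cutoff_mul hg n) ?_
  rw [h]
  exact integrable_cutoff_mul (hg.rot hx hy) n

lemma tendsto_integral_cutoff_mul (hg : Integrable g (gibbs d T)) (Λ : Finset (Site d)) :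
    Tendsto (fun n => ∫ p, cutoff Λ n p * g p ∂gibbs d T) atTop (𝓝 (∫ p, g p ∂gibbs d T)) := by
  refine tendsto_integral_of_dominated_convergence (fun p => ‖g p‖) (fun n => ?_) hg.norm
    (fun n => ae_of_all _ fun p => ?_) (ae_of_all _ fun p => ?_)
  · exact (smoothOn_cutoff Λ n).aestronglyMeasurable.mul hg.aestronglyMeasurable
  · rw [norm_mul, Real.norm_of_nonneg (cutoff_nonneg _ _ _)]
    exact mul_le_of_le_one_left (norm_nonneg _) (cutoff_le_one _ _ _)
  · simpa using (tendsto_cutoff Λ p).mul_const (g p)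

end Cutoff

/-! ### The generator on local functions and its Dirichlet form -/

section Generator

variable {d : ℕ} {T : ℝ} {a : Fin d → ℝ} {Λ X : Finset (Site d)} {f g : Config d → ℝ}

/-- `X` contains the lower end points of all bonds that touch `Λ`. -/
def TouchedBy (Λ X : Finset (Site d)) : Prop :=
  ∀ x ∉ X, x ∉ Λ ∧ ∀ i, x + e i ∉ Λ

lemma exists_touchedBy (Λ Y : Finset (Site d)) : ∃ X, TouchedBy Λ X ∧ Y ⊆ X ∧ Λ ⊆ X := by
  classical
  refine ⟨Y ∪ (Λ ∪ Finset.univ.biUnion fun i : Fin d => Λ.image (· - e i)), fun x hx => ?_,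
    Finset.subset_union_left, fun x hx => by simp [hx]⟩
  simp only [Finset.mem_union, Finset.mem_biUnion, Finset.mem_image, not_or, not_exists,
    Finset.mem_univ, true_and, not_and] at hx
  exact ⟨hx.2.1, fun i hi => hx.2.2 i (x + e i) hi (by simp)⟩

lemma exists_notMem [Nonempty (Fin d)] (Λ : Finset (Site d)) : ∃ o, o ∉ Λ :=
  Infinite.exists_notMem_finset Λ

lemma rot_zero (x y : Site d) : rot x y (0 : Config d → ℝ) = 0 := by
  funext p; simp [rot, partialDeriv]

lemma gen_eq_sum (hf : SmoothOn Λ f) (hX : TouchedBy Λ X) (p : Config d) :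
    gen a f p = ∑ i, ∑ x ∈ X, (rot x (x + e i) (rot x (x + e i) f) p +
      a i * (p x * p (x + e i) * rot x (x + e i) f p)) := by
  have h0 : ∀ i, ∀ x ∉ X, rot x (x + e i) f = 0 := fun i x hx =>
    hf.rot_eq_zero (hX x hx).1 ((hX x hx).2 i)
  simp only [gen, genS, genA, Finset.sum_add_distrib]
  congr 1
  · refine Finset.sum_congr rfl fun i _ => finsum_eq_sum_of_support_subset _ fun x hx => ?_
    by_contra hxX
    exact hx (by simp only [h0 i x hxX, rot_zero]; rfl)
  · refine Finset.sum_congr rfl fun i _ => ?_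
    rw [← Finset.mul_sum]
    congr 1
    refine finsum_eq_sum_of_support_subset _ fun x hx => ?_
    by_contra hxX
    exact hx (by simp [h0 i x hxX])

/-- Telescoping: `X` contains `Λ` and `Λ - e_i`, so both sums reduce to the sum of `I` over `Λ`. It
disposes of every contribution of the antisymmetric part that is a difference of a quantity at the
two ends of a bond. -/
lemma sum_shift_sub_eq_zero {I : Site d → ℝ} (hX : TouchedBy Λ X) (i : Fin d)
    (h0 : ∀ x ∈ X, (x ∉ Λ → I x = 0) ∧ (x + e i ∉ Λ → I (x + e i) = 0)) :
    ∑ x ∈ X, (I (x + e i) - I x) = 0 := by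
  classical
  have hΛX : Λ ⊆ X := fun x hx => by by_contra h; exact (hX x h).1 hx
  rw [Finset.sum_sub_distrib, sub_eq_zero]
  have h1 : ∑ x ∈ X, I x = ∑ x ∈ Λ, I x :=
    (Finset.sum_subset hΛX fun x hx hxΛ => (h0 x hx).1 hxΛ).symm
  rw [h1, ← Finset.sum_filter_add_sum_filter_not X (fun x => x + e i ∈ Λ)]
  rw [Finset.sum_eq_zero (s := X.filter (fun x => x + e i ∉ Λ)) (fun x hx => by
    rw [Finset.mem_filter] at hx; exact (h0 x hx.1).2 hx.2), add_zero]
  refine Finset.sum_bij (fun x _ => x + e i) (fun x hx => (Finset.mem_filter.1 hx).2)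
    (fun x _ y _ h => by simpa using h) (fun y hy => ?_) (fun _ _ => rfl)
  refine ⟨y - e i, ?_, by simp⟩
  rw [Finset.mem_filter, sub_add_cancel]
  refine ⟨?_, hy⟩
  by_contra h
  exact (hX _ h).2 i (by simpa using hy)

lemma SmoothOn.gen_touched (hf : SmoothOn Λ f) (hX : TouchedBy Λ X) {Λ' : Finset (Site d)}
    (hΛ : Λ ⊆ Λ') (hXΛ : X ⊆ Λ') (hXe : ∀ i, ∀ x ∈ X, x + e i ∈ Λ') : SmoothOn Λ' (gen a f) := by
  have : gen a f = fun p => ∑ i, ∑ x ∈ X, (AEM.rot x (x + e i) (AEM.rot x (x + e i) f) p +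
      a i * (p x * p (x + e i) * AEM.rot x (x + e i) f p)) := by
    funext p; exact gen_eq_sum hf hX p
  rw [this]
  have hf' := hf.mono hΛ
  refine SmoothOn.sum fun i _ => SmoothOn.sum fun x hx => ?_
  have hr := hf'.rot (hXΛ hx) (hXe i x hx)
  exact (hr.rot (hXΛ hx) (hXe i x hx)).add ((SmoothOn.const (a i)).mul
    (((SmoothOn.coord (hXΛ hx)).mul (SmoothOn.coord (hXe i x hx))).mul hr))

lemma exists_enlargement (X Λ : Finset (Site d)) (o : Site d) : ∃ Λ' : Finset (Site d),
    Λ ⊆ Λ' ∧ X ⊆ Λ' ∧ (∀ i, ∀ x ∈ X, x + e i ∈ Λ') ∧ o ∈ Λ' := by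
  classical
  refine ⟨insert o (Λ ∪ (X ∪ Finset.univ.biUnion fun i : Fin d => X.image (· + e i))),
    fun x hx => by simp [hx], fun x hx => by simp [hx], fun i x hx => ?_, by simp⟩
  refine Finset.mem_insert_of_mem (Finset.mem_union_right _ (Finset.mem_union_right _ ?_))
  exact Finset.mem_biUnion.2 ⟨i, Finset.mem_univ i, Finset.mem_image_of_mem _ hx⟩

/-- The Dirichlet form identity with a cutoff. -/
lemma exists_integral_cutoff_mul_gen [Nonempty (Fin d)] (hf : SmoothOn Λ f)
    (hX : TouchedBy Λ X) : ∃ Λ', SmoothOn Λ' (gen a f) ∧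
      (∀ i, ∀ x ∈ X, SmoothOn Λ' (rot x (x + e i) f)) ∧ ∀ n,
      ∑ i, ∑ x ∈ X, ∫ p, cutoff Λ' n p * (rot x (x + e i) f p * rot x (x + e i) f p) ∂gibbs d T =
        -∫ p, cutoff Λ' n p * (f p * gen a f p) ∂gibbs d T := by
  -- A reference site off the support of `f`. Energies are compared with `E_o`, so that no mean
  -- value has to be computed.
  obtain ⟨o, ho⟩ := exists_notMem Λ
  obtain ⟨Λ', hΛ, hXΛ, hXe, hoΛ⟩ := exists_enlargement X Λ o
  have hf' := hf.mono hΛ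
  have hr : ∀ i, ∀ x ∈ X, SmoothOn Λ' (rot x (x + e i) f) := fun i x hx =>
    hf'.rot (hXΛ hx) (hXe i x hx)
  refine ⟨Λ', hf.gen_touched hX hΛ hXΛ hXe, hr, fun n => ?_⟩
  have hrr : ∀ i, ∀ x ∈ X, SmoothOn Λ' (rot x (x + e i) (rot x (x + e i) f)) := fun i x hx =>
    (hr i x hx).rot (hXΛ hx) (hXe i x hx)
  have hpp : ∀ i, ∀ x ∈ X, SmoothOn Λ' (fun p => p x * p (x + e i)) := fun i x hx =>
    (SmoothOn.coord (hXΛ hx)).mul (SmoothOn.coord (hXe i x hx))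
  have hen : ∀ u ∈ Λ', SmoothOn Λ' (energy u) := fun u hu => by
    have : energy u = fun p : Config d => p u * p u := by funext p; simp [energy, pow_two]
    rw [this]; exact (SmoothOn.coord hu).mul (SmoothOn.coord hu)
  -- the symmetric part
  have hS : ∀ i, ∀ x ∈ X, ∫ p, cutoff Λ' n p * (f p * rot x (x + e i) (rot x (x + e i) f) p) ∂gibbs d T =
      -∫ p, cutoff Λ' n p * (rot x (x + e i) f p * rot x (x + e i) f p) ∂gibbs d T := by
    intro i x hx
    have h := integral_cutoff_mul_rot (T := T) (ne_add_e x i) (hXΛ hx) (hXe i x hx)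
      (hf'.mul (hr i x hx)) n
    simp only [rot_mul hf' (hr i x hx), mul_add] at h
    rw [integral_add (integrable_cutoff_mul ((hr i x hx).mul (hr i x hx)) n)
      (integrable_cutoff_mul (hf'.mul (hrr i x hx)) n)] at h
    linarith
  -- the antisymmetric part
  set I : Site d → ℝ := fun u => ∫ p, cutoff Λ' n p * (f p * f p * (energy u p - energy o p)) ∂gibbs d T
    with hI
  -- For `u` and `o` both off the support, `f² (E_u - E_o)` equals `rot o u (f² p_o p_u)` and
  -- integrates to zero under the cutoff.
  have hI0 : ∀ u ∈ Λ', u ∉ Λ → I u = 0 := by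
    intro u hu huΛ
    by_cases huo : u = o
    · simp [hI, huo]
    have huo' : o ≠ u := fun h => huo h.symm
    have h := integral_cutoff_mul_rot (T := T) huo' hoΛ hu
      ((hf'.mul hf').mul ((SmoothOn.coord hoΛ).mul (SmoothOn.coord hu))) n
    rw [← h, hI]
    refine integral_congr_ae (ae_of_all _ fun p => ?_)
    simp only []
    rw [rot_mul (hf'.mul hf') ((SmoothOn.coord hoΛ).mul (SmoothOn.coord hu)), rot_mul hf' hf',
      rot_coord_mul huo', hf.rot_eq_zero ho huΛ]
    simp
  -- Since `f rot f = rot (f²) / 2`, an integration by parts puts the field on `p_x p_{x+e_i}` and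
  -- leaves the difference of two energies against `f²`.
  have hA : ∀ i, ∀ x ∈ X, ∫ p, cutoff Λ' n p * (f p * (p x * p (x + e i) * rot x (x + e i) f p)) ∂gibbs d T =
      -(I (x + e i) - I x) / 2 := by
    intro i x hx
    have h := integral_cutoff_mul_rot (T := T) (ne_add_e x i) (hXΛ hx) (hXe i x hx)
      ((hf'.mul hf').mul (hpp i x hx)) n
    have e1 : ∀ p, cutoff Λ' n p * rot x (x + e i) (fun p => f p * f p * (p x * p (x + e i))) p =
        2 * (cutoff Λ' n p * (f p * (p x * p (x + e i) * rot x (x + e i) f p))) +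
          (cutoff Λ' n p * (f p * f p * (energy (x + e i) p - energy o p)) -
            cutoff Λ' n p * (f p * f p * (energy x p - energy o p))) := by
      intro p
      rw [rot_mul (hf'.mul hf') (hpp i x hx), rot_mul hf' hf', rot_coord_mul (ne_add_e x i)]
      ring
    have i1 := integrable_cutoff_mul (T := T) (hf'.mul ((hpp i x hx).mul (hr i x hx))) n
    have i2 : ∀ u ∈ Λ', Integrable (fun p => cutoff Λ' n p * (f p * f p * (energy u p - energy o p)))
        (gibbs d T) := fun u hu =>
      integrable_cutoff_mul ((hf'.mul hf').mul ((hen u hu).sub (hen o hoΛ))) n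
    simp_rw [e1] at h
    have i3 : Integrable (fun p => cutoff Λ' n p * (f p * f p * (energy (x + e i) p - energy o p)) -
        cutoff Λ' n p * (f p * f p * (energy x p - energy o p))) (gibbs d T) :=
      (i2 _ (hXe i x hx)).sub (i2 _ (hXΛ hx))
    rw [integral_add (i1.const_mul 2) i3,
      integral_const_mul, integral_sub (i2 _ (hXe i x hx)) (i2 _ (hXΛ hx))] at h
    simp only [hI]
    linarith
  have hexp : ∫ p, cutoff Λ' n p * (f p * gen a f p) ∂gibbs d T = ∑ i, ∑ x ∈ X,
      (∫ p, cutoff Λ' n p * (f p * rot x (x + e i) (rot x (x + e i) f) p) ∂gibbs d T + a i *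
        ∫ p, cutoff Λ' n p * (f p * (p x * p (x + e i) * rot x (x + e i) f p)) ∂gibbs d T) := by
    have e2 : ∀ p, cutoff Λ' n p * (f p * gen a f p) = ∑ i, ∑ x ∈ X,
        (cutoff Λ' n p * (f p * rot x (x + e i) (rot x (x + e i) f) p) +
          a i * (cutoff Λ' n p * (f p * (p x * p (x + e i) * rot x (x + e i) f p)))) := by
      intro p
      rw [gen_eq_sum hf hX, Finset.mul_sum, Finset.mul_sum]
      refine Finset.sum_congr rfl fun i _ => ?_
      rw [Finset.mul_sum, Finset.mul_sum]
      refine Finset.sum_congr rfl fun x _ => by ring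
    simp_rw [e2]
    have j1 : ∀ i, ∀ x ∈ X, Integrable
        (fun p => cutoff Λ' n p * (f p * rot x (x + e i) (rot x (x + e i) f) p)) (gibbs d T) :=
      fun i x hx => integrable_cutoff_mul (hf'.mul (hrr i x hx)) n
    have j2 : ∀ i, ∀ x ∈ X, Integrable
        (fun p => a i * (cutoff Λ' n p * (f p * (p x * p (x + e i) * rot x (x + e i) f p)))) (gibbs d T) :=
      fun i x hx => (integrable_cutoff_mul (hf'.mul ((hpp i x hx).mul (hr i x hx))) n).const_mul _
    have j3 : ∀ i, ∀ x ∈ X, Integrable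
        (fun p => cutoff Λ' n p * (f p * rot x (x + e i) (rot x (x + e i) f) p) +
          a i * (cutoff Λ' n p * (f p * (p x * p (x + e i) * rot x (x + e i) f p))))
        (gibbs d T) := fun i x hx => (j1 i x hx).add (j2 i x hx)
    rw [integral_finsetSum _ fun i _ => integrable_finsetSum _ fun x hx => j3 i x hx]
    refine Finset.sum_congr rfl fun i _ => ?_
    rw [integral_finsetSum _ fun x hx => j3 i x hx]
    refine Finset.sum_congr rfl fun x hx => ?_
    rw [integral_add (j1 i x hx) (j2 i x hx), integral_const_mul]
  rw [hexp, ← Finset.sum_neg_distrib]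
  refine Finset.sum_congr rfl fun i _ => ?_
  -- The energy differences telescope in each direction, so the antisymmetric part drops out.
  have hz := sum_shift_sub_eq_zero (I := I) hX i fun x hx =>
    ⟨hI0 x (hXΛ hx), hI0 _ (hXe i x hx)⟩
  have hc : ∑ x ∈ X, (∫ p, cutoff Λ' n p * (f p * rot x (x + e i) (rot x (x + e i) f) p)
      ∂gibbs d T + a i * ∫ p, cutoff Λ' n p * (f p * (p x * p (x + e i) * rot x (x + e i) f p))
      ∂gibbs d T) = ∑ x ∈ X, (-∫ p, cutoff Λ' n p *
        (rot x (x + e i) f p * rot x (x + e i) f p) ∂gibbs d T +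
        -(a i / 2) * (I (x + e i) - I x)) :=
    Finset.sum_congr rfl fun x hx => by rw [hS i x hx, hA i x hx]; ring
  rw [hc, Finset.sum_add_distrib, ← Finset.mul_sum, hz, Finset.sum_neg_distrib]
  ring

/-- The Dirichlet form of a smooth local function in the initial domain is finite. -/
lemma dirichlet_le [Nonempty (Fin d)] (hf : SmoothOn Λ f) (h2 : MemLp f 2 (gibbs d T))
    (hg : MemLp (gen a f) 2 (gibbs d T)) :
    (∀ i x, MemLp (rot x (x + e i) f) 2 (gibbs d T)) ∧ ∀ Y : Finset (Site d),
      ∑ i, ∑ x ∈ Y, ∫ p, rot x (x + e i) f p * rot x (x + e i) f p ∂gibbs d T ≤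
        -∫ p, f p * gen a f p ∂gibbs d T := by
  have main : ∀ X, TouchedBy Λ X →
      (∀ i, ∀ x ∈ X, Integrable (fun p => rot x (x + e i) f p * rot x (x + e i) f p) (gibbs d T)) ∧
      ∑ i, ∑ x ∈ X, ∫ p, rot x (x + e i) f p * rot x (x + e i) f p ∂gibbs d T ≤
        -∫ p, f p * gen a f p ∂gibbs d T := by
    intro X hX
    obtain ⟨Λ', hgs, hr, hid⟩ := exists_integral_cutoff_mul_gen (a := a) (T := T) hf hX
    set h : Config d → ℝ := fun p => ∑ i, ∑ x ∈ X, rot x (x + e i) f p * rot x (x + e i) f p with hh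
    have hs : SmoothOn Λ' h := SmoothOn.sum fun i _ => SmoothOn.sum fun x hx =>
      (hr i x hx).mul (hr i x hx)
    have hnn : ∀ p, 0 ≤ h p := fun p => Finset.sum_nonneg fun i _ => Finset.sum_nonneg fun x _ =>
      mul_self_nonneg _
    have hsum : ∀ n, ∫ p, cutoff Λ' n p * h p ∂gibbs d T =
        -∫ p, cutoff Λ' n p * (f p * gen a f p) ∂gibbs d T := by
      intro n
      rw [← hid n]
      simp only [hh, Finset.mul_sum]
      have j : ∀ i, ∀ x ∈ X, Integrable (fun p => cutoff Λ' n p *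
          (rot x (x + e i) f p * rot x (x + e i) f p)) (gibbs d T) := fun i x hx =>
        integrable_cutoff_mul ((hr i x hx).mul (hr i x hx)) n
      rw [integral_finsetSum _ fun i _ => integrable_finsetSum _ fun x hx => j i x hx]
      exact Finset.sum_congr rfl fun i _ => integral_finsetSum _ fun x hx => j i x hx
    have hfg : Integrable (fun p => f p * gen a f p) (gibbs d T) := h2.integrable_mul hg
    have hlim : Tendsto (fun n => ∫ p, cutoff Λ' n p * h p ∂gibbs d T) atTop
        (𝓝 (-∫ p, f p * gen a f p ∂gibbs d T)) := by
      simp_rw [hsum]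
      exact (tendsto_integral_cutoff_mul hfg Λ').neg
    have hlim0 : 0 ≤ -∫ p, f p * gen a f p ∂gibbs d T :=
      ge_of_tendsto' hlim fun n => integral_nonneg fun p => mul_nonneg (cutoff_nonneg _ _ _) (hnn p)
    -- Integrability of the squared gradients is not known beforehand. Fatou's lemma gives it
    -- together with the inequality, since the identities with cutoff have a finite limit.
    have hfatou : ∫⁻ p, ENNReal.ofReal (h p) ∂gibbs d T ≤
        ENNReal.ofReal (-∫ p, f p * gen a f p ∂gibbs d T) := by
      have h1 : ∀ p, ENNReal.ofReal (h p) ≤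
          liminf (fun n => ENNReal.ofReal (cutoff Λ' n p * h p)) atTop := by
        intro p
        have : Tendsto (fun n => ENNReal.ofReal (cutoff Λ' n p * h p)) atTop
            (𝓝 (ENNReal.ofReal (h p))) :=
          ENNReal.tendsto_ofReal (by simpa using (tendsto_cutoff Λ' p).mul_const (h p))
        exact this.liminf_eq.ge
      calc _ ≤ ∫⁻ p, liminf (fun n => ENNReal.ofReal (cutoff Λ' n p * h p)) atTop ∂gibbs d T :=
            lintegral_mono h1
        _ ≤ liminf (fun n => ∫⁻ p, ENNReal.ofReal (cutoff Λ' n p * h p) ∂gibbs d T) atTop :=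
            lintegral_liminf_le fun n => ((smoothOn_cutoff Λ' n).mul hs).measurable.ennreal_ofReal
        _ = _ := by
            have : Tendsto (fun n => ∫⁻ p, ENNReal.ofReal (cutoff Λ' n p * h p) ∂gibbs d T) atTop
                (𝓝 (ENNReal.ofReal (-∫ p, f p * gen a f p ∂gibbs d T))) := by
              have e : ∀ n, ∫⁻ p, ENNReal.ofReal (cutoff Λ' n p * h p) ∂gibbs d T =
                  ENNReal.ofReal (∫ p, cutoff Λ' n p * h p ∂gibbs d T) := fun n =>
                (ofReal_integral_eq_lintegral_ofReal (integrable_cutoff_mul hs n)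
                  (ae_of_all _ fun p => mul_nonneg (cutoff_nonneg _ _ _) (hnn p))).symm
              simp_rw [e]
              exact ENNReal.tendsto_ofReal hlim
            exact this.liminf_eq
    have hint : Integrable h (gibbs d T) := by
      refine ⟨hs.aestronglyMeasurable, ?_⟩
      rw [hasFiniteIntegral_iff_ofReal (ae_of_all _ hnn)]
      exact hfatou.trans_lt ENNReal.ofReal_lt_top
    have hone : ∀ i, ∀ x ∈ X,
        Integrable (fun p => rot x (x + e i) f p * rot x (x + e i) f p) (gibbs d T) := by
      intro i x hx
      refine hint.mono' ((hr i x hx).mul (hr i x hx)).aestronglyMeasurable (ae_of_all _ fun p => ?_)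
      rw [Real.norm_of_nonneg (mul_self_nonneg _)]
      calc _ ≤ ∑ x ∈ X, rot x (x + e i) f p * rot x (x + e i) f p :=
            Finset.single_le_sum (f := fun x => rot x (x + e i) f p * rot x (x + e i) f p)
              (fun _ _ => mul_self_nonneg _) hx
        _ ≤ _ := Finset.single_le_sum
            (f := fun i => ∑ x ∈ X, rot x (x + e i) f p * rot x (x + e i) f p)
            (fun _ _ => Finset.sum_nonneg fun _ _ => mul_self_nonneg _) (Finset.mem_univ i)
    refine ⟨hone, ?_⟩
    have : ∑ i, ∑ x ∈ X, ∫ p, rot x (x + e i) f p * rot x (x + e i) f p ∂gibbs d T =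
        ∫ p, h p ∂gibbs d T := by
      rw [integral_finsetSum _ fun i _ => integrable_finsetSum _ fun x hx => hone i x hx]
      exact Finset.sum_congr rfl fun i _ => (integral_finsetSum _ fun x hx => hone i x hx).symm
    rw [this, ← ENNReal.ofReal_le_ofReal_iff hlim0,
      ofReal_integral_eq_lintegral_ofReal hint (ae_of_all _ hnn)]
    exact hfatou
  refine ⟨fun i x => ?_, fun Y => ?_⟩
  · obtain ⟨X, hX, hx, -⟩ := exists_touchedBy Λ {x}
    have hxX : x ∈ X := hx (by simp)
    obtain ⟨Λ', -, hr, -⟩ := exists_integral_cutoff_mul_gen (a := a) (T := T) hf hX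
    rw [memLp_two_iff_integrable_sq (hr i x hxX).aestronglyMeasurable]
    simpa only [pow_two] using (main X hX).1 i x hxX
  · obtain ⟨X, hX, hY, -⟩ := exists_touchedBy Λ Y
    refine le_trans (Finset.sum_le_sum fun i _ => ?_) (main X hX).2
    exact Finset.sum_le_sum_of_subset_of_nonneg hY fun x _ _ =>
      integral_nonneg fun p => mul_self_nonneg _

end Generator

/-! ### The adjoint of the generator on polynomials -/

section Adjoint

variable {d : ℕ} {T : ℝ} {a : Fin d → ℝ} {Λ X : Finset (Site d)} {f g : Config d → ℝ}

lemma integrable_pev_mul (P : Pol d) (hf : MemLp f 2 (gibbs d T)) :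
    Integrable (fun p => pev P p * f p) (gibbs d T) :=
  (memLp_two_pev P).integrable_mul hf

lemma integral_pev_mul_rot {x y : Site d} (hxy : x ≠ y) (hf : SmoothOn Λ f)
    (h2 : MemLp f 2 (gibbs d T)) (hr : MemLp (rot x y f) 2 (gibbs d T)) (Q : Pol d) :
    ∫ p, pev Q p * rot x y f p ∂gibbs d T = -∫ p, pev (rotP x y Q) p * f p ∂gibbs d T := by
  obtain ⟨Λ', hQ⟩ := exists_smoothOn_pev Q
  classical
  have hf' := hf.mono (Finset.subset_union_left (s₂ := Λ'))
  have hQ' := hQ.mono (Finset.subset_union_right (s₁ := Λ))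
  have e1 : rot x y (fun p => pev Q p * f p) = fun p =>
      pev (rotP x y Q) p * f p + pev Q p * rot x y f p := by
    funext p; rw [rot_mul hQ' hf', rot_pev]
  have i1 := integrable_pev_mul (T := T) (rotP x y Q) h2
  have i2 := integrable_pev_mul (T := T) Q hr
  have h := integral_rot_eq_zero hxy (hQ'.mul hf') (integrable_pev_mul Q h2)
    (by rw [e1]; exact i1.add i2)
  rw [e1, integral_add i1 i2] at h
  linarith

/-- The action of the symmetric part on polynomials, with the bonds restricted to `X`. -/
noncomputable def polS (X : Finset (Site d)) (P : Pol d) : Pol d :=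
  ∑ i, ∑ x ∈ X, rotP x (x + e i) (rotP x (x + e i) P)

/-- The action of the antisymmetric part on polynomials, with the bonds restricted to `X`. -/
noncomputable def polA (a : Fin d → ℝ) (X : Finset (Site d)) (P : Pol d) : Pol d :=
  ∑ i, ∑ x ∈ X, a i • (MvPolynomial.X x * MvPolynomial.X (x + e i) * rotP x (x + e i) P)

lemma rotP_X_mul_X {x y : Site d} (hxy : x ≠ y) :
    rotP x y (MvPolynomial.X x * MvPolynomial.X y : Pol d) =
      MvPolynomial.X y ^ 2 - MvPolynomial.X x ^ 2 := by
  classical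
  simp [rotP_apply, Derivation.leibniz, MvPolynomial.pderiv_X_of_ne hxy,
    MvPolynomial.pderiv_X_of_ne hxy.symm]
  ring

/-- The second derivatives of `f` need not be integrable. Under the cutoff one of them is moved to
`P`; the remaining first derivatives are in `L²` by `dirichlet_le`, so the cutoff can be removed
afterwards. -/
lemma tendsto_integral_gen_mul [Nonempty (Fin d)] (hf : SmoothOn Λ f)
    (h2 : MemLp f 2 (gibbs d T)) (hg : MemLp (gen a f) 2 (gibbs d T))
    {P : Pol d} (hP : SmoothOn Λ (pev P)) (hX : TouchedBy Λ X) :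
    ∫ p, pev P p * gen a f p ∂gibbs d T = ∑ i, ∑ x ∈ X,
      (-∫ p, pev (rotP x (x + e i) P) p * rot x (x + e i) f p ∂gibbs d T +
        a i * ∫ p, pev (P * (MvPolynomial.X x * MvPolynomial.X (x + e i))) p *
          rot x (x + e i) f p ∂gibbs d T) := by
  obtain ⟨o, -⟩ := exists_notMem Λ
  obtain ⟨Λ', hΛ, hXΛ, hXe, -⟩ := exists_enlargement X Λ o
  have hf' := hf.mono hΛ
  have hP' := hP.mono hΛ
  have hL2 := (dirichlet_le hf h2 hg).1
  have hr : ∀ i, ∀ x ∈ X, SmoothOn Λ' (rot x (x + e i) f) := fun i x hx =>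
    hf'.rot (hXΛ hx) (hXe i x hx)
  have hrr : ∀ i, ∀ x ∈ X, SmoothOn Λ' (rot x (x + e i) (rot x (x + e i) f)) := fun i x hx =>
    (hr i x hx).rot (hXΛ hx) (hXe i x hx)
  have hrP : ∀ i, ∀ x ∈ X, SmoothOn Λ' (pev (rotP x (x + e i) P)) := fun i x hx => by
    rw [← rot_pev]; exact hP'.rot (hXΛ hx) (hXe i x hx)
  have hPX : ∀ i, ∀ x ∈ X,
      SmoothOn Λ' (pev (P * (MvPolynomial.X x * MvPolynomial.X (x + e i)))) := fun i x hx => by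
    have : pev (P * (MvPolynomial.X x * MvPolynomial.X (x + e i))) =
        fun p => pev P p * (p x * p (x + e i)) := by funext p; simp
    rw [this]
    exact hP'.mul ((SmoothOn.coord (hXΛ hx)).mul (SmoothOn.coord (hXe i x hx)))
  have hn : ∀ n, ∫ p, cutoff Λ' n p * (pev P p * gen a f p) ∂gibbs d T = ∑ i, ∑ x ∈ X,
      (-∫ p, cutoff Λ' n p * (pev (rotP x (x + e i) P) p * rot x (x + e i) f p) ∂gibbs d T +
        a i * ∫ p, cutoff Λ' n p * (pev (P * (MvPolynomial.X x * MvPolynomial.X (x + e i))) p *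
          rot x (x + e i) f p) ∂gibbs d T) := by
    intro n
    have e2 : ∀ p, cutoff Λ' n p * (pev P p * gen a f p) = ∑ i, ∑ x ∈ X,
        (cutoff Λ' n p * (pev P p * rot x (x + e i) (rot x (x + e i) f) p) +
          a i * (cutoff Λ' n p * (pev (P * (MvPolynomial.X x * MvPolynomial.X (x + e i))) p *
            rot x (x + e i) f p))) := by
      intro p
      rw [gen_eq_sum hf hX, Finset.mul_sum, Finset.mul_sum]
      refine Finset.sum_congr rfl fun i _ => ?_
      rw [Finset.mul_sum, Finset.mul_sum]
      refine Finset.sum_congr rfl fun x _ => by simp; ring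
    simp_rw [e2]
    have j1 : ∀ i, ∀ x ∈ X, Integrable
        (fun p => cutoff Λ' n p * (pev P p * rot x (x + e i) (rot x (x + e i) f) p))
        (gibbs d T) := fun i x hx => integrable_cutoff_mul (hP'.mul (hrr i x hx)) n
    have j2 : ∀ i, ∀ x ∈ X, Integrable
        (fun p => a i * (cutoff Λ' n p * (pev (P * (MvPolynomial.X x * MvPolynomial.X (x + e i))) p
          * rot x (x + e i) f p))) (gibbs d T) :=
      fun i x hx => (integrable_cutoff_mul ((hPX i x hx).mul (hr i x hx)) n).const_mul _
    have j3 : ∀ i, ∀ x ∈ X, Integrable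
        (fun p => cutoff Λ' n p * (pev P p * rot x (x + e i) (rot x (x + e i) f) p) +
          a i * (cutoff Λ' n p * (pev (P * (MvPolynomial.X x * MvPolynomial.X (x + e i))) p
          * rot x (x + e i) f p)))
        (gibbs d T) := fun i x hx => (j1 i x hx).add (j2 i x hx)
    rw [integral_finsetSum _ fun i _ => integrable_finsetSum _ fun x hx => j3 i x hx]
    refine Finset.sum_congr rfl fun i _ => ?_
    rw [integral_finsetSum _ fun x hx => j3 i x hx]
    refine Finset.sum_congr rfl fun x hx => ?_
    rw [integral_add (j1 i x hx) (j2 i x hx), integral_const_mul]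
    congr 1
    have h := integral_cutoff_mul_rot (T := T) (ne_add_e x i) (hXΛ hx) (hXe i x hx)
      (hP'.mul (hr i x hx)) n
    simp only [rot_mul hP' (hr i x hx), mul_add, rot_pev] at h
    rw [integral_add (integrable_cutoff_mul ((hrP i x hx).mul (hr i x hx)) n)
      (integrable_cutoff_mul (hP'.mul (hrr i x hx)) n)] at h
    linarith
  have l1 := tendsto_integral_cutoff_mul (integrable_pev_mul P hg) Λ'
  refine tendsto_nhds_unique l1 ?_
  simp_rw [hn]
  refine tendsto_finsetSum _ fun i _ => tendsto_finsetSum _ fun x _ => ?_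
  exact (tendsto_integral_cutoff_mul (integrable_pev_mul _ (hL2 i x)) Λ').neg.add
    ((tendsto_integral_cutoff_mul (integrable_pev_mul _ (hL2 i x)) Λ').const_mul _)

/-- The adjoint of `S + A` acts on polynomials as `S - A`. -/
lemma integral_pev_mul_gen [Nonempty (Fin d)] (hf : SmoothOn Λ f)
    (h2 : MemLp f 2 (gibbs d T)) (hg : MemLp (gen a f) 2 (gibbs d T))
    {P : Pol d} (hX : ∀ i, ∀ x ∉ X, rotP x (x + e i) P = 0) :
    ∫ p, pev P p * gen a f p ∂gibbs d T =
      ∫ p, pev (polS X P - polA a X P) p * f p ∂gibbs d T := by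
  classical
  obtain ⟨ΛP, hP⟩ := exists_smoothOn_pev P
  replace hf := hf.mono (Finset.subset_union_left (s₂ := ΛP))
  replace hP := hP.mono (Finset.subset_union_right (s₁ := Λ))
  generalize Λ ∪ ΛP = Λ at hf hP
  obtain ⟨o, ho⟩ := exists_notMem Λ
  obtain ⟨X', hX', hXX, -⟩ := exists_touchedBy Λ X
  have hL2 := (dirichlet_le hf h2 hg).1
  rw [tendsto_integral_gen_mul hf h2 hg hP hX']
  -- The telescoping of the Dirichlet identity, with `P f` in place of `f²`: moving the field off
  -- `f` also differentiates `p_x p_{x+e_i}`, and the resulting energy differences sum to zero.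
  set I : Site d → ℝ := fun u =>
    ∫ p, pev (P * (MvPolynomial.X u ^ 2 - MvPolynomial.X o ^ 2)) p * f p ∂gibbs d T with hI
  have hI0 : ∀ u, u ∉ Λ → I u = 0 := by
    intro u hu
    by_cases huo : u = o
    · simp [hI, huo]
    have huo' : o ≠ u := fun h => huo h.symm
    have hro : rot o u f = 0 := hf.rot_eq_zero ho hu
    have h := integral_pev_mul_rot (T := T) huo' hf h2 (by rw [hro]; exact MemLp.zero)
      (P * (MvPolynomial.X o * MvPolynomial.X u))
    rw [hro] at h
    have hPo : ∀ p, pev (rotP o u P) p = 0 := fun p => by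
      rw [← rot_pev, hP.rot_eq_zero ho hu]; rfl
    simp only [Pi.zero_apply, mul_zero, integral_zero] at h
    simp only [hI]
    rw [← neg_eq_zero, h]
    congr 1
    refine integral_congr_ae (ae_of_all _ fun p => ?_)
    simp [Derivation.leibniz, rotP_X_mul_X huo', hPo, -Derivation.map_smul]
  have hterm : ∀ i x, -∫ p, pev (rotP x (x + e i) P) p * rot x (x + e i) f p ∂gibbs d T +
        a i * ∫ p, pev (P * (MvPolynomial.X x * MvPolynomial.X (x + e i))) p *
          rot x (x + e i) f p ∂gibbs d T =
      ∫ p, pev (rotP x (x + e i) (rotP x (x + e i) P) - a i •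
        (MvPolynomial.X x * MvPolynomial.X (x + e i) * rotP x (x + e i) P)) p * f p ∂gibbs d T
        + -a i * (I (x + e i) - I x) := by
    intro i x
    rw [integral_pev_mul_rot (ne_add_e x i) hf h2 (hL2 i x),
      integral_pev_mul_rot (ne_add_e x i) hf h2 (hL2 i x)]
    simp only [hI]
    have i4 : Integrable (fun p =>
        pev (P * (MvPolynomial.X (x + e i) ^ 2 - MvPolynomial.X o ^ 2)) p * f p -
        pev (P * (MvPolynomial.X x ^ 2 - MvPolynomial.X o ^ 2)) p * f p) (gibbs d T) :=
      (integrable_pev_mul _ h2).sub (integrable_pev_mul _ h2)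
    rw [← integral_sub (integrable_pev_mul _ h2) (integrable_pev_mul _ h2), neg_neg, mul_neg,
      ← integral_const_mul, ← integral_const_mul, ← sub_eq_add_neg,
      ← integral_sub (integrable_pev_mul _ h2) ((integrable_pev_mul _ h2).const_mul _),
      ← integral_add (integrable_pev_mul _ h2) (i4.const_mul _)]
    refine integral_congr_ae (ae_of_all _ fun p => ?_)
    simp only [Derivation.leibniz (rotP x (x + e i)) P, rotP_X_mul_X (ne_add_e x i), smul_eq_mul,
      pev_add, pev_sub, pev_mul, pev_smul, pev_pow, pev_X]
    ring
  simp_rw [hterm, Finset.sum_add_distrib]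
  have hz : ∑ i, ∑ x ∈ X', -a i * (I (x + e i) - I x) = 0 :=
    Finset.sum_eq_zero fun i _ => by
      rw [← Finset.mul_sum, sum_shift_sub_eq_zero hX' i fun x _ => ⟨hI0 x, hI0 _⟩, mul_zero]
  rw [hz, add_zero]
  have hfin : ∀ p, pev (polS X P - polA a X P) p * f p = ∑ i, ∑ x ∈ X,
      pev (rotP x (x + e i) (rotP x (x + e i) P) - a i •
        (MvPolynomial.X x * MvPolynomial.X (x + e i) * rotP x (x + e i) P)) p * f p := by
    intro p
    simp only [polS, polA, pev_sub, pev_sum, ← Finset.sum_sub_distrib, Finset.sum_mul]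
  simp_rw [hfin]
  rw [integral_finsetSum _ fun i _ => integrable_finsetSum _ fun x _ => integrable_pev_mul _ h2]
  refine Finset.sum_congr rfl fun i _ => ?_
  rw [integral_finsetSum _ fun x _ => integrable_pev_mul _ h2]
  refine (Finset.sum_subset hXX fun x _ hx => ?_).symm
  simp [hX i x hx]

end Adjoint

/-! ### Wick ordering and the Fock space form -/

section Wick

variable {d : ℕ} {T : ℝ}

open MvPolynomial (X pderiv monomial C)

@[simp] lemma pev_neg (P : Pol d) (p : Config d) : pev (-P) p = -pev P p := by
  simp [pev]

lemma integral_eval_sq (hT : 0 < T) (y : Site d) : ∫ p, p y ^ 2 ∂gibbs d T = T := by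
  have h1 : ∫ p : Config d, p y ^ 2 ∂gibbs d T = ∫ t, t ^ 2 ∂gaussianReal 0 T.toNNReal := by
    rw [← (measurePreserving_eval (T := T) y).map_eq,
      integral_map (measurable_pi_apply y).aemeasurable (by fun_prop)]
  have h2 := variance_eq_sub (memLp_id_gaussianReal (μ := 0) (v := T.toNNReal) 2)
  rw [variance_id_gaussianReal] at h2
  simp only [Pi.pow_apply, id_eq, integral_id_gaussianReal] at h2
  rw [h1]
  rw [Real.coe_toNNReal _ hT.le] at h2
  linarith

/-- Gaussian integration by parts for polynomials. -/
lemma integral_pev_X_mul [Nonempty (Fin d)] (hT : 0 < T) (x : Site d) (P : Pol d) :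
    ∫ p, pev (X x * P) p ∂gibbs d T = T * ∫ p, pev (pderiv x P) p ∂gibbs d T := by
  classical
  obtain ⟨Λ, hP⟩ := exists_smoothOn_pev P
  -- For a fresh site `y` the field gives `rot x y (p_y P) = p_y² ∂_x P - p_x P`, whose mean is
  -- zero. Independence and `⟨p_y²⟩ = T` turn this into integration by parts.
  obtain ⟨y, hy⟩ := exists_notMem (insert x Λ)
  rw [Finset.mem_insert, not_or] at hy
  have hxy : x ≠ y := fun h => hy.1 h.symm
  obtain ⟨Λ'', hQ⟩ := exists_smoothOn_pev (X y * P)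
  have h := integral_rot_eq_zero (T := T) hxy hQ (integrable_pev _)
    (by rw [rot_pev]; exact integrable_pev _)
  have hdy : ∀ p, pev (pderiv y P) p = 0 := fun p => by
    rw [← partialDeriv_pev, hP.partialDeriv_eq_zero hy.2]; rfl
  have e1 : ∀ p, rot x y (pev (X y * P)) p = pev (X y ^ 2 * pderiv x P) p - pev (X x * P) p := by
    intro p
    rw [rot_pev]
    simp [rotP_apply, Derivation.leibniz, MvPolynomial.pderiv_X_of_ne hxy.symm, hdy]
    ring
  simp_rw [e1] at h
  rw [integral_sub (integrable_pev _) (integrable_pev _), sub_eq_zero] at h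
  rw [← h]
  have hdx : SmoothOn Λ (pev (pderiv x P)) := by
    have : pev (pderiv x P) = partialDeriv x (pev P) := by
      funext p; rw [partialDeriv_pev]
    rw [this]; exact hP.partialDeriv x
  obtain ⟨φ, hφ, hφe⟩ := hdx
  have hind := (iIndepFun_eval (d := d) (T := T)).indepFun_finset {y} Λ
    (Finset.disjoint_singleton_left.2 hy.2) (fun z => measurable_pi_apply z)
  have hmul := hind.integral_fun_comp_mul_comp
    (f := fun q : (({y} : Finset (Site d)) → ℝ) => q ⟨y, by simp⟩ ^ 2) (g := φ)
    (Measurable.aemeasurable (by fun_prop)) (Measurable.aemeasurable (by fun_prop))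
    ((measurable_pi_apply _).pow_const 2).aestronglyMeasurable hφ.continuous.aestronglyMeasurable
  rw [integral_eval_sq hT] at hmul
  rw [hφe, ← hmul]
  refine integral_congr_ae (ae_of_all _ fun p => ?_)
  simp [hφe]

/-- The Hermite polynomials in the variable `X_x`, for Gaussians of variance `T`. -/
noncomputable def hermitePol (T : ℝ) (x : Site d) : ℕ → Pol d
  | 0 => 1
  | 1 => X x
  | n + 2 => X x * hermitePol T x (n + 1) - (T * (n + 1)) • hermitePol T x n

/-- The recurrence in a form valid for every `n`: at `n = 0` the coefficient `T * n` removes the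
truncated index. -/
lemma X_mul_hermitePol (x : Site d) (n : ℕ) :
    X x * hermitePol T x n = hermitePol T x (n + 1) + (T * n) • hermitePol T x (n - 1) := by
  cases n with
  | zero => simp [hermitePol]
  | succ n => simp [hermitePol]

lemma pderiv_hermitePol (x : Site d) (n : ℕ) :
    pderiv x (hermitePol T x n) = (n : ℝ) • hermitePol T x (n - 1) := by
  induction n using Nat.strong_induction_on with
  | _ n ih =>
    match n with
    | 0 => simp [hermitePol]
    | 1 => simp [hermitePol]
    | n + 2 =>
      rw [hermitePol, map_sub, Derivation.leibniz, Derivation.map_smul, ih n (by omega),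
        ih (n + 1) (by omega)]
      simp only [MvPolynomial.pderiv_X_self, smul_eq_mul, Nat.add_sub_cancel, mul_one,
        Algebra.mul_smul_comm, X_mul_hermitePol]
      have : n + 2 - 1 = n + 1 := by omega
      rw [this]
      simp only [smul_add, smul_smul]
      push_cast
      module

lemma pderiv_hermitePol_of_ne {x y : Site d} (h : y ≠ x) (n : ℕ) :
    pderiv x (hermitePol T y n) = 0 := by
  induction n using Nat.strong_induction_on with
  | _ n ih =>
    match n with
    | 0 => simp [hermitePol]
    | 1 => simp [hermitePol, MvPolynomial.pderiv_X_of_ne h]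
    | n + 2 =>
      rw [hermitePol, map_sub, Derivation.leibniz, Derivation.map_smul, ih n (by omega),
        ih (n + 1) (by omega), MvPolynomial.pderiv_X_of_ne h]
      simp

/-- Products of Hermite polynomials. -/
noncomputable def hermiteProd (T : ℝ) (α : Site d →₀ ℕ) : Pol d :=
  α.prod fun x n => hermitePol T x n

lemma hermiteProd_eq (α : Site d →₀ ℕ) (x : Site d) :
    hermiteProd T α = hermitePol T x (α x) * hermiteProd T (α.erase x) :=
  (Finsupp.mul_prod_erase' α x _ fun _ => rfl).symm

lemma pderiv_hermiteProd_erase (α : Site d →₀ ℕ) (x : Site d) :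
    pderiv x (hermiteProd T (α.erase x)) = 0 := by
  classical
  have h : ∀ s : Finset (Site d), x ∉ s → ∀ n : Site d → ℕ,
      pderiv x (∏ y ∈ s, hermitePol T y (n y)) = 0 := by
    intro s
    induction s using Finset.induction_on with
    | empty => simp
    | insert y s hy ih =>
      intro hx n
      rw [Finset.mem_insert, not_or] at hx
      rw [Finset.prod_insert hy, Derivation.leibniz, ih hx.2,
        pderiv_hermitePol_of_ne fun h => hx.1 h.symm]
      simp
  exact h _ (by simp) _

/-- The linear map that sends monomials to products of Hermite polynomials. -/
noncomputable def wick (T : ℝ) : Pol d →ₗ[ℝ] Pol d :=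
  (MvPolynomial.basisMonomials (Site d) ℝ).constr ℝ (hermiteProd T)

lemma wick_monomial (α : Site d →₀ ℕ) (c : ℝ) :
    wick T (monomial α c) = c • hermiteProd T α := by
  have : wick T (monomial α 1) = hermiteProd T α := by
    have := (MvPolynomial.basisMonomials (Site d) ℝ).constr_basis ℝ (hermiteProd T) α
    rwa [MvPolynomial.coe_basisMonomials] at this
  rw [← this, ← map_smul, MvPolynomial.smul_monomial, smul_eq_mul, mul_one]

lemma wick_one : wick T (1 : Pol d) = 1 := by
  have : (1 : Pol d) = monomial 0 1 := by rw [← MvPolynomial.C_apply, MvPolynomial.C_1]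
  rw [this, wick_monomial]; simp [hermiteProd, ← this]

lemma erase_sub_single (α : Site d →₀ ℕ) (x : Site d) (n : ℕ) :
    (α - Finsupp.single x n).erase x = α.erase x := by
  classical
  ext y; by_cases h : y = x
  · simp [h]
  · simp [Finsupp.erase_ne h, Ne.symm h]

lemma erase_add_single (α : Site d →₀ ℕ) (x : Site d) (n : ℕ) :
    (α + Finsupp.single x n).erase x = α.erase x := by
  classical
  ext y; by_cases h : y = x
  · simp [h]
  · simp [Finsupp.erase_ne h]

lemma pol_induction {p : Pol d → Prop} (P : Pol d)
    (hm : ∀ α, p (monomial α 1)) (ha : ∀ P Q, p P → p Q → p (P + Q))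
    (hs : ∀ (c : ℝ) P, p P → p (c • P)) : p P := by
  induction P using MvPolynomial.induction_on' with
  | monomial α c =>
    have := hs c _ (hm α)
    rwa [MvPolynomial.smul_monomial, smul_eq_mul, mul_one] at this
  | add P Q hP hQ => exact ha P Q hP hQ

lemma pderiv_wick (x : Site d) (P : Pol d) : pderiv x (wick T P) = wick T (pderiv x P) := by
  induction P using pol_induction with
  | hm α =>
    rw [MvPolynomial.pderiv_monomial, wick_monomial, wick_monomial, one_smul, one_mul,
      hermiteProd_eq α x, hermiteProd_eq (α - _) x, erase_sub_single, Derivation.leibniz,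
      pderiv_hermiteProd_erase, pderiv_hermitePol]
    simp [mul_comm]
  | ha P Q hP hQ => simp only [map_add, hP, hQ]
  | hs c P hP => simp only [map_smul, Derivation.map_smul, hP]

/-- Multiplication by a momentum is a creation plus an annihilation operator; on Hermite factors
this is the three-term recurrence. -/
lemma X_mul_wick (x : Site d) (P : Pol d) :
    X x * wick T P = wick T (X x * P + T • pderiv x P) := by
  induction P using pol_induction with
  | hm α =>
    have h1 : X x * monomial α (1 : ℝ) = monomial (α + Finsupp.single x 1) 1 := by
      rw [MvPolynomial.X, MvPolynomial.monomial_mul, add_comm]; simp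
    rw [MvPolynomial.pderiv_monomial, map_add, map_smul, h1, wick_monomial, wick_monomial,
      wick_monomial, one_smul, one_mul, one_smul, hermiteProd_eq α x, hermiteProd_eq (α - _) x,
      hermiteProd_eq (α + _) x, erase_sub_single, erase_add_single, ← mul_assoc, X_mul_hermitePol]
    simp [add_mul, smul_smul]
  | ha P Q hP hQ => simp only [map_add, mul_add, hP, hQ, smul_add]; abel
  | hs c P hP =>
    rw [map_smul, Algebra.mul_smul_comm, hP, Derivation.map_smul, Algebra.mul_smul_comm,
      ← map_smul]
    congr 1
    simp only [smul_add, smul_smul, mul_comm]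

/-- The annihilation terms of the two halves of the field are `T ∂_x ∂_y P` and `T ∂_y ∂_x P`, and
they cancel. Hence the rotation fields keep the degree and act on Wick symbols as on polynomials. -/
lemma rotP_wick (x y : Site d) (P : Pol d) : rotP x y (wick T P) = wick T (rotP x y P) := by
  rw [rotP_apply, rotP_apply, pderiv_wick, pderiv_wick, X_mul_wick, X_mul_wick, ← map_sub]
  congr 1
  have : pderiv y (pderiv x P) = pderiv x (pderiv y P) := by
    induction P using MvPolynomial.induction_on' with
    | monomial α c =>
      rw [MvPolynomial.pderiv_monomial, MvPolynomial.pderiv_monomial, MvPolynomial.pderiv_monomial,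
        MvPolynomial.pderiv_monomial, tsub_right_comm]
      congr 1
      by_cases h : x = y
      · rw [h]
      · simp [h]; ring
    | add P Q hP hQ => simp only [map_add, hP, hQ]
  rw [this]
  ring

/-- The covariance form on the Fock space. -/
noncomputable def fock (T : ℝ) (P Q : Pol d) : ℝ :=
  ∫ p, pev (wick T P) p * pev (wick T Q) p ∂gibbs d T

lemma fock_comm (P Q : Pol d) : fock T P Q = fock T Q P := by
  simp only [fock, mul_comm]

lemma fock_smul_left (c : ℝ) (P Q : Pol d) : fock T (c • P) Q = c * fock T P Q := by
  simp [fock, mul_assoc, integral_const_mul]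

/-- Creation by `X_x` is adjoint to `T ∂_x`. All inner products of Wick polynomials are computed
from this rule. -/
lemma fock_X_mul [Nonempty (Fin d)] (hT : 0 < T) (x : Site d) (P Q : Pol d) :
    fock T (X x * P) Q = T * fock T P (pderiv x Q) := by
  have h1 : wick T (X x * P) = X x * wick T P - T • pderiv x (wick T P) := by
    rw [X_mul_wick, pderiv_wick, map_add, map_smul]; ring
  have h2 := integral_pev_X_mul hT x (wick T P * wick T Q)
  rw [Derivation.leibniz] at h2
  simp only [fock, h1, ← pderiv_wick]
  have e1 : ∀ p, pev (X x * wick T P - T • pderiv x (wick T P)) p * pev (wick T Q) p =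
      pev (X x * (wick T P * wick T Q)) p - T * pev (pderiv x (wick T P) * wick T Q) p := by
    intro p; simp; ring
  have e2 : ∀ p, pev (wick T P • pderiv x (wick T Q) + wick T Q • pderiv x (wick T P)) p =
      pev (wick T P * pderiv x (wick T Q)) p + pev (pderiv x (wick T P) * wick T Q) p := by
    intro p; simp [smul_eq_mul]; ring
  simp_rw [e1]
  simp_rw [e2] at h2
  rw [integral_add (integrable_pev _) (integrable_pev _)] at h2
  rw [integral_sub (integrable_pev _) ((integrable_pev _).const_mul T), h2, integral_const_mul]
  simp only [pev_mul]
  ring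

lemma fock_one_one : fock T (1 : Pol d) 1 = 1 := by
  simp [fock, wick_one]

lemma monomial_add_single_one (α : Site d →₀ ℕ) (x : Site d) :
    monomial (α + Finsupp.single x 1) (1 : ℝ) = X x * monomial α 1 := by
  rw [MvPolynomial.X, MvPolynomial.monomial_mul, add_comm]; simp

lemma fock_monomial_add_single [Nonempty (Fin d)] (hT : 0 < T) (x : Site d) (α β : Site d →₀ ℕ) :
    fock T (monomial (α + Finsupp.single x 1) 1) (monomial β 1) =
      T * (β x * fock T (monomial α 1) (monomial (β - Finsupp.single x 1) 1)) := by
  have h1 : ∀ c : ℝ, monomial (β - Finsupp.single x 1) c =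
      c • monomial (β - Finsupp.single x 1) (1 : ℝ) := fun c => by
    rw [MvPolynomial.smul_monomial, smul_eq_mul, mul_one]
  rw [monomial_add_single_one, fock_X_mul hT, MvPolynomial.pderiv_monomial, one_mul, h1, fock_comm,
    fock_smul_left, fock_comm]

lemma exists_add_single {α : Site d →₀ ℕ} {n : ℕ} (h : α.degree = n + 1) :
    ∃ β x, α = β + Finsupp.single x 1 ∧ β.degree = n := by
  obtain ⟨x, hx⟩ : ∃ x, α x ≠ 0 := by
    by_contra hc
    push Not at hc
    have : α = 0 := by ext y; simp [hc y]
    simp [this] at h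
  have h1 : Finsupp.single x 1 ≤ α := by
    rw [Finsupp.single_le_iff]; omega
  refine ⟨α - Finsupp.single x 1, x, (tsub_add_cancel_of_le h1).symm, ?_⟩
  have h2 := congrArg Finsupp.degree (tsub_add_cancel_of_le h1)
  rw [map_add, h] at h2
  simp at h2
  omega

/-- Induction on the degree: a factor taken off `α` is taken off `β` as well, and when `β` is
exhausted the result vanishes. -/
lemma fock_monomial_of_ne [Nonempty (Fin d)] (hT : 0 < T) {α β : Site d →₀ ℕ} (h : α ≠ β) :
    fock T (monomial α 1) (monomial β 1) = 0 := by
  have key : ∀ n, ∀ α β : Site d →₀ ℕ, α.degree = n → α ≠ β →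
      fock T (monomial α 1) (monomial β 1) = 0 := by
    intro n
    induction n with
    | zero =>
      intro α β hα hne
      have hα0 : α = 0 := (Finsupp.degree_eq_zero_iff α).1 hα
      subst hα0
      obtain ⟨m, hm⟩ : ∃ m, β.degree = m + 1 := by
        refine Nat.exists_eq_succ_of_ne_zero fun h0 => hne ?_
        have : β = 0 := (Finsupp.degree_eq_zero_iff β).1 h0
        rw [this]
      obtain ⟨γ, x, rfl, -⟩ := exists_add_single hm
      rw [fock_comm, fock_monomial_add_single hT]
      simp
    | succ n ih =>
      intro α β hα hne
      obtain ⟨γ, x, rfl, hγ⟩ := exists_add_single hα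
      rw [fock_monomial_add_single hT]
      by_cases hx : β x = 0
      · simp [hx]
      rw [ih γ _ hγ fun h => hne ?_]
      · simp
      rw [h, tsub_add_cancel_of_le]
      rw [Finsupp.single_le_iff]; omega
  exact key _ α β rfl h

lemma fock_monomial_self_add_single [Nonempty (Fin d)] (hT : 0 < T) (x : Site d)
    (α : Site d →₀ ℕ) :
    fock T (monomial (α + Finsupp.single x 1) 1) (monomial (α + Finsupp.single x 1) 1) =
      T * (α x + 1) * fock T (monomial α 1) (monomial α 1) := by
  rw [fock_monomial_add_single hT, add_tsub_cancel_right]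
  simp; ring

/-- Each added factor multiplies the squared norm by `T` times the new exponent of its site, which
is at most the new degree. -/
lemma fock_monomial_self_bounds [Nonempty (Fin d)] (hT : 0 < T) (n : ℕ) (α : Site d →₀ ℕ)
    (h : α.degree = n) : 0 ≤ fock T (monomial α 1) (monomial α 1) ∧
      fock T (monomial α 1) (monomial α 1) ≤ n.factorial * T ^ n := by
  induction n generalizing α with
  | zero =>
    have : α = 0 := (Finsupp.degree_eq_zero_iff α).1 h
    subst this
    simp [fock_one_one]
  | succ n ih =>
    obtain ⟨β, x, rfl, hβ⟩ := exists_add_single h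
    rw [fock_monomial_self_add_single hT]
    obtain ⟨h0, h1⟩ := ih β hβ
    refine ⟨by positivity, ?_⟩
    have h2 : (β x : ℝ) ≤ n := by
      have := Finsupp.le_degree x β
      rw [hβ] at this
      exact_mod_cast this
    rw [Nat.factorial_succ, pow_succ]
    push_cast
    calc T * (β x + 1) * fock T (monomial β 1) (monomial β 1)
        ≤ T * (n + 1) * (n.factorial * T ^ n) := by gcongr
      _ = _ := by ring

/-- The element of `𝕃²(μ_T)` defined by a vector of the Fock space. -/
noncomputable def toL2 (T : ℝ) : Pol d →ₗ[ℝ] L2 d T where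
  toFun P := (memLp_two_pev (wick T P)).toLp _
  map_add' P Q := by
    rw [← MemLp.toLp_add (memLp_two_pev _) (memLp_two_pev _)]
    congr 1
    funext p; simp
  map_smul' c P := by
    rw [RingHom.id_apply, ← MemLp.toLp_const_smul c (memLp_two_pev _)]
    congr 1
    funext p; simp

lemma coeFn_toL2 (P : Pol d) : (toL2 T P : Config d → ℝ) =ᵐ[gibbs d T] pev (wick T P) :=
  MemLp.coeFn_toLp (memLp_two_pev (wick T P))

lemma inner_eq_integral (f g : L2 d T) : inner ℝ f g = ∫ p, f p * g p ∂gibbs d T := by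
  rw [L2.inner_def]
  simp [mul_comm]

lemma inner_toL2_left (P : Pol d) (f : L2 d T) :
    inner ℝ (toL2 T P) f = ∫ p, pev (wick T P) p * f p ∂gibbs d T := by
  rw [inner_eq_integral]
  refine integral_congr_ae ?_
  filter_upwards [coeFn_toL2 (T := T) P] with p hp
  rw [hp]

lemma inner_toL2_toL2 (P Q : Pol d) : inner ℝ (toL2 T P) (toL2 T Q) = fock T P Q := by
  rw [inner_toL2_left, fock]
  refine integral_congr_ae ?_
  filter_upwards [coeFn_toL2 (T := T) Q] with p hp
  rw [hp]

/-- A bound for the norm of a combination of monomials with few coincidences. -/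
lemma norm_sq_toL2_sum_le [Nonempty (Fin d)] (hT : 0 < T) {ι : Type*} (s : Finset ι)
    (c : ι → ℝ) (α : ι → Site d →₀ ℕ) {n m : ℕ} (hn : ∀ i ∈ s, (α i).degree = n)
    (hm : ∀ i ∈ s, (s.filter fun j => α j = α i).card ≤ m) :
    ‖toL2 T (∑ i ∈ s, c i • monomial (α i) 1)‖ ^ 2 ≤
      m * (n.factorial * T ^ n) * ∑ i ∈ s, c i ^ 2 := by
  classical
  set K : ℝ := n.factorial * T ^ n with hK
  have hK0 : 0 ≤ K := by positivity
  -- Distinct monomials are orthogonal; for coinciding ones the product of coefficients is at most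
  -- half the sum of their squares.
  have h1 : ∀ i ∈ s, ∀ j ∈ s, c i * (c j * fock T (monomial (α i) 1) (monomial (α j) 1)) ≤
      (K / 2) * ((if α j = α i then c i ^ 2 else 0) + if α i = α j then c j ^ 2 else 0) := by
    intro i hi j hj
    by_cases h : α i = α j
    · rw [if_pos h, if_pos h.symm, ← h]
      obtain ⟨h0, h2⟩ := fock_monomial_self_bounds hT n (α i) (hn i hi)
      nlinarith [mul_le_mul_of_nonneg_right h2 (add_nonneg (sq_nonneg (c i)) (sq_nonneg (c j))),
        mul_nonneg h0 (sq_nonneg (c i - c j))]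
    · rw [fock_monomial_of_ne hT h, if_neg h, if_neg fun h' => h h'.symm]; simp
  rw [← real_inner_self_eq_norm_sq, map_sum, sum_inner]
  simp_rw [inner_sum, map_smul, inner_smul_left, inner_smul_right, inner_toL2_toL2]
  simp only [conj_trivial]
  refine (Finset.sum_le_sum fun i hi => Finset.sum_le_sum fun j hj => h1 i hi j hj).trans ?_
  simp_rw [← Finset.mul_sum, Finset.sum_add_distrib]
  rw [Finset.sum_comm (f := fun i j => if α i = α j then c j ^ 2 else 0)]
  have h2 : ∑ i ∈ s, ∑ j ∈ s, (if α j = α i then c i ^ 2 else 0) ≤ m * ∑ i ∈ s, c i ^ 2 := by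
    rw [Finset.mul_sum]
    refine Finset.sum_le_sum fun i hi => ?_
    rw [← Finset.sum_filter, Finset.sum_const, nsmul_eq_mul]
    have : ((s.filter fun j => α j = α i).card : ℝ) ≤ m := by exact_mod_cast hm i hi
    gcongr
  calc _ ≤ K / 2 * (m * ∑ i ∈ s, c i ^ 2 + m * ∑ i ∈ s, c i ^ 2) := by gcongr
    _ = _ := by ring

end Wick

/-! ### The resolvent of a contraction semigroup -/

section Resolvent

variable {d : ℕ} {T : ℝ}

lemma IsMarkovSemigroup.norm_sub_le {P : ℝ≥0 → L2 d T →L[ℝ] L2 d T} (hP : IsMarkovSemigroup P)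
    (w : L2 d T) (s t : ℝ≥0) : ‖P s w - P t w‖ ≤ ‖P (max s t - min s t) w - w‖ := by
  wlog h : t ≤ s generalizing s t
  · rw [norm_sub_rev, max_comm, min_comm]; exact this t s (le_of_not_ge h)
  rw [max_eq_left h, min_eq_right h]
  have h1 : P s w = P t (P (s - t) w) := by
    conv_lhs => rw [← add_tsub_cancel_of_le h, hP.add]
    rfl
  rw [h1, ← map_sub]
  exact hP.contraction t _

lemma IsMarkovSemigroup.continuous_orbit {P : ℝ≥0 → L2 d T →L[ℝ] L2 d T}
    (hP : IsMarkovSemigroup P) (w : L2 d T) : Continuous fun t => P t w := by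
  rw [continuous_iff_continuousAt]
  intro t
  rw [ContinuousAt, tendsto_iff_norm_sub_tendsto_zero]
  have h1 : Tendsto (fun s : ℝ≥0 => max s t - min s t) (𝓝 t) (𝓝 0) := by
    have : Continuous fun s : ℝ≥0 => max s t - min s t := by fun_prop
    simpa using this.tendsto t
  have h2 := tendsto_iff_norm_sub_tendsto_zero.1 ((hP.continuous w).comp h1)
  exact squeeze_zero (fun _ => norm_nonneg _) (fun s => hP.norm_sub_le w s t) h2

/-- The Laplace transform of the semigroup inverts `lam - L`. -/
lemma IsMarkovSemigroup.exists_resolvent {P : ℝ≥0 → L2 d T →L[ℝ] L2 d T}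
    (hP : IsMarkovSemigroup P) {lam : ℝ} (hlam : 0 < lam) (w : L2 d T) :
    ∃ u, IsGeneratorPair P u (lam • u - w) := by
  set F : ℝ → L2 d T := fun t => Real.exp (-lam * t) • P t.toNNReal w with hF
  have hFc : Continuous F := by
    have := (hP.continuous_orbit w).comp continuous_real_toNNReal
    exact (by fun_prop : Continuous fun t : ℝ => Real.exp (-lam * t)).smul this
  have hFi : ∀ c, IntegrableOn F (Set.Ioi c) := by
    intro c
    refine Integrable.mono' (((integrableOn_exp_mul_Ioi (neg_lt_zero.2 hlam) c)).mul_const ‖w‖)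
      hFc.aestronglyMeasurable (ae_of_all _ fun t => ?_)
    rw [hF, norm_smul, Real.norm_of_nonneg (Real.exp_pos _).le]
    exact mul_le_mul_of_nonneg_left (hP.contraction _ _) (Real.exp_pos _).le
  set u := ∫ t in Set.Ioi 0, F t with hu
  refine ⟨u, ?_⟩
  -- `P h` shifts the Laplace integral to `e^{lam h} ∫_h^∞ F`. The right side is defined for real
  -- `h` and is differentiable at zero, with derivative `lam u - w`.
  have hPu : ∀ h : ℝ≥0, P h u = Real.exp (lam * h) • (u - ∫ t in (0 : ℝ)..h, F t) := by
    intro h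
    have h1 : P h u = ∫ t in Set.Ioi 0, Real.exp (lam * h) • F (t + h) := by
      rw [hu, ← ContinuousLinearMap.integral_comp_comm _ (hFi 0)]
      refine setIntegral_congr_fun measurableSet_Ioi fun t ht => ?_
      have ht0 : 0 ≤ t := le_of_lt ht
      simp only [hF, map_smul, smul_smul]
      have h0 : (t + (h : ℝ)).toNNReal = h + t.toNNReal := by
        rw [Real.toNNReal_add ht0 h.coe_nonneg, Real.toNNReal_coe, add_comm]
      rw [← Real.exp_add, h0, hP.add, ContinuousLinearMap.comp_apply]
      congr 2
      ring
    have h2 : ∫ t in Set.Ioi 0, F (t + h) = ∫ t in Set.Ioi (h : ℝ), F t := by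
      have := (measurePreserving_add_right volume (h : ℝ)).setIntegral_preimage_emb
        (measurableEmbedding_addRight _) F (Set.Ioi (h : ℝ))
      simpa using this
    rw [h1, integral_smul, h2, ← intervalIntegral.integral_Ioi_sub_Ioi (hFi 0) h.coe_nonneg]
    simp [hu]
  set V : ℝ → L2 d T := fun h => Real.exp (lam * h) • (u - ∫ t in (0 : ℝ)..h, F t) with hV
  have hV' : HasDerivAt V (lam • u - w) 0 := by
    have h1 : HasDerivAt (fun h : ℝ => ∫ t in (0 : ℝ)..h, F t) (F 0) 0 :=
      intervalIntegral.integral_hasDerivAt_right (hFc.intervalIntegrable 0 0)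
        hFc.stronglyMeasurable.stronglyMeasurableAtFilter hFc.continuousAt
    have h2 : HasDerivAt (fun h : ℝ => Real.exp (lam * h)) lam 0 := by
      have := ((hasDerivAt_id' (0 : ℝ)).const_mul lam).exp
      simpa using this
    have h3 := h2.smul ((hasDerivAt_const (0 : ℝ) u).sub h1)
    have hF0 : F 0 = w := by simp [hF, hP.zero]
    refine h3.congr_deriv ?_
    simp [hF0, sub_eq_neg_add]
  have h4 := hV'.tendsto_slope_zero_right
  have h5 : Tendsto (fun t : ℝ≥0 => (t : ℝ)) (𝓝[>] 0) (𝓝[>] 0) := by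
    refine tendsto_nhdsWithin_iff.2 ⟨?_, ?_⟩
    · have : Tendsto (fun t : ℝ≥0 => (t : ℝ)) (𝓝 0) (𝓝 ((0 : ℝ≥0) : ℝ)) :=
        NNReal.continuous_coe.tendsto 0
      simpa using this.mono_left nhdsWithin_le_nhds
    · filter_upwards [self_mem_nhdsWithin] with t ht
      exact NNReal.coe_pos.2 ht
  have h6 := h4.comp h5
  refine h6.congr fun t => ?_
  simp [hV, hPu]

lemma IsGeneratorPair.add {P : ℝ≥0 → L2 d T →L[ℝ] L2 d T} {f g f' g' : L2 d T}
    (h : IsGeneratorPair P f g) (h' : IsGeneratorPair P f' g') :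
    IsGeneratorPair P (f + f') (g + g') := by
  refine (Tendsto.add h h').congr fun t => ?_
  rw [← smul_add, map_add]; congr 1; abel

lemma IsGeneratorPair.sub {P : ℝ≥0 → L2 d T →L[ℝ] L2 d T} {f g f' g' : L2 d T}
    (h : IsGeneratorPair P f g) (h' : IsGeneratorPair P f' g') :
    IsGeneratorPair P (f - f') (g - g') := by
  refine (Tendsto.sub h h').congr fun t => ?_
  rw [← smul_sub, map_sub]; congr 1; abel

lemma IsGeneratorPair.zero {P : ℝ≥0 → L2 d T →L[ℝ] L2 d T} : IsGeneratorPair P 0 0 := by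
  simp [IsGeneratorPair]

lemma IsGeneratorPair.sum {P : ℝ≥0 → L2 d T →L[ℝ] L2 d T} {ι : Type*} (s : Finset ι)
    {f g : ι → L2 d T} (h : ∀ i ∈ s, IsGeneratorPair P (f i) (g i)) :
    IsGeneratorPair P (∑ i ∈ s, f i) (∑ i ∈ s, g i) := by
  classical
  induction s using Finset.induction_on with
  | empty => simpa using IsGeneratorPair.zero
  | insert i s hi ih =>
    rw [Finset.sum_insert hi, Finset.sum_insert hi]
    exact (h i (by simp)).add (ih fun j hj => h j (by simp [hj]))

end Resolvent

/-! ### Passage to the closure of the generator, and translation covariance -/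

section ClosedGraph

variable {d : ℕ} {T : ℝ} {a : Fin d → ℝ}

open MvPolynomial (X pderiv)

/-- Multiplication by `p_x`, transported to the Fock space. -/
noncomputable def mulX (T : ℝ) (x : Site d) (P : Pol d) : Pol d := X x * P + T • pderiv x P

/-- The antisymmetric part on the Fock space, with the bonds restricted to `Y`. -/
noncomputable def fockA (T : ℝ) (a : Fin d → ℝ) (Y : Finset (Site d)) (P : Pol d) : Pol d :=
  ∑ i, ∑ x ∈ Y, a i • mulX T x (mulX T (x + e i) (rotP x (x + e i) P))

lemma polS_wick (Y : Finset (Site d)) (P : Pol d) : polS Y (wick T P) = wick T (polS Y P) := by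
  simp only [polS, rotP_wick, map_sum]

lemma polA_wick (Y : Finset (Site d)) (P : Pol d) :
    polA a Y (wick T P) = wick T (fockA T a Y P) := by
  simp only [polA, fockA, rotP_wick, map_sum, map_smul, mulX, ← X_mul_wick, mul_assoc]

lemma preGraph_elim {q : L2 d T × L2 d T} (hq : q ∈ preGraph d T a) :
    ∃ Λ f, SmoothOn Λ f ∧ (q.1 : Config d → ℝ) =ᵐ[gibbs d T] f ∧
      (q.2 : Config d → ℝ) =ᵐ[gibbs d T] gen a f ∧ MemLp f 2 (gibbs d T) ∧
      MemLp (gen a f) 2 (gibbs d T) := by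
  obtain ⟨f, ⟨Λ, φ, hφ, hf⟩, h1, h2⟩ := hq
  exact ⟨Λ, f, ⟨φ, hφ, hf⟩, h1, h2, (memLp_congr_ae h1).1 (Lp.memLp _),
    (memLp_congr_ae h2).1 (Lp.memLp _)⟩

lemma inner_congr {u v : L2 d T} {f g : Config d → ℝ} (hf : (u : Config d → ℝ) =ᵐ[gibbs d T] f)
    (hg : (v : Config d → ℝ) =ᵐ[gibbs d T] g) : inner ℝ u v = ∫ p, f p * g p ∂gibbs d T := by
  rw [inner_eq_integral]
  refine integral_congr_ae ?_
  filter_upwards [hf, hg] with p h1 h2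
  rw [h1, h2]

lemma closedGraph_induction {p : L2 d T × L2 d T → Prop} (hc : IsClosed {q | p q})
    (h : ∀ q ∈ preGraph d T a, p q) {q : L2 d T × L2 d T} (hq : q ∈ closedGraph d T a) : p q :=
  closure_minimal (show preGraph d T a ⊆ {q | p q} from fun q hq => h q hq) hc hq

/-- The adjoint identity in weak form: both sides are continuous in the graph point, so it extends
from local functions to the closure without any discussion of the domain of the adjoint. -/
lemma inner_toL2_graph [Nonempty (Fin d)] {P : Pol d} {Y : Finset (Site d)}
    (hY : ∀ i, ∀ x ∉ Y, rotP x (x + e i) P = 0) {q : L2 d T × L2 d T}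
    (hq : q ∈ closedGraph d T a) :
    inner ℝ (toL2 T P) q.2 = inner ℝ (toL2 T (polS Y P - fockA T a Y P)) q.1 := by
  refine closedGraph_induction (p := fun q => inner ℝ (toL2 T P) q.2 =
    inner ℝ (toL2 T (polS Y P - fockA T a Y P)) q.1)
    (isClosed_eq (by fun_prop) (by fun_prop)) (fun q hq => ?_) hq
  obtain ⟨Λ, f, hf, h1, h2, m1, m2⟩ := preGraph_elim hq
  rw [inner_congr (coeFn_toL2 P) h2, inner_congr (coeFn_toL2 _) h1, map_sub, ← polS_wick,
    ← polA_wick]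
  exact integral_pev_mul_gen hf m1 m2 fun i x hx => by rw [rotP_wick, hY i x hx, map_zero]

lemma inner_graph_nonpos [Nonempty (Fin d)] {q : L2 d T × L2 d T} (hq : q ∈ closedGraph d T a) :
    0 ≤ -inner ℝ q.1 q.2 := by
  refine closedGraph_induction (p := fun q => 0 ≤ -inner ℝ q.1 q.2)
    (isClosed_le (by fun_prop) (by fun_prop)) (fun q hq => ?_) hq
  obtain ⟨Λ, f, hf, h1, h2, m1, m2⟩ := preGraph_elim hq
  rw [inner_congr h1 h2]
  simpa using (dirichlet_le hf m1 m2).2 ∅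

/-- Cauchy–Schwarz after the field is moved from `G` to `u`. The rotation is kept on the test side
because this form of the inequality is continuous in `(u, L u)` and survives the closure, where `rot
u` has no direct meaning. -/
lemma sq_sum_inner_rotP_le [Nonempty (Fin d)] (Y : Finset (Site d)) (G : Fin d → Site d → Pol d)
    {q : L2 d T × L2 d T} (hq : q ∈ closedGraph d T a) :
    (∑ i, ∑ x ∈ Y, inner ℝ (toL2 T (rotP x (x + e i) (G i x))) q.1) ^ 2 ≤
      (∑ i, ∑ x ∈ Y, ‖toL2 T (G i x)‖ ^ 2) * -inner ℝ q.1 q.2 := by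
  refine closedGraph_induction
    (p := fun q => (∑ i, ∑ x ∈ Y, inner ℝ (toL2 T (rotP x (x + e i) (G i x))) q.1) ^ 2 ≤
      (∑ i, ∑ x ∈ Y, ‖toL2 T (G i x)‖ ^ 2) * -inner ℝ q.1 q.2)
    (isClosed_le (by fun_prop) (by fun_prop)) (fun q hq => ?_) hq
  obtain ⟨Λ, f, hf, h1, h2, m1, m2⟩ := preGraph_elim hq
  obtain ⟨hL, hD⟩ := dirichlet_le hf m1 m2
  rw [inner_congr h1 h2]
  have e1 : ∀ i x, inner ℝ (toL2 T (rotP x (x + e i) (G i x))) q.1 =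
      -inner ℝ (toL2 T (G i x)) ((hL i x).toLp _) := by
    intro i x
    rw [inner_congr (coeFn_toL2 _) h1, inner_congr (coeFn_toL2 _) (MemLp.coeFn_toLp _),
      integral_pev_mul_rot (ne_add_e x i) hf m1 (hL i x), rotP_wick, neg_neg]
  have e2 : ∀ i x, ‖(hL i x).toLp _‖ ^ 2 =
      ∫ p, rot x (x + e i) f p * rot x (x + e i) f p ∂gibbs d T := by
    intro i x
    rw [← real_inner_self_eq_norm_sq]
    exact inner_congr (MemLp.coeFn_toLp _) (MemLp.coeFn_toLp _)
  simp_rw [e1]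
  have hD' := hD Y
  simp_rw [← e2] at hD'
  simp only [← Finset.sum_product'] at *
  have h3 : |∑ z ∈ Finset.univ ×ˢ Y, -inner ℝ (toL2 T (G z.1 z.2)) ((hL z.1 z.2).toLp _)| ≤
      ∑ z ∈ Finset.univ ×ˢ Y, ‖toL2 T (G z.1 z.2)‖ * ‖(hL z.1 z.2).toLp _‖ := by
    refine (Finset.abs_sum_le_sum_abs _ _).trans (Finset.sum_le_sum fun z _ => ?_)
    rw [abs_neg]; exact abs_real_inner_le_norm _ _
  calc _ ≤ (∑ z ∈ Finset.univ ×ˢ Y, ‖toL2 T (G z.1 z.2)‖ * ‖(hL z.1 z.2).toLp _‖) ^ 2 := by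
        rw [← sq_abs]; gcongr
    _ ≤ _ := Finset.sum_mul_sq_le_sq_mul_sq _ _ _
    _ ≤ _ := mul_le_mul_of_nonneg_left hD' (Finset.sum_nonneg fun _ _ => sq_nonneg _)

lemma partialDeriv_comp_shift (z x : Site d) (f : Config d → ℝ) (p : Config d) :
    partialDeriv x (fun p => f (shift z p)) p = partialDeriv (x - z) f (shift z p) := by
  classical
  have h1 : ∀ s, shift z (Function.update p x s) = Function.update (shift z p) (x - z) s := by
    intro s; funext y
    simp only [shift, Function.update_apply, eq_sub_iff_add_eq]
  simp only [partialDeriv, h1]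
  simp [shift]

lemma rot_comp_shift (z x y : Site d) (f : Config d → ℝ) :
    rot x y (fun p => f (shift z p)) = fun p => rot (x - z) (y - z) f (shift z p) := by
  funext p
  simp [rot, partialDeriv_comp_shift, shift]

lemma gen_comp_shift (z : Site d) (f : Config d → ℝ) (p : Config d) :
    gen a (fun p => f (shift z p)) p = gen a f (shift z p) := by
  have key : ∀ g : Site d → ℝ, ∑ᶠ x, g x = ∑ᶠ x, g (x + z) := fun g =>
    (finsum_comp_equiv (Equiv.addRight z) (f := g)).symm
  simp only [gen, genS, genA]
  congr 1
  · refine Finset.sum_congr rfl fun i _ => ?_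
    rw [key]
    refine finsum_congr fun x => ?_
    have hx : x + z + e i - z = x + e i := by abel
    rw [rot_comp_shift, rot_comp_shift z _ _ (rot (x + z - z) (x + z + e i - z) f),
      add_sub_cancel_right, hx]
  · refine Finset.sum_congr rfl fun i _ => ?_
    rw [key]
    congr 1
    refine finsum_congr fun x => ?_
    have hx : x + z + e i - z = x + e i := by abel
    rw [rot_comp_shift, add_sub_cancel_right, hx]
    simp only [shift]
    rw [add_right_comm]

/-- The shift operator `τ_z` on `𝕃²(μ_T)`. -/
noncomputable def shiftL2 (z : Site d) : L2 d T →+ L2 d T :=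
  Lp.compMeasurePreserving (shift z) (measurePreserving_shift z)

lemma coeFn_shiftL2 (z : Site d) (u : L2 d T) :
    (shiftL2 z u : Config d → ℝ) =ᵐ[gibbs d T] fun p => u (shift z p) :=
  Lp.coeFn_compMeasurePreserving u (measurePreserving_shift z)

lemma ae_shift {z : Site d} {f g : Config d → ℝ} (h : f =ᵐ[gibbs d T] g) :
    (fun p => f (shift z p)) =ᵐ[gibbs d T] fun p => g (shift z p) :=
  (measurePreserving_shift z).quasiMeasurePreserving.ae_eq_comp h

lemma continuous_shiftL2 (z : Site d) : Continuous (shiftL2 (T := T) z) :=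
  (Lp.isometry_compMeasurePreserving (measurePreserving_shift z)).continuous

lemma shiftL2_mem_closedGraph (z : Site d) {u g : L2 d T} (h : (u, g) ∈ closedGraph d T a) :
    (shiftL2 z u, shiftL2 z g) ∈ closedGraph d T a := by
  have hc : Continuous fun q : L2 d T × L2 d T => (shiftL2 z q.1, shiftL2 z q.2) :=
    ((continuous_shiftL2 z).comp continuous_fst).prodMk ((continuous_shiftL2 z).comp continuous_snd)
  refine map_mem_closure (f := fun q : L2 d T × L2 d T => (shiftL2 z q.1, shiftL2 z q.2))
    (x := (u, g)) hc h fun q hq => ?_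
  obtain ⟨f, ⟨Λ, φ, hφ, hf⟩, h1, h2⟩ := hq
  refine ⟨fun p => f (shift z p), ?_, ?_, ?_⟩
  · classical
    refine ⟨Λ.image (· + z), fun q => φ fun x => q ⟨x + z, Finset.mem_image_of_mem _ x.2⟩,
      hφ.comp (contDiff_pi.2 fun x => contDiff_apply ℝ ℝ _), ?_⟩
    funext p; simp [hf, shift]
  · exact (coeFn_shiftL2 z _).trans (ae_shift h1)
  · refine (coeFn_shiftL2 z _).trans ((ae_shift h2).trans (ae_of_all _ fun p => ?_))
    exact (gen_comp_shift z f p).symm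

end ClosedGraph

/-! ### Dyadic flows from a point to the uniform distribution on a box -/

section Flow

variable {d : ℕ}

/-- The box with sides `2L` in the directions of `J` and `L` in the others. -/
noncomputable def corner (L : ℕ) (J : Finset (Fin d)) : Finset (Site d) :=
  Fintype.piFinset fun i => Finset.Ico 0 (if i ∈ J then 2 * (L : ℤ) else L)

lemma mem_corner {L : ℕ} {J : Finset (Fin d)} {x : Site d} :
    x ∈ corner L J ↔ ∀ i, 0 ≤ x i ∧ x i < if i ∈ J then 2 * (L : ℤ) else L := by
  simp [corner, Fintype.mem_piFinset]

lemma smul_e_apply (l : ℕ) (i j : Fin d) : ((l : ℤ) • (e j : Site d)) i = if i = j then (l : ℤ) else 0 := by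
  simp [e, Pi.single_apply]

lemma sum_corner_insert {V : Type*} [AddCommGroup V] {L : ℕ} {J : Finset (Fin d)} {j : Fin d}
    (hj : j ∉ J) (h : Site d → V) :
    ∑ y ∈ corner L (insert j J), h y =
      ∑ x ∈ corner L J, h x + ∑ x ∈ corner L J, h (x + (L : ℤ) • e j) := by
  classical
  rw [← Finset.sum_filter_add_sum_filter_not _ (fun y : Site d => y j < L)]
  congr 1
  · refine Finset.sum_congr ?_ fun _ _ => rfl
    ext x
    simp only [Finset.mem_filter, mem_corner, Finset.mem_insert]
    constructor
    · rintro ⟨h1, h2⟩ i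
      refine ⟨(h1 i).1, ?_⟩
      by_cases hij : i = j
      · subst hij; simpa [hj] using h2
      · simpa [hij] using (h1 i).2
    · intro h1
      have hjL : x j < L := by simpa [hj] using (h1 j).2
      refine ⟨fun i => ⟨(h1 i).1, ?_⟩, hjL⟩
      by_cases hij : i = j
      · subst hij; simp; have := (h1 i).1; omega
      · simpa [hij] using (h1 i).2
  · symm
    refine Finset.sum_bij (fun x _ => x + (L : ℤ) • e j) (fun x hx => ?_)
      (fun x _ y _ hxy => by simpa using hxy) (fun y hy => ?_) (fun _ _ => rfl)
    · rw [mem_corner] at hx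
      simp only [Finset.mem_filter, mem_corner, Finset.mem_insert, Pi.add_apply, smul_e_apply, if_true]
      refine ⟨fun i => ?_, by have := (hx j).1; omega⟩
      by_cases hij : i = j
      · subst hij
        have := hx i
        simp only [hj, if_false] at this
        simp; omega
      · simpa [hij] using hx i
    · simp only [Finset.mem_filter, mem_corner, Finset.mem_insert, not_lt] at hy
      refine ⟨y - (L : ℤ) • e j, ?_, by simp⟩
      rw [mem_corner]
      intro i
      simp only [Pi.sub_apply, smul_e_apply]
      have h1 := hy.1 i
      by_cases hij : i = j
      · subst hij
        simp only [true_or, if_true] at h1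
        simp only [if_true, hj, if_false]
        have := hy.2
        omega
      · simpa [hij] using h1

lemma card_corner (L : ℕ) (J : Finset (Fin d)) :
    (corner L J).card = ∏ i : Fin d, (if i ∈ J then 2 * L else L) := by
  rw [corner, Fintype.card_piFinset]
  refine Finset.prod_congr rfl fun i _ => ?_
  split_ifs <;> simp
  omega

lemma pow_le_card_corner (L : ℕ) (J : Finset (Fin d)) : L ^ d ≤ (corner L J).card := by
  rw [card_corner]
  calc L ^ d = ∏ _i : Fin d, L := by simp
    _ ≤ _ := Finset.prod_le_prod' fun i _ => by split_ifs <;> omega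

lemma card_corner_univ (L : ℕ) : (corner (d := d) L Finset.univ).card = (2 * L) ^ d := by
  rw [card_corner]; simp

lemma card_corner_empty (L : ℕ) : (corner (d := d) L ∅).card = L ^ d := by
  rw [card_corner]; simp

lemma corner_univ (L : ℕ) : corner (d := d) L Finset.univ = corner (2 * L) ∅ := by
  ext x; simp [mem_corner]

/-- The straight-line flow that moves half of the uniform mass of a box by `L` in direction `j`. -/
noncomputable def lineFlow (B : Finset (Site d)) (L : ℕ) (j : Fin d) : Site d →₀ ℝ :=
  ∑ x ∈ B, ∑ l ∈ Finset.range L, Finsupp.single (x + (l : ℤ) • e j) (-(2 * (B.card : ℝ))⁻¹)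

lemma linearCombination_lineFlow {V : Type*} [AddCommGroup V] [Module ℝ V] (B : Finset (Site d))
    (L : ℕ) (j : Fin d) (h : Site d → V) :
    Finsupp.linearCombination ℝ (fun x => h (x + e j) - h x) (lineFlow B L j) =
      (-(2 * (B.card : ℝ))⁻¹) • ∑ x ∈ B, (h (x + (L : ℤ) • e j) - h x) := by
  simp only [lineFlow, map_sum, Finsupp.linearCombination_single, ← Finset.smul_sum]
  congr 1
  refine Finset.sum_congr rfl fun x _ => ?_
  have := Finset.sum_range_sub (fun l : ℕ => h (x + (l : ℤ) • e j)) L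
  simp only [Nat.cast_zero, zero_smul, add_zero] at this
  rw [← this]
  refine Finset.sum_congr rfl fun l _ => ?_
  rw [Nat.cast_succ, add_smul, one_smul, add_assoc]

lemma abs_lineFlow_le (B : Finset (Site d)) (L : ℕ) (j : Fin d) (y : Site d) :
    |lineFlow B L j y| ≤ L * (2 * (B.card : ℝ))⁻¹ := by
  classical
  simp only [lineFlow, Finsupp.coe_finsetSum, Finset.sum_apply, Finsupp.single_apply]
  rw [Finset.sum_comm]
  refine (Finset.abs_sum_le_sum_abs _ _).trans ?_
  calc _ ≤ ∑ _l ∈ Finset.range L, (2 * (B.card : ℝ))⁻¹ := by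
        refine Finset.sum_le_sum fun l _ => ?_
        have : ∀ x, (x + (l : ℤ) • e j = y) ↔ (x = y - (l : ℤ) • e j) := fun x =>
          eq_sub_iff_add_eq.symm
        simp only [this, Finset.sum_ite_eq']
        split_ifs
        · rw [abs_neg, abs_of_nonneg (by positivity)]
        · simp
    _ = _ := by simp

lemma sum_abs_lineFlow_le (B : Finset (Site d)) (hB : B.Nonempty) (L : ℕ) (j : Fin d)
    (S : Finset (Site d)) : ∑ y ∈ S, |lineFlow B L j y| ≤ L / 2 := by
  classical
  have hB' : (0 : ℝ) < B.card := by exact_mod_cast hB.card_pos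
  calc ∑ y ∈ S, |lineFlow B L j y|
      ≤ ∑ y ∈ S, ∑ x ∈ B, ∑ l ∈ Finset.range L,
          (if x + (l : ℤ) • e j = y then (2 * (B.card : ℝ))⁻¹ else 0) := by
        refine Finset.sum_le_sum fun y _ => ?_
        simp only [lineFlow, Finsupp.coe_finsetSum, Finset.sum_apply, Finsupp.single_apply]
        refine (Finset.abs_sum_le_sum_abs _ _).trans (Finset.sum_le_sum fun x _ => ?_)
        refine (Finset.abs_sum_le_sum_abs _ _).trans (Finset.sum_le_sum fun l _ => ?_)
        split_ifs
        · rw [abs_neg, abs_of_nonneg (by positivity)]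
        · simp
    _ = ∑ x ∈ B, ∑ l ∈ Finset.range L, ∑ y ∈ S,
          (if x + (l : ℤ) • e j = y then (2 * (B.card : ℝ))⁻¹ else 0) := by
        rw [Finset.sum_comm]
        exact Finset.sum_congr rfl fun x _ => Finset.sum_comm
    _ ≤ ∑ x ∈ B, ∑ l ∈ Finset.range L, (2 * (B.card : ℝ))⁻¹ := by
        refine Finset.sum_le_sum fun x _ => Finset.sum_le_sum fun l _ => ?_
        rw [Finset.sum_ite_eq]
        split_ifs
        · exact le_rfl
        · positivity
    _ = L / 2 := by
        simp only [Finset.sum_const, Finset.card_range, nsmul_eq_mul]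
        field_simp

/-- A bound for the energy of the dyadic flow up to scale `2 ^ n`. -/
noncomputable def flowEnergy (d n : ℕ) : ℝ := ∑ m ∈ Finset.range n, 2 * (4 ^ m / (2 ^ m) ^ d : ℝ)

/-- Unit flows from the origin to the uniform distribution on a dyadic box. -/
lemma exists_flow (d n : ℕ) : ∃ θ : Fin d → Site d →₀ ℝ,
    (∀ h : Site d → Pol d, h 0 = ((2 ^ n : ℝ) ^ d)⁻¹ • ∑ y ∈ corner (2 ^ n) ∅, h y +
      ∑ j, Finsupp.linearCombination ℝ (fun x => h (x + e j) - h x) (θ j)) ∧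
    (∀ j S, ∑ y ∈ S, |θ j y| ≤ 2 ^ n) ∧ ∀ j S, ∑ y ∈ S, θ j y ^ 2 ≤ flowEnergy d n := by
  classical
  induction n with
  | zero =>
    refine ⟨0, fun h => ?_, fun j S => by simp, fun j S => by simp [flowEnergy]⟩
    have : corner (d := d) 1 ∅ = {0} := by
      ext x
      simp only [mem_corner, Finset.mem_singleton, funext_iff, Pi.zero_apply]
      refine forall_congr' fun i => ?_
      simp; omega
    simp [this]
  | succ n ih =>
    obtain ⟨θ₀, hθ₀, hl₀, hE₀⟩ := ih
    -- One scale doubles the box in one direction after the other. The clause `θ j = θ₀ j` for `j ∉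
    -- J` keeps the bounds of the previous scale available when direction `j` receives its new flow.
    have key : ∀ J : Finset (Fin d), ∃ θ : Fin d → Site d →₀ ℝ,
        (∀ h : Site d → Pol d, h 0 = ((corner (2 ^ n) J).card : ℝ)⁻¹ •
          ∑ y ∈ corner (2 ^ n) J, h y +
          ∑ j, Finsupp.linearCombination ℝ (fun x => h (x + e j) - h x) (θ j)) ∧
        (∀ j ∉ J, θ j = θ₀ j) ∧
        (∀ j S, ∑ y ∈ S, |θ j y| ≤ 2 ^ (n + 1)) ∧
        ∀ j S, ∑ y ∈ S, θ j y ^ 2 ≤ flowEnergy d (n + 1) := by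
      intro J
      induction J using Finset.induction_on with
      | empty =>
        refine ⟨θ₀, fun h => ?_, fun _ _ => rfl, fun j S => (hl₀ j S).trans ?_, fun j S =>
          (hE₀ j S).trans ?_⟩
        · rw [card_corner_empty]; push_cast; exact hθ₀ h
        · gcongr <;> simp
        · rw [flowEnergy, flowEnergy, Finset.sum_range_succ]
          have : (0 : ℝ) ≤ 2 * (4 ^ n / (2 ^ n) ^ d) := by positivity
          linarith
      | insert j J hj ihJ =>
        obtain ⟨θ, hθ, hne, hl, hE⟩ := ihJ
        set B := corner (2 ^ n) J with hB
        have hcard : (2 ^ n) ^ d ≤ B.card := pow_le_card_corner _ _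
        have hBpos : 0 < B.card := lt_of_lt_of_le (by positivity) hcard
        have hBne : B.Nonempty := Finset.card_pos.1 hBpos
        have hBR : (0 : ℝ) < B.card := by exact_mod_cast hBpos
        have hcardR : ((2 : ℝ) ^ n) ^ d ≤ B.card := by exact_mod_cast hcard
        have hcard' : (corner (2 ^ n) (insert j J)).card = 2 * B.card := by
          rw [card_corner, hB, card_corner, ← Finset.mul_prod_erase _ _ (Finset.mem_univ j),
            ← Finset.mul_prod_erase (f := fun i => if i ∈ J then 2 * 2 ^ n else 2 ^ n) _
              (Finset.mem_univ j)]
          simp only [Finset.mem_insert, true_or, if_true, hj, if_false, mul_assoc]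
          congr 2
          refine Finset.prod_congr rfl fun i hi => ?_
          simp [Finset.ne_of_mem_erase hi]
        refine ⟨Function.update θ j (θ j + lineFlow B (2 ^ n) j), fun h => ?_, fun i hi => ?_,
          fun i S => ?_, fun i S => ?_⟩
        · rw [hcard', sum_corner_insert hj, hθ h, ← Finset.add_sum_erase _ _ (Finset.mem_univ j),
            ← Finset.add_sum_erase (f := fun i => Finsupp.linearCombination ℝ
              (fun x => h (x + e i) - h x) (Function.update θ j (θ j + lineFlow B (2 ^ n) j) i)) _
              (Finset.mem_univ j)]
          rw [Function.update_self, map_add, linearCombination_lineFlow, Finset.sum_sub_distrib]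
          rw [Finset.sum_congr rfl (fun i hi => by
            rw [← Function.update_of_ne (Finset.ne_of_mem_erase hi)
              (θ j + lineFlow B (2 ^ n) j) θ] : ∀ i ∈ Finset.univ.erase j,
              Finsupp.linearCombination ℝ (fun x => h (x + e i) - h x) (θ i) =
              Finsupp.linearCombination ℝ (fun x => h (x + e i) - h x)
                (Function.update θ j (θ j + lineFlow B (2 ^ n) j) i))]
          -- Half of the mass at each site stays, the other half moves by `2 ^ n` along the line
          -- flow.
          have h2 : (B.card : ℝ)⁻¹ = (2 * (B.card : ℝ))⁻¹ + (2 * (B.card : ℝ))⁻¹ := by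
            field_simp; norm_num
          rw [h2]
          push_cast
          module
        · rw [Finset.mem_insert, not_or] at hi
          rw [Function.update_of_ne hi.1, hne i hi.2]
        · by_cases hij : i = j
          · subst hij
            rw [Function.update_self]
            have h1 := hl₀ i S
            rw [← hne i hj] at h1
            have h2 := sum_abs_lineFlow_le B hBne (2 ^ n) i S
            push_cast at h2
            calc _ ≤ ∑ y ∈ S, (|θ i y| + |lineFlow B (2 ^ n) i y|) :=
                  Finset.sum_le_sum fun y _ => abs_add_le _ _
              _ ≤ 2 ^ n + 2 ^ n / 2 := by rw [Finset.sum_add_distrib]; exact add_le_add h1 h2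
              _ ≤ _ := by rw [pow_succ]; linarith [show (0 : ℝ) < 2 ^ n by positivity]
          · rw [Function.update_of_ne hij]; exact hl i S
        · by_cases hij : i = j
          · subst hij
            rw [Function.update_self]
            have h1 := hl₀ i S
            have h1' := hE₀ i S
            rw [← hne i hj] at h1 h1'
            have h2 := sum_abs_lineFlow_le B hBne (2 ^ n) i S
            have h3 := abs_lineFlow_le B (2 ^ n) i
            push_cast at h2 h3
            set s : ℝ := 2 ^ n * (2 * (B.card : ℝ))⁻¹ with hs
            have hs0 : 0 ≤ s := by positivity
            -- The line flow is at most `s` everywhere, so the added energy is controlled by `s`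
            -- times total variations of order `2 ^ n`.
            have hpt : ∀ y, (θ i + lineFlow B (2 ^ n) i) y ^ 2 ≤
                θ i y ^ 2 + s * (2 * |θ i y| + |lineFlow B (2 ^ n) i y|) := by
              intro y
              rw [Finsupp.add_apply]
              have h4 := h3 y
              have h5 : θ i y * lineFlow B (2 ^ n) i y ≤ |θ i y| * s := by
                calc _ ≤ |θ i y * lineFlow B (2 ^ n) i y| := le_abs_self _
                  _ = |θ i y| * |lineFlow B (2 ^ n) i y| := abs_mul _ _
                  _ ≤ _ := mul_le_mul_of_nonneg_left h4 (abs_nonneg _)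
              have h6 : lineFlow B (2 ^ n) i y ^ 2 ≤ s * |lineFlow B (2 ^ n) i y| := by
                rw [← sq_abs, pow_two]
                exact mul_le_mul_of_nonneg_right h4 (abs_nonneg _)
              nlinarith
            have hsb : s ≤ 2 ^ n / (2 * ((2 : ℝ) ^ n) ^ d) := by
              rw [hs, div_eq_mul_inv]; gcongr
            calc _ ≤ ∑ y ∈ S, (θ i y ^ 2 + s * (2 * |θ i y| + |lineFlow B (2 ^ n) i y|)) :=
                  Finset.sum_le_sum fun y _ => hpt y
              _ = ∑ y ∈ S, θ i y ^ 2 + s * (2 * ∑ y ∈ S, |θ i y| +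
                    ∑ y ∈ S, |lineFlow B (2 ^ n) i y|) := by
                  rw [Finset.sum_add_distrib, ← Finset.mul_sum, Finset.sum_add_distrib,
                    Finset.mul_sum _ _ (2 : ℝ)]
              _ ≤ flowEnergy d n + 2 ^ n / (2 * ((2 : ℝ) ^ n) ^ d) *
                    (2 * 2 ^ n + 2 ^ n / 2) := by gcongr
              _ ≤ _ := by
                  rw [flowEnergy, flowEnergy, Finset.sum_range_succ]
                  refine add_le_add_right ?_ _
                  have h4 : (4 : ℝ) ^ n = 2 ^ n * 2 ^ n := by rw [← mul_pow]; norm_num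
                  rw [h4]
                  -- The increment is `5/4` of the dyadic ratio, below the factor `2` built into
                  -- `flowEnergy`.
                  have h5 : (2 : ℝ) ^ n / (2 * ((2 : ℝ) ^ n) ^ d) * (2 * 2 ^ n + 2 ^ n / 2) =
                      5 / 4 * (2 ^ n * 2 ^ n / ((2 : ℝ) ^ n) ^ d) := by
                    field_simp; norm_num
                  rw [h5]
                  have : (0 : ℝ) < 2 ^ n * 2 ^ n / ((2 : ℝ) ^ n) ^ d := by positivity
                  linarith
          · rw [Function.update_of_ne hij]; exact hE i S
    obtain ⟨θ, hθ, -, hl, hE⟩ := key Finset.univ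
    refine ⟨θ, fun h => ?_, hl, hE⟩
    have := hθ h
    rw [card_corner_univ, corner_univ] at this
    rw [pow_succ', pow_succ']
    push_cast at this
    exact this

end Flow

/-! ### The dual resolvent norm and the transport of squared momenta -/

section ResolventNorm

variable {d : ℕ} {T lam : ℝ} {a : Fin d → ℝ} {q : L2 d T × L2 d T}

open MvPolynomial (X pderiv monomial)

/-- The squared resolvent norm `lam ‖u‖² - ⟨u, L u⟩` of a point `(u, L u)` of the graph. -/
noncomputable def energyNorm (lam : ℝ) (q : L2 d T × L2 d T) : ℝ :=
  lam * ‖q.1‖ ^ 2 - inner ℝ q.1 q.2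

/-- The functional `⟨P, u⟩` is bounded by `K` times the resolvent norm of `u`. -/
def HBound (lam : ℝ) (q : L2 d T × L2 d T) (P : Pol d) (K : ℝ) : Prop :=
  |inner ℝ (toL2 T P) q.1| ≤ K * √(energyNorm lam q)

namespace HBound

lemma add {P Q : Pol d} {K L : ℝ} (h : HBound lam q P K) (h' : HBound lam q Q L) :
    HBound lam q (P + Q) (K + L) := by
  unfold HBound at *
  rw [map_add, inner_add_left, add_mul]
  exact (abs_add_le _ _).trans (add_le_add h h')

lemma smul {P : Pol d} {K : ℝ} (c : ℝ) (h : HBound lam q P K) :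
    HBound lam q (c • P) (|c| * K) := by
  unfold HBound at *
  rw [map_smul, inner_smul_left, abs_mul, mul_assoc]
  exact mul_le_mul_of_nonneg_left h (abs_nonneg _)

lemma mono {P : Pol d} {K L : ℝ} (h : HBound lam q P K) (hKL : K ≤ L) : HBound lam q P L :=
  le_trans h (mul_le_mul_of_nonneg_right hKL (Real.sqrt_nonneg _))

lemma zero : HBound lam q (0 : Pol d) 0 := by simp [HBound]

lemma sum {ι : Type*} {s : Finset ι} {P : ι → Pol d} {K : ι → ℝ}
    (h : ∀ i ∈ s, HBound lam q (P i) (K i)) : HBound lam q (∑ i ∈ s, P i) (∑ i ∈ s, K i) := by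
  classical
  induction s using Finset.induction_on with
  | empty => simpa using zero
  | insert i s hi ih =>
    rw [Finset.sum_insert hi, Finset.sum_insert hi]
    exact (h i (by simp)).add (ih fun j hj => h j (by simp [hj]))

/-- `lam ‖u‖²` is at most the squared resolvent norm, because the Dirichlet form is nonnegative. -/
lemma of_norm [Nonempty (Fin d)] (hlam : 0 < lam) (hq : q ∈ closedGraph d T a) {P : Pol d} {S : ℝ}
    (hS : ‖toL2 T P‖ ^ 2 ≤ S) : HBound lam q P (√(S / lam)) := by
  have h1 := abs_real_inner_le_norm (toL2 T P) q.1
  have h2 := inner_graph_nonpos hq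
  refine h1.trans ?_
  rw [← Real.sqrt_mul (div_nonneg ((sq_nonneg _).trans hS) hlam.le)]
  refine Real.le_sqrt_of_sq_le ?_
  rw [mul_pow, energyNorm]
  have h3 : ‖q.1‖ ^ 2 ≤ (lam * ‖q.1‖ ^ 2 - inner ℝ q.1 q.2) / lam := by
    rw [le_div_iff₀ hlam]; linarith
  calc _ ≤ S * ((lam * ‖q.1‖ ^ 2 - inner ℝ q.1 q.2) / lam) :=
        mul_le_mul hS h3 (sq_nonneg _) ((sq_nonneg _).trans hS)
    _ = _ := by ring

/-- The Dirichlet form alone is at most the squared resolvent norm; no power of `lam` is lost. -/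
lemma of_rot [Nonempty (Fin d)] (hlam : 0 < lam) (hq : q ∈ closedGraph d T a)
    (Y : Finset (Site d)) (G : Fin d → Site d → Pol d) {S : ℝ}
    (hS : ∑ i, ∑ x ∈ Y, ‖toL2 T (G i x)‖ ^ 2 ≤ S) :
    HBound lam q (∑ i, ∑ x ∈ Y, rotP x (x + e i) (G i x)) (√S) := by
  have h1 := sq_sum_inner_rotP_le Y G hq
  have h2 := inner_graph_nonpos hq
  have hS0 : 0 ≤ S := (Finset.sum_nonneg fun _ _ => Finset.sum_nonneg fun _ _ =>
    sq_nonneg _).trans hS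
  unfold HBound
  rw [← Real.sqrt_mul hS0]
  refine Real.le_sqrt_of_sq_le ?_
  rw [sq_abs, map_sum, sum_inner]
  simp_rw [map_sum, sum_inner]
  refine h1.trans ?_
  refine mul_le_mul hS ?_ h2 hS0
  rw [energyNorm]
  nlinarith [sq_nonneg ‖q.1‖]

end HBound

/-- The constant in the norm bound for combinations of monomials. -/
noncomputable def normConst (T : ℝ) (n r : ℕ) : ℝ := (n ^ r : ℕ) * (n.factorial * T ^ n)

lemma normConst_nonneg (hT : 0 < T) (n r : ℕ) : 0 ≤ normConst T n r := by
  unfold normConst; positivity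

lemma card_support_le_degree (α : Site d →₀ ℕ) : α.support.card ≤ α.degree := by
  rw [Finsupp.degree_apply, Finset.card_eq_sum_ones]
  refine Finset.sum_le_sum fun x hx => ?_
  have := Finsupp.mem_support_iff.1 hx
  omega

/-- A norm bound for combinations of monomials that are determined by `r` sites of their
support. -/
lemma norm_sq_toL2_le [Nonempty (Fin d)] (hT : 0 < T) {ι : Type*} (s : Finset ι)
    (c : ι → ℝ) (α : ι → Site d →₀ ℕ) {n r : ℕ} (hn : ∀ i ∈ s, (α i).degree = n)
    (key : ι → Fin r → Site d) (hinj : Set.InjOn key s)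
    (hkey : ∀ i ∈ s, ∀ k, α i (key i k) ≠ 0) :
    ‖toL2 T (∑ i ∈ s, c i • monomial (α i) 1)‖ ^ 2 ≤ normConst T n r * ∑ i ∈ s, c i ^ 2 := by
  classical
  refine norm_sq_toL2_sum_le hT s c α hn fun i hi => ?_
  -- Indices with the same monomial have their `r` keys in one support of at most `n` sites, and the
  -- keys determine the index.
  calc _ ≤ (Fintype.piFinset fun _ : Fin r => (α i).support).card := by
        refine Finset.card_le_card_of_injOn key (fun j hj => ?_)
          (hinj.mono fun j hj => (Finset.mem_filter.1 hj).1)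
        have hj' := Finset.mem_filter.1 hj
        refine Fintype.mem_piFinset.2 fun k => ?_
        rw [Finsupp.mem_support_iff, ← hj'.2]
        exact hkey j hj'.1 k
    _ = (α i).support.card ^ r := by simp
    _ ≤ n ^ r := Nat.pow_le_pow_left ((card_support_le_degree _).trans_eq (hn i hi)) r

/-- `X^ξ X_z²`, normalized so that its gradient in `z` is of the form `rot G`. -/
noncomputable def walker (ξ : Site d →₀ ℕ) (z : Site d) : Pol d :=
  (1 + (ξ z : ℝ))⁻¹ • monomial (ξ + Finsupp.single z 2) 1

/-- On the monomial the term `X_y ∂_x` produces the factor `1 + ξ x` and `X_x ∂_y` the factor `1 + ξ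
y`; the weights in `walker` are those for which the difference becomes a single `rotP`. -/
lemma walker_sub (ξ : Site d →₀ ℕ) {x y : Site d} (hxy : x ≠ y) :
    walker ξ y - walker ξ x = rotP x y (((1 + (ξ x : ℝ)) * (1 + ξ y))⁻¹ •
      monomial (ξ + Finsupp.single x 1 + Finsupp.single y 1) (1 : ℝ)) := by
  have hx : ξ + Finsupp.single x 1 + Finsupp.single y 1 - Finsupp.single x 1 =
      ξ + Finsupp.single y 1 := by rw [add_right_comm, add_tsub_cancel_right]
  have h1 : ∀ (α : Site d →₀ ℕ) (z : Site d) (c : ℝ),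
      X z * monomial (α + Finsupp.single z 1) c = c • monomial (α + Finsupp.single z 2) (1 : ℝ) := by
    intro α z c
    rw [MvPolynomial.X, MvPolynomial.monomial_mul, MvPolynomial.smul_monomial, one_mul, smul_eq_mul,
      mul_one, add_comm, add_assoc, ← Finsupp.single_add]
  rw [Derivation.map_smul, rotP_apply, MvPolynomial.pderiv_monomial, MvPolynomial.pderiv_monomial,
    hx, add_tsub_cancel_right, h1, h1, walker, walker]
  have e1 : (ξ + Finsupp.single x 1 + Finsupp.single y 1 : Site d →₀ ℕ) x = ξ x + 1 := by
    simp [hxy.symm]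
  have e2 : (ξ + Finsupp.single x 1 + Finsupp.single y 1 : Site d →₀ ℕ) y = ξ y + 1 := by
    simp [hxy]
  rw [e1, e2, smul_sub, smul_smul, smul_smul]
  congr 2 <;> · push_cast; field_simp; ring

lemma degree_single (x : Site d) (n : ℕ) : (Finsupp.single x n).degree = n := by
  simp

lemma inv_one_add_nonneg (n : ℕ) : 0 ≤ (1 + (n : ℝ))⁻¹ := by positivity

lemma inv_one_add_le_one (n : ℕ) : (1 + (n : ℝ))⁻¹ ≤ 1 :=
  inv_le_one_of_one_le₀ (by linarith [n.cast_nonneg (α := ℝ)])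

lemma sq_mul_le_sq {c w : ℝ} (h0 : 0 ≤ w) (h1 : w ≤ 1) : (c * w) ^ 2 ≤ c ^ 2 := by
  rw [mul_pow]
  exact mul_le_of_le_one_right (sq_nonneg c) (pow_le_one₀ h0 h1)

lemma gradient_weight (ξ : Site d →₀ ℕ) (x y : Site d) :
    0 ≤ ((1 + (ξ x : ℝ)) * (1 + ξ y))⁻¹ ∧ ((1 + (ξ x : ℝ)) * (1 + ξ y))⁻¹ ≤ 1 := by
  refine ⟨by positivity, ?_⟩
  rw [mul_inv]
  exact mul_le_one₀ (inv_one_add_le_one _) (inv_one_add_nonneg _) (inv_one_add_le_one _)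

/-- The resolvent norm of a combination of walkers, by transporting each of them along the
dyadic flow up to the scale `2 ^ m`. -/
lemma HBound.flow [Nonempty (Fin d)] (hT : 0 < T) (hlam : 0 < lam) (hq : q ∈ closedGraph d T a)
    {ι : Type*} (s : Finset ι) (g : ι → ℝ) (base : ι → Site d) (ξ : ι → Site d →₀ ℕ) {n r : ℕ}
    (hn : ∀ i ∈ s, (ξ i).degree = n) (key : ι → Fin r → Site d) (hinj : Set.InjOn key s)
    (hkey : ∀ i ∈ s, ∀ k, ξ i (key i k) ≠ 0) (m : ℕ) :
    HBound lam q (∑ i ∈ s, g i • walker (ξ i) (base i))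
      (√(normConst T (n + 2) (r + 1) * ((((2 : ℝ) ^ m) ^ d)⁻¹ * ∑ i ∈ s, g i ^ 2) / lam) +
        √(normConst T (n + 2) r * (d * flowEnergy d m * ∑ i ∈ s, g i ^ 2))) := by
  classical
  obtain ⟨θ, hθ, -, hE⟩ := exists_flow d m
  set B : Finset (Site d) := corner (2 ^ m) ∅ with hB
  set D : ℝ := ((2 : ℝ) ^ m) ^ d with hD
  have hD0 : 0 < D := by positivity
  have hBD : (B.card : ℝ) = D := by rw [hB, card_corner_empty, hD]; push_cast; rfl
  set Z : Finset (Site d) := s.biUnion fun i => Finset.univ.biUnion fun j =>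
    (θ j).support.image fun b => base i + b with hZ
  set w : ι → Site d → Site d → ℝ := fun i x y => ((1 + (ξ i x : ℝ)) * (1 + ξ i y))⁻¹ with hw
  set G : Fin d → Site d → Pol d := fun j z => ∑ i ∈ s, (g i * θ j (z - base i) * w i z (z + e j)) •
    monomial (ξ i + Finsupp.single z 1 + Finsupp.single (z + e j) 1) 1 with hG
  -- Each walker is its average over a box of side `2 ^ m` placed at its base, plus gradients
  -- weighted by the flow. The averages are spread out and small in norm; the gradients are of the
  -- form `rotP`. The set `Z` collects the bonds visited by any of the flows.
  have hdecomp : ∑ i ∈ s, g i • walker (ξ i) (base i) =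
      ∑ t ∈ s ×ˢ B, (g t.1 * D⁻¹ * (1 + (ξ t.1 (base t.1 + t.2) : ℝ))⁻¹) •
        monomial (ξ t.1 + Finsupp.single (base t.1 + t.2) 2) 1 +
      ∑ j, ∑ z ∈ Z, rotP z (z + e j) (G j z) := by
    have h1 : ∀ i ∈ s, g i • walker (ξ i) (base i) =
        ∑ y ∈ B, (g i * D⁻¹ * (1 + (ξ i (base i + y) : ℝ))⁻¹) •
          monomial (ξ i + Finsupp.single (base i + y) 2) (1 : ℝ) +
        ∑ j, ∑ z ∈ Z, rotP z (z + e j) ((g i * θ j (z - base i) * w i z (z + e j)) •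
          monomial (ξ i + Finsupp.single z 1 + Finsupp.single (z + e j) 1) 1) := by
      intro i hi
      have h2 := hθ fun y => walker (ξ i) (base i + y)
      simp only [add_zero] at h2
      rw [h2, smul_add]
      congr 1
      · rw [smul_smul, Finset.smul_sum]
        refine Finset.sum_congr rfl fun y _ => ?_
        rw [walker, smul_smul]
      · rw [Finset.smul_sum]
        refine Finset.sum_congr rfl fun j _ => ?_
        rw [Finsupp.linearCombination_apply, Finsupp.sum, Finset.smul_sum]
        have hsub : (θ j).support.image (fun b => base i + b) ⊆ Z := fun z hz => by
          rw [hZ]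
          exact Finset.mem_biUnion.2 ⟨i, hi, Finset.mem_biUnion.2 ⟨j, Finset.mem_univ j, hz⟩⟩
        rw [← Finset.sum_subset hsub fun z _ hz => ?_]
        · rw [Finset.sum_image fun b _ b' _ h => by simpa using h]
          refine Finset.sum_congr rfl fun b _ => ?_
          rw [← add_assoc, walker_sub _ (ne_add_e _ _), add_sub_cancel_left, ← Derivation.map_smul,
            ← Derivation.map_smul]
          simp only [hw, smul_smul, mul_assoc]
        · have : θ j (z - base i) = 0 := by
            by_contra hne
            exact hz (Finset.mem_image.2 ⟨z - base i, Finsupp.mem_support_iff.2 hne, by abel⟩)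
          simp [this]
    rw [Finset.sum_congr rfl h1, Finset.sum_add_distrib, Finset.sum_product]
    congr 1
    rw [Finset.sum_comm]
    refine Finset.sum_congr rfl fun j _ => ?_
    rw [Finset.sum_comm]
    refine Finset.sum_congr rfl fun z _ => ?_
    rw [hG, map_sum]
  rw [hdecomp]
  refine HBound.add (HBound.of_norm hlam hq ?_) (HBound.of_rot hlam hq Z G ?_)
  · refine (norm_sq_toL2_le hT (n := n + 2) (r := r + 1) (s ×ˢ B) _ _ (fun t ht => ?_)
      -- The site reached in the box is an additional key, whence `r + 1`.
      (fun t => Fin.cons (base t.1 + t.2) (key t.1)) ?_ ?_).trans ?_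
    · rw [map_add, hn _ (Finset.mem_product.1 ht).1, degree_single]
    · intro t ht t' ht' h
      rw [Finset.mem_coe, Finset.mem_product] at ht ht'
      simp only [] at h
      have h2 : key t.1 = key t'.1 := by
        funext k; simpa using congrFun h k.succ
      have h3 := hinj ht.1 ht'.1 h2
      have h4 := congrFun h 0
      simp only [Fin.cons_zero, h3] at h4
      exact Prod.ext h3 (by simpa using h4)
    · intro t ht k
      rw [Finset.mem_product] at ht
      refine Fin.cases ?_ (fun k => ?_) k
      · simp
      · have := hkey t.1 ht.1 k
        simp [this]
    · refine mul_le_mul_of_nonneg_left ?_ (normConst_nonneg hT _ _)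
      rw [Finset.sum_product]
      calc _ ≤ ∑ i ∈ s, ∑ _y ∈ B, (g i * D⁻¹) ^ 2 := by
            refine Finset.sum_le_sum fun i _ => Finset.sum_le_sum fun y _ => ?_
            exact sq_mul_le_sq (inv_one_add_nonneg _) (inv_one_add_le_one _)
        _ = _ := by
            rw [Finset.mul_sum]
            refine Finset.sum_congr rfl fun i _ => ?_
            rw [Finset.sum_const, nsmul_eq_mul, hBD]
            field_simp
  -- Here the bond is fixed, so the original `r` keys already determine the index.
  · calc ∑ j, ∑ z ∈ Z, ‖toL2 T (G j z)‖ ^ 2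
        ≤ ∑ j, ∑ z ∈ Z, normConst T (n + 2) r * ∑ i ∈ s, (g i ^ 2 * θ j (z - base i) ^ 2) := by
          refine Finset.sum_le_sum fun j _ => Finset.sum_le_sum fun z _ => ?_
          refine (norm_sq_toL2_le hT (n := n + 2) (r := r) s _ _ (fun i hi => ?_) key hinj
            fun i hi k => ?_).trans ?_
          · rw [map_add, map_add, hn i hi, degree_single, degree_single]
          · have := hkey i hi k
            simp [this]
          · refine mul_le_mul_of_nonneg_left ?_ (normConst_nonneg hT _ _)
            refine Finset.sum_le_sum fun i _ => ?_
            rw [← mul_pow]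
            exact sq_mul_le_sq (gradient_weight _ _ _).1 (gradient_weight _ _ _).2
      _ = normConst T (n + 2) r * ∑ j : Fin d, ∑ i ∈ s, g i ^ 2 *
            ∑ z ∈ Z, θ j (z - base i) ^ 2 := by
          rw [Finset.mul_sum]
          refine Finset.sum_congr rfl fun j _ => ?_
          rw [← Finset.mul_sum, Finset.sum_comm]
          simp only [Finset.mul_sum]
      _ ≤ normConst T (n + 2) r * ∑ j : Fin d, ∑ i ∈ s, g i ^ 2 * flowEnergy d m := by
          refine mul_le_mul_of_nonneg_left ?_ (normConst_nonneg hT _ _)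
          refine Finset.sum_le_sum fun j _ => Finset.sum_le_sum fun i _ => ?_
          refine mul_le_mul_of_nonneg_left ?_ (sq_nonneg _)
          have := hE j (Z.image (· - base i))
          rwa [Finset.sum_image fun b _ b' _ h => by simpa using h] at this
      _ = _ := by
          rw [Finset.sum_const, Finset.card_univ, Fintype.card_fin, nsmul_eq_mul, ← Finset.sum_mul]
          ring

end ResolventNorm

/-! ### Algebra of polynomials quadratic in the squared momenta -/

section PairPolynomial

variable {d : ℕ} {T lam : ℝ} {a : Fin d → ℝ} {q : L2 d T × L2 d T}

open MvPolynomial (X pderiv monomial C)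

lemma pderiv_X_sq (u v : Site d) :
    pderiv u (X v ^ 2 : Pol d) = (if v = u then (2 : ℝ) else 0) • X u := by
  rw [Derivation.leibniz_pow]
  split_ifs with h
  · subst h
    rw [MvPolynomial.smul_eq_C_mul, map_ofNat]
    simp
  · simp [MvPolynomial.pderiv_X_of_ne h]

/-- The linear combination `∑ F(v) X_v²`. -/
noncomputable def sqPol (s : Finset (Site d)) (F : Site d → ℝ) : Pol d := ∑ v ∈ s, F v • X v ^ 2

/-- The linear combination `∑ F(x,v) X_x² X_v²`. -/
noncomputable def pairPol (s : Finset (Site d)) (F : Site d → Site d → ℝ) : Pol d :=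
  ∑ x ∈ s, ∑ v ∈ s, F x v • (X x ^ 2 * X v ^ 2)

lemma pderiv_sqPol (s : Finset (Site d)) (F : Site d → ℝ) (u : Site d) (hu : u ∉ s → F u = 0) :
    pderiv u (sqPol s F) = (2 * F u) • X u := by
  classical
  rw [sqPol, map_sum]
  simp only [Derivation.map_smul, pderiv_X_sq, smul_smul, ite_smul, zero_smul,
    smul_ite, smul_zero]
  rw [Finset.sum_ite_eq']
  split_ifs with h
  · rw [mul_comm]
  · rw [hu h]; simp

lemma pderiv_pairPol (s : Finset (Site d)) {F : Site d → Site d → ℝ} (hF : ∀ x v, F x v = F v x)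
    (u : Site d) (hu : u ∉ s → F u = 0) :
    pderiv u (pairPol s F) = 4 * (X u * sqPol s (F u)) := by
  classical
  have h1 : pairPol s F = ∑ x ∈ s, X x ^ 2 * sqPol s (F x) := by
    simp only [pairPol, sqPol, Finset.mul_sum, mul_smul_comm]
  have h2 : ∑ x ∈ s, X x ^ 2 * (2 * F x u) • (X u : Pol d) = 2 * (X u * sqPol s (F u)) := by
    rw [sqPol, Finset.mul_sum, Finset.mul_sum]
    refine Finset.sum_congr rfl fun x _ => ?_
    rw [hF x u, MvPolynomial.smul_eq_C_mul, MvPolynomial.smul_eq_C_mul, map_mul]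
    simp only [map_ofNat]
    ring
  have h3 : ∑ x ∈ s, sqPol s (F x) * (if x = u then (2 : ℝ) else 0) • (X u : Pol d) =
      2 * (X u * sqPol s (F u)) := by
    simp only [ite_smul, zero_smul, mul_ite, mul_zero]
    rw [Finset.sum_ite_eq']
    split_ifs with h
    · rw [MvPolynomial.smul_eq_C_mul, map_ofNat]; ring
    · simp [hu h, sqPol]
  have h4 : ∀ x ∈ s, pderiv u (X x ^ 2 * sqPol s (F x)) = X x ^ 2 * (2 * F x u) • (X u : Pol d) +
      sqPol s (F x) * (if x = u then (2 : ℝ) else 0) • (X u : Pol d) := by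
    intro x _
    rw [Derivation.leibniz, pderiv_sqPol s (F x) u (fun h => by rw [hF, hu h]; rfl), pderiv_X_sq,
      smul_eq_mul, smul_eq_mul]
  rw [h1, map_sum, Finset.sum_congr rfl h4, Finset.sum_add_distrib, h2, h3]
  ring

lemma sqPol_sub (s : Finset (Site d)) (F G : Site d → ℝ) :
    sqPol s F - sqPol s G = sqPol s (F - G) := by
  simp [sqPol, sub_smul]

/-- Both derivatives carry the common factor `X_x X_y`, so the field sees `F` only through its
discrete gradient in the first variable. -/
lemma rotP_pairPol (s : Finset (Site d)) {F : Site d → Site d → ℝ} (hF : ∀ x v, F x v = F v x)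
    {x y : Site d} (hx : x ∉ s → F x = 0) (hy : y ∉ s → F y = 0) :
    rotP x y (pairPol s F) = (4 : ℝ) • (X x * (X y * sqPol s (F x - F y))) := by
  rw [rotP_apply, pderiv_pairPol s hF x hx, pderiv_pairPol s hF y hy, ← sqPol_sub,
    MvPolynomial.smul_eq_C_mul, map_ofNat]
  ring

lemma mulX_smul (c : ℝ) (x : Site d) (P : Pol d) : mulX T x (c • P) = c • mulX T x P := by
  simp only [mulX, Derivation.map_smul, mul_smul_comm, smul_add]
  rw [smul_comm]

/-- Multiplication of `X_x X_y Δ` by `X_x X_y` in terms of Wick products. -/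
lemma mulX_mulX {x y : Site d} (hxy : x ≠ y) {Δ : Pol d} {c c' : ℝ} (hx : pderiv x Δ = c • X x)
    (hy : pderiv y Δ = c' • X y) :
    mulX T x (mulX T y (X x * (X y * Δ))) = X x ^ 2 * X y ^ 2 * Δ +
      (T • ((X x ^ 2 + X y ^ 2) * Δ) + (T * (c + c')) • (X x ^ 2 * X y ^ 2)) +
      (T ^ 2 • Δ + T ^ 2 • (c • X x ^ 2 + c' • X y ^ 2)) := by
  have h1 : pderiv y (X x * (X y * Δ)) = X x * (Δ + c' • X y ^ 2) := by
    rw [Derivation.leibniz, Derivation.leibniz, hy, MvPolynomial.pderiv_X_self,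
      MvPolynomial.pderiv_X_of_ne hxy]
    simp only [smul_eq_mul, MvPolynomial.smul_eq_C_mul]
    ring
  have h2 : mulX T y (X x * (X y * Δ)) = X x * (X y ^ 2 * Δ + T • (Δ + c' • X y ^ 2)) := by
    rw [mulX, h1]
    simp only [MvPolynomial.smul_eq_C_mul]
    ring
  have h3 : pderiv x (X y ^ 2 : Pol d) = 0 := by
    rw [pderiv_X_sq, if_neg hxy.symm, zero_smul]
  have h4 : pderiv x (X x * (X y ^ 2 * Δ + T • (Δ + c' • X y ^ 2))) =
      (X y ^ 2 * Δ + T • (Δ + c' • X y ^ 2)) + c • (X x ^ 2 * X y ^ 2) + (T * c) • X x ^ 2 := by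
    rw [Derivation.leibniz, map_add, Derivation.leibniz, Derivation.map_smul, map_add,
      Derivation.map_smul, h3, hx, MvPolynomial.pderiv_X_self]
    simp only [smul_eq_mul, MvPolynomial.smul_eq_C_mul, map_mul]
    ring
  rw [h2, mulX, h4]
  simp only [MvPolynomial.smul_eq_C_mul, map_mul, map_add, map_pow]
  ring

/-- A sum over a finite set is invariant under shifts if the summand is supported well inside. -/
lemma sum_shift {M : Type*} [AddCommMonoid M] {K K' : Finset (Site d)} (j : Fin d)
    (hK : ∀ x ∈ K, x ∈ K' ∧ x - e j ∈ K') (g : Site d → M) (hg : ∀ x, x ∉ K → g x = 0) :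
    ∑ x ∈ K', g (x + e j) = ∑ x ∈ K', g x := by
  classical
  rw [← Finset.sum_subset (fun x hx => (hK x hx).1) fun x _ hx => hg x hx,
    ← Finset.sum_subset (s₁ := K.image (· - e j)) (s₂ := K') ?_ fun x _ hx => hg _ fun h => hx
      (Finset.mem_image.2 ⟨x + e j, h, by simp⟩)]
  · rw [Finset.sum_image fun b _ b' _ h => by simpa using h]
    simp
  · intro x hx
    obtain ⟨y, hy, rfl⟩ := Finset.mem_image.1 hx
    exact (hK y hy).2

/-- The parts of degrees two and one of the antisymmetric part only see the lack of
translation invariance of `F`. -/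
lemma sum_lower_order {K K' : Finset (Site d)} (j : Fin d)
    (hK : ∀ x ∈ K, x ∈ K' ∧ x - e j ∈ K') {F : Site d → Site d → ℝ}
    (hF : ∀ x v, F x v = F v x) (hs : ∀ x, x ∉ K → F x = 0) :
    ∑ x ∈ K', (T • ((X x ^ 2 + X (x + e j) ^ 2) * sqPol K' (F x - F (x + e j))) +
        (T * (2 * (F x - F (x + e j)) x + 2 * (F x - F (x + e j)) (x + e j))) •
          (X x ^ 2 * X (x + e j) ^ 2) +
        (T ^ 2 • sqPol K' (F x - F (x + e j)) + T ^ 2 •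
          ((2 * (F x - F (x + e j)) x) • X x ^ 2 +
            (2 * (F x - F (x + e j)) (x + e j)) • X (x + e j) ^ 2))) =
      T • ∑ t ∈ K' ×ˢ K', (F t.1 t.2 - F (t.1 + e j) (t.2 + e j)) • (X (t.1 + e j) ^ 2 * X t.2 ^ 2 : Pol d) +
      (2 * T) • ∑ x ∈ K', (F x x - F (x + e j) (x + e j)) • (X x ^ 2 * X (x + e j) ^ 2 : Pol d) +
      (2 * T ^ 2) • ∑ x ∈ K', (F x (x + e j) - F (x + e j) (x + e j + e j)) • X (x + e j) ^ 2 := by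
  have z1 : ∑ x ∈ K', X (x + e j) ^ 2 * sqPol K' (F (x + e j)) =
      ∑ x ∈ K', X x ^ 2 * sqPol K' (F x) :=
    sum_shift j hK (fun x => X x ^ 2 * sqPol K' (F x)) fun x hx => by simp [hs x hx, sqPol]
  have z2 : ∑ x ∈ K', sqPol K' (F (x + e j)) = ∑ x ∈ K', sqPol K' (F x) :=
    sum_shift j hK (fun x => sqPol K' (F x)) fun x hx => by simp [hs x hx, sqPol]
  have z3 : ∑ x ∈ K', F (x + e j) (x + e j) • (X (x + e j) ^ 2 : Pol d) =
      ∑ x ∈ K', F x x • X x ^ 2 :=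
    sum_shift j hK (fun x => F x x • (X x ^ 2 : Pol d)) fun x hx => by simp [hs x hx]
  have z4 : ∑ x ∈ K', F (x + e j) (x + e j + e j) • (X (x + e j) ^ 2 : Pol d) =
      ∑ x ∈ K', F x (x + e j) • X x ^ 2 :=
    sum_shift j hK (fun x => F x (x + e j) • (X x ^ 2 : Pol d)) fun x hx => by simp [hs x hx]
  -- Shifting the second variable too gives this sum the same monomials as `z6`, with coefficients
  -- translated in both variables.
  have z5 : ∑ x ∈ K', X x ^ 2 * sqPol K' (F (x + e j)) =
      ∑ t ∈ K' ×ˢ K', F (t.1 + e j) (t.2 + e j) • (X (t.1 + e j) ^ 2 * X t.2 ^ 2 : Pol d) := by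
    rw [Finset.sum_product_right]
    refine Finset.sum_congr rfl fun x _ => ?_
    rw [sqPol, ← sum_shift j hK (fun v => F (x + e j) v • (X v ^ 2 : Pol d)) fun v hv => by
      rw [hF, hs v hv]; simp, Finset.mul_sum]
    refine Finset.sum_congr rfl fun v _ => ?_
    rw [hF, mul_smul_comm, mul_comm]
  have z6 : ∑ x ∈ K', X (x + e j) ^ 2 * sqPol K' (F x) =
      ∑ t ∈ K' ×ˢ K', F t.1 t.2 • (X (t.1 + e j) ^ 2 * X t.2 ^ 2 : Pol d) := by
    rw [Finset.sum_product]
    refine Finset.sum_congr rfl fun x _ => ?_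
    rw [sqPol, Finset.mul_sum]
    exact Finset.sum_congr rfl fun v _ => mul_smul_comm _ _ _
  simp only [sub_smul, Finset.sum_sub_distrib, ← z5, ← z6, z4]
  rw [← sub_eq_zero]
  -- What is left of the two sides are sums minus their translates, which cancel because `F` is
  -- supported well inside `K'`.
  calc _ = T • (∑ x ∈ K', X x ^ 2 * sqPol K' (F x) -
          ∑ x ∈ K', X (x + e j) ^ 2 * sqPol K' (F (x + e j))) +
        T ^ 2 • (∑ x ∈ K', sqPol K' (F x) - ∑ x ∈ K', sqPol K' (F (x + e j))) +
        (2 * T ^ 2) • (∑ x ∈ K', F x x • (X x ^ 2 : Pol d) -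
          ∑ x ∈ K', F (x + e j) (x + e j) • X (x + e j) ^ 2) := by
        simp only [← Finset.sum_sub_distrib, Finset.smul_sum, ← Finset.sum_add_distrib]
        refine Finset.sum_congr rfl fun x _ => ?_
        rw [← sqPol_sub]
        simp only [MvPolynomial.smul_eq_C_mul, map_mul, map_add, map_sub, map_pow, Pi.sub_apply,
          map_ofNat, hF (x + e j) x]
        ring
    _ = 0 := by rw [z1, z2, z3]; simp

end PairPolynomial

/-! ### The generator on pair polynomials, sorted by degree -/

section PairEstimate

variable {d : ℕ} {T lam : ℝ} {a : Fin d → ℝ} {q : L2 d T × L2 d T}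

open MvPolynomial (X pderiv monomial C)

lemma X_sq_mul_X_sq (x y : Site d) :
    (X x ^ 2 * X y ^ 2 : Pol d) = monomial (Finsupp.single x 2 + Finsupp.single y 2) 1 := by
  rw [MvPolynomial.X_pow_eq_monomial, MvPolynomial.X_pow_eq_monomial, MvPolynomial.monomial_mul,
    one_mul]

lemma X_mul_X_mul_X_sq (x y v : Site d) :
    (X x * (X y * X v ^ 2) : Pol d) =
      monomial (Finsupp.single v 2 + Finsupp.single x 1 + Finsupp.single y 1) 1 := by
  rw [monomial_add_single_one, monomial_add_single_one, ← MvPolynomial.X_pow_eq_monomial]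
  ring

/-- The factor `3` at `v = y` undoes the weight `1/3` of the walker, which finds two momenta at its
site. It is the source of the reweighting in `driftTerm` and `drift`. -/
lemma X_sq_mul_X_sq_mul_X_sq {x y : Site d} (hxy : x ≠ y) (v : Site d) :
    (X x ^ 2 * X y ^ 2 * X v ^ 2 : Pol d) = (1 + if v = y then (2 : ℝ) else 0) •
      walker (Finsupp.single x 2 + Finsupp.single v 2) y := by
  rw [walker, smul_smul, mul_right_comm, X_sq_mul_X_sq, MvPolynomial.X_pow_eq_monomial,
    MvPolynomial.monomial_mul, one_mul]
  have : (1 + if v = y then (2 : ℝ) else 0) *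
      (1 + (((Finsupp.single x 2 + Finsupp.single v 2 : Site d →₀ ℕ) y : ℕ) : ℝ))⁻¹ = 1 := by
    rw [Finsupp.add_apply, Finsupp.single_eq_of_ne hxy.symm, Finsupp.single_apply]
    split_ifs <;> norm_num
  rw [this, one_smul]

/-- The coefficient of the degree three part of the antisymmetric operator in direction `j`. -/
noncomputable def driftTerm (a : Fin d → ℝ) (F : Site d → Site d → ℝ) (j : Fin d)
    (x v : Site d) : ℝ :=
  a j * (1 + if v = x + e j then 2 else 0) * (F x v - F (x + e j) v)

lemma sq_driftTerm_le (F : Site d → Site d → ℝ) (j : Fin d) (x v : Site d) :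
    driftTerm a F j x v ^ 2 ≤ 9 * a j ^ 2 * (F x v - F (x + e j) v) ^ 2 := by
  rw [driftTerm, mul_pow, mul_pow]
  refine mul_le_mul_of_nonneg_right ?_ (sq_nonneg _)
  rw [mul_comm]
  refine mul_le_mul_of_nonneg_right ?_ (sq_nonneg _)
  split_ifs <;> norm_num

/-- The sum of the squared gradients of `F` in its first variable. -/
noncomputable def gradEnergy (s : Finset (Site d)) (F : Site d → Site d → ℝ) : ℝ :=
  ∑ j, ∑ x ∈ s, ∑ v ∈ s, (F x v - F (x + e j) v) ^ 2

/-- The squared norm of the drift of `F` in its first variable. -/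
noncomputable def driftEnergy (a : Fin d → ℝ) (s : Finset (Site d)) (F : Site d → Site d → ℝ) : ℝ :=
  ∑ t ∈ s ×ˢ s, (∑ j, driftTerm a F j t.1 t.2) ^ 2

/-- The lack of translation invariance of `F`. -/
noncomputable def shiftEnergy (s : Finset (Site d)) (F : Site d → Site d → ℝ) : ℝ :=
  ∑ j, ∑ t ∈ s ×ˢ s, (F t.1 t.2 - F (t.1 + e j) (t.2 + e j)) ^ 2

lemma gradEnergy_nonneg (s : Finset (Site d)) (F : Site d → Site d → ℝ) : 0 ≤ gradEnergy s F :=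
  Finset.sum_nonneg fun _ _ => Finset.sum_nonneg fun _ _ => Finset.sum_nonneg fun _ _ => sq_nonneg _

lemma driftEnergy_nonneg (s : Finset (Site d)) (F : Site d → Site d → ℝ) :
    0 ≤ driftEnergy a s F :=
  Finset.sum_nonneg fun _ _ => sq_nonneg _

lemma shiftEnergy_nonneg (s : Finset (Site d)) (F : Site d → Site d → ℝ) : 0 ≤ shiftEnergy s F :=
  Finset.sum_nonneg fun _ _ => Finset.sum_nonneg fun _ _ => sq_nonneg _

lemma flowEnergy_nonneg (d n : ℕ) : 0 ≤ flowEnergy d n :=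
  Finset.sum_nonneg fun _ _ => by positivity

lemma two_keys_injOn (s : Set (Site d × Site d)) :
    Set.InjOn (fun t : Site d × Site d => ![t.1, t.2]) s := by
  intro t _ t' _ h
  exact Prod.ext (by simpa using congrFun h 0) (by simpa using congrFun h 1)

lemma one_key_injOn (s : Set (Site d)) : Set.InjOn (fun (v : Site d) (_ : Fin 1) => v) s :=
  fun _ _ _ _ h => congrFun h 0

lemma HBound.pairPol [Nonempty (Fin d)] (hT : 0 < T) (hlam : 0 < lam) (hq : q ∈ closedGraph d T a)
    (s : Finset (Site d)) (F : Site d → Site d → ℝ) :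
    HBound lam q (pairPol s F)
      (√(normConst T 4 2 * ∑ t ∈ s ×ˢ s, F t.1 t.2 ^ 2 / lam)) := by
  have h : AEM.pairPol s F = ∑ t ∈ s ×ˢ s, F t.1 t.2 •
      monomial (Finsupp.single t.1 2 + Finsupp.single t.2 2) 1 := by
    rw [Finset.sum_product]
    simp only [AEM.pairPol, X_sq_mul_X_sq]
  rw [h, ← Finset.sum_div, ← mul_div_assoc]
  refine HBound.of_norm hlam hq (norm_sq_toL2_le hT _ _ _ (fun t _ => ?_) _ (two_keys_injOn _) ?_)
  · simp
  · intro t _ k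
    fin_cases k <;> simp

/-- `S` is a sum of squares of the fields, hence already in `rotP` form, with the gradient of `F` as
coefficient. -/
lemma HBound.polS_pairPol [Nonempty (Fin d)] (hT : 0 < T) (hlam : 0 < lam)
    (hq : q ∈ closedGraph d T a) {s : Finset (Site d)} {F : Site d → Site d → ℝ}
    (hF : ∀ x v, F x v = F v x) (hs : ∀ x, x ∉ s → F x = 0)
    (hs' : ∀ x j, x + e j ∉ s → F (x + e j) = 0) :
    HBound lam q (polS s (AEM.pairPol s F)) (√(16 * normConst T 4 1 * gradEnergy s F)) := by
  rw [polS]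
  refine HBound.of_rot hlam hq s _ ?_
  rw [gradEnergy, Finset.mul_sum]
  refine Finset.sum_le_sum fun j _ => ?_
  rw [Finset.mul_sum]
  refine Finset.sum_le_sum fun x _ => ?_
  have h : rotP x (x + e j) (AEM.pairPol s F) = ∑ v ∈ s, (4 * (F x v - F (x + e j) v)) •
      monomial (Finsupp.single v 2 + Finsupp.single x 1 + Finsupp.single (x + e j) 1) 1 := by
    rw [rotP_pairPol s hF (hs x) (hs' x j), sqPol, Finset.mul_sum, Finset.mul_sum, Finset.smul_sum]
    refine Finset.sum_congr rfl fun v _ => ?_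
    rw [mul_smul_comm, mul_smul_comm, X_mul_X_mul_X_sq, smul_smul]; rfl
  rw [h]
  refine (norm_sq_toL2_le hT (n := 4) (r := 1) _ _ _ (fun v _ => ?_) _ (one_key_injOn _)
    ?_).trans (le_of_eq ?_)
  · simp
  · intro v _ k
    simp
  · simp only [mul_pow, ← Finset.mul_sum]; ring

/-- In the degree six part the walker at `x + e j` is replaced by the one at `x`, and the difference
is a `rotP`. Then all directions share one monomial and their coefficients add up before any square
is taken: only the full drift is charged to the expensive flow estimate. This cancellation between
directions is what dimension two relies on. -/
lemma fockA_pairPol [Nonempty (Fin d)] {K K' : Finset (Site d)} (hK : ∀ j, ∀ x ∈ K, x ∈ K' ∧ x - e j ∈ K' ∧ x + e j ∈ K')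
    {F : Site d → Site d → ℝ} (hF : ∀ x v, F x v = F v x) (hs : ∀ x, x ∉ K → F x = 0) :
    fockA T a K' (AEM.pairPol K' F) =
      (4 : ℝ) • (∑ t ∈ K' ×ˢ K', (∑ j, driftTerm a F j t.1 t.2) •
        walker (Finsupp.single t.1 2 + Finsupp.single t.2 2) t.1) +
      (4 : ℝ) • (∑ j, ∑ x ∈ K', rotP x (x + e j) (∑ v ∈ K', (driftTerm a F j x v *
        ((1 + ((Finsupp.single x 2 + Finsupp.single v 2 : Site d →₀ ℕ) x : ℝ)) *
          (1 + ((Finsupp.single x 2 + Finsupp.single v 2 : Site d →₀ ℕ) (x + e j) : ℝ)))⁻¹) •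
        monomial (Finsupp.single x 2 + Finsupp.single v 2 + Finsupp.single x 1 +
          Finsupp.single (x + e j) 1) 1)) +
      ∑ j, (4 * a j) • (
        T • ∑ t ∈ K' ×ˢ K', (F t.1 t.2 - F (t.1 + e j) (t.2 + e j)) •
          (X (t.1 + e j) ^ 2 * X t.2 ^ 2 : Pol d) +
        (2 * T) • ∑ x ∈ K', (F x x - F (x + e j) (x + e j)) • (X x ^ 2 * X (x + e j) ^ 2 : Pol d) +
        (2 * T ^ 2) • ∑ x ∈ K', (F x (x + e j) - F (x + e j) (x + e j + e j)) • X (x + e j) ^ 2) := by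
  have hs1 : ∀ x, x ∉ K' → F x = 0 := by
    intro x hx
    exact hs x fun h => hx (hK (Classical.arbitrary _) x h).1
  have hb : ∀ j, ∀ x ∈ K', mulX T x (mulX T (x + e j) (rotP x (x + e j) (AEM.pairPol K' F))) =
      (4 : ℝ) • (∑ v ∈ K', ((1 + if v = x + e j then (2 : ℝ) else 0) * (F x v - F (x + e j) v)) •
        walker (Finsupp.single x 2 + Finsupp.single v 2) (x + e j)) + (4 : ℝ) •
      ((T • ((X x ^ 2 + X (x + e j) ^ 2) * sqPol K' (F x - F (x + e j))) +
        (T * (2 * (F x - F (x + e j)) x + 2 * (F x - F (x + e j)) (x + e j))) •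
          (X x ^ 2 * X (x + e j) ^ 2) +
        (T ^ 2 • sqPol K' (F x - F (x + e j)) + T ^ 2 •
          ((2 * (F x - F (x + e j)) x) • X x ^ 2 +
            (2 * (F x - F (x + e j)) (x + e j)) • X (x + e j) ^ 2)))) := by
    intro j x hx
    have h0 : ∀ u, u ∉ K' → (F x - F (x + e j)) u = 0 := fun u hu => by
      rw [Pi.sub_apply, hF, hF _ u, hs1 u hu]; simp
    rw [rotP_pairPol K' hF (hs1 x) (hs1 _), mulX_smul, mulX_smul,
      mulX_mulX (ne_add_e x j) (pderiv_sqPol K' _ x (h0 x)) (pderiv_sqPol K' _ _ (h0 _)), add_assoc,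
      smul_add]
    congr 2
    rw [sqPol, Finset.mul_sum]
    refine Finset.sum_congr rfl fun v _ => ?_
    rw [mul_smul_comm, X_sq_mul_X_sq_mul_X_sq (ne_add_e x j), smul_smul, mul_comm]; rfl
  have hw : ∀ j, ∀ x ∈ K', ∀ v ∈ K', walker (Finsupp.single x 2 + Finsupp.single v 2) (x + e j) =
      walker (Finsupp.single x 2 + Finsupp.single v 2) x + rotP x (x + e j)
        ((((1 + ((Finsupp.single x 2 + Finsupp.single v 2 : Site d →₀ ℕ) x : ℝ)) *
          (1 + ((Finsupp.single x 2 + Finsupp.single v 2 : Site d →₀ ℕ) (x + e j) : ℝ)))⁻¹) •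
        monomial (Finsupp.single x 2 + Finsupp.single v 2 + Finsupp.single x 1 +
          Finsupp.single (x + e j) 1) 1) := by
    intro j x _ v _
    rw [← walker_sub _ (ne_add_e x j)]; abel
  have hj : ∀ j, ∑ x ∈ K', a j • mulX T x (mulX T (x + e j) (rotP x (x + e j) (AEM.pairPol K' F))) =
      (4 : ℝ) • (∑ x ∈ K', ∑ v ∈ K', driftTerm a F j x v •
        walker (Finsupp.single x 2 + Finsupp.single v 2) x) +
      (4 : ℝ) • (∑ x ∈ K', rotP x (x + e j) (∑ v ∈ K', (driftTerm a F j x v *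
        ((1 + ((Finsupp.single x 2 + Finsupp.single v 2 : Site d →₀ ℕ) x : ℝ)) *
          (1 + ((Finsupp.single x 2 + Finsupp.single v 2 : Site d →₀ ℕ) (x + e j) : ℝ)))⁻¹) •
        monomial (Finsupp.single x 2 + Finsupp.single v 2 + Finsupp.single x 1 +
          Finsupp.single (x + e j) 1) 1)) +
      (4 * a j) • (
        T • ∑ t ∈ K' ×ˢ K', (F t.1 t.2 - F (t.1 + e j) (t.2 + e j)) •
          (X (t.1 + e j) ^ 2 * X t.2 ^ 2 : Pol d) +
        (2 * T) • ∑ x ∈ K', (F x x - F (x + e j) (x + e j)) • (X x ^ 2 * X (x + e j) ^ 2 : Pol d) +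
        (2 * T ^ 2) • ∑ x ∈ K', (F x (x + e j) - F (x + e j) (x + e j + e j)) • X (x + e j) ^ 2) := by
    intro j
    rw [← sum_lower_order j (fun x hx => ⟨(hK j x hx).1, (hK j x hx).2.1⟩) hF hs, Finset.smul_sum,
      Finset.smul_sum, Finset.smul_sum, ← Finset.sum_add_distrib, ← Finset.sum_add_distrib]
    refine Finset.sum_congr rfl fun x hx => ?_
    rw [hb j x hx, smul_add, mul_comm (4 : ℝ) (a j), mul_smul (a j) (4 : ℝ)]
    congr 1
    rw [map_sum, ← smul_add, ← Finset.sum_add_distrib, smul_comm, Finset.smul_sum]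
    congr 1
    refine Finset.sum_congr rfl fun v hv => ?_
    rw [hw j x hx v hv, smul_smul, ← mul_assoc, smul_add, ← Derivation.map_smul, smul_smul]
    rfl
  rw [fockA, Finset.sum_congr rfl fun j _ => hj j, Finset.sum_add_distrib, Finset.sum_add_distrib]
  congr 2
  · rw [← Finset.smul_sum, Finset.sum_product, Finset.sum_comm]
    congr 1
    refine Finset.sum_congr rfl fun x _ => ?_
    rw [Finset.sum_comm]
    refine Finset.sum_congr rfl fun v _ => ?_
    rw [Finset.sum_smul]
  · rw [Finset.smul_sum]

end PairEstimate

/-! ### The cost of a pair test function in the dual norm -/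

section PairEstimate

variable {d : ℕ} {T lam : ℝ} {a : Fin d → ℝ} {q : L2 d T × L2 d T}

open MvPolynomial (X pderiv monomial C)

lemma HBound.of_sqrt {P : Pol d} {S c R : ℝ} (h : HBound lam q P (√S)) (hc : 0 ≤ c)
    (hS : S ≤ c * R) : HBound lam q P (√c * √R) :=
  h.mono ((Real.sqrt_le_sqrt hS).trans_eq (Real.sqrt_mul hc R))

/-- The total cost of the test function `F`. -/
noncomputable def pairCost (a : Fin d → ℝ) (lam : ℝ) (m : ℕ) (s : Finset (Site d))
    (F : Site d → Site d → ℝ) : ℝ :=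
  lam * ∑ t ∈ s ×ˢ s, F t.1 t.2 ^ 2 + gradEnergy s F +
    (flowEnergy d m + ((2 ^ m) ^ d * lam)⁻¹) * driftEnergy a s F + shiftEnergy s F / lam

lemma pairCost_bounds (hlam : 0 < lam) (m : ℕ) (s : Finset (Site d)) (F : Site d → Site d → ℝ) :
    lam * ∑ t ∈ s ×ˢ s, F t.1 t.2 ^ 2 ≤ pairCost a lam m s F ∧
    gradEnergy s F ≤ pairCost a lam m s F ∧
    flowEnergy d m * driftEnergy a s F ≤ pairCost a lam m s F ∧
    ((2 ^ m) ^ d * lam)⁻¹ * driftEnergy a s F ≤ pairCost a lam m s F ∧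
    shiftEnergy s F / lam ≤ pairCost a lam m s F := by
  have h1 : 0 ≤ lam * ∑ t ∈ s ×ˢ s, F t.1 t.2 ^ 2 :=
    mul_nonneg hlam.le (Finset.sum_nonneg fun _ _ => sq_nonneg _)
  have h2 := gradEnergy_nonneg s F
  have h3 := mul_nonneg (flowEnergy_nonneg d m) (driftEnergy_nonneg (a := a) s F)
  have h4 : 0 ≤ ((2 ^ m) ^ d * lam)⁻¹ * driftEnergy a s F :=
    mul_nonneg (by positivity) (driftEnergy_nonneg s F)
  have h5 := div_nonneg (shiftEnergy_nonneg s F) hlam.le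
  unfold pairCost
  refine ⟨?_, ?_, ?_, ?_, ?_⟩ <;> linarith

lemma sum_diag_le (s : Finset (Site d)) (F : Site d → Site d → ℝ) (j : Fin d) :
    ∑ x ∈ s, (F x x - F (x + e j) (x + e j)) ^ 2 ≤ shiftEnergy s F := by
  classical
  have h : ∑ x ∈ s, (F x x - F (x + e j) (x + e j)) ^ 2 ≤
      ∑ t ∈ s ×ˢ s, (F t.1 t.2 - F (t.1 + e j) (t.2 + e j)) ^ 2 := by
    rw [Finset.sum_product]
    exact Finset.sum_le_sum fun x hx => Finset.single_le_sum
      (f := fun v => (F x v - F (x + e j) (v + e j)) ^ 2) (fun _ _ => sq_nonneg _) hx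
  exact h.trans (Finset.single_le_sum
    (f := fun j => ∑ t ∈ s ×ˢ s, (F t.1 t.2 - F (t.1 + e j) (t.2 + e j)) ^ 2)
    (fun _ _ => Finset.sum_nonneg fun _ _ => sq_nonneg _) (Finset.mem_univ j))

lemma sum_offdiag_le {s : Finset (Site d)} {F : Site d → Site d → ℝ}
    (hF : ∀ x v, F x v = F v x) (hs : ∀ x, x ∉ s → F x = 0) (j : Fin d) :
    ∑ x ∈ s, (F x (x + e j) - F (x + e j) (x + e j + e j)) ^ 2 ≤ shiftEnergy s F := by
  classical
  have h : ∑ x ∈ s, (F x (x + e j) - F (x + e j) (x + e j + e j)) ^ 2 ≤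
      ∑ t ∈ s ×ˢ s, (F t.1 t.2 - F (t.1 + e j) (t.2 + e j)) ^ 2 := by
    rw [Finset.sum_product]
    refine Finset.sum_le_sum fun x hx => ?_
    by_cases h : x + e j ∈ s
    · exact Finset.single_le_sum
        (f := fun v => (F x v - F (x + e j) (v + e j)) ^ 2) (fun _ _ => sq_nonneg _) h
    · rw [hF x, hs _ h]
      simp only [Pi.zero_apply, sub_zero, ne_eq, OfNat.ofNat_ne_zero, not_false_eq_true, zero_pow]
      exact Finset.sum_nonneg fun _ _ => sq_nonneg _
  exact h.trans (Finset.single_le_sum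
    (f := fun j => ∑ t ∈ s ×ˢ s, (F t.1 t.2 - F (t.1 + e j) (t.2 + e j)) ^ 2)
    (fun _ _ => Finset.sum_nonneg fun _ _ => sq_nonneg _) (Finset.mem_univ j))

/-- The resolvent norm of `(lam - L) F` for a test function `F` of degree four. -/
theorem hbound_pairPol_sub (hd : Nonempty (Fin d)) (hT : 0 < T) (a : Fin d → ℝ) :
    ∃ c : ℝ, 0 < c ∧ ∀ (lam : ℝ) (q : L2 d T × L2 d T) (m : ℕ) (K K' : Finset (Site d))
      (F : Site d → Site d → ℝ), 0 < lam → q ∈ closedGraph d T a →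
      (∀ j, ∀ x ∈ K, x ∈ K' ∧ x - e j ∈ K' ∧ x + e j ∈ K') → (∀ x v, F x v = F v x) →
      (∀ x, x ∉ K → F x = 0) →
      HBound lam q (lam • pairPol K' F - polS K' (pairPol K' F) + fockA T a K' (pairPol K' F))
        (c * √(pairCost a lam m K' F)) := by
  refine ⟨1 + (√(normConst T 4 2) + √(16 * normConst T 4 1) + (4 * (√(normConst T 6 3) +
    √(normConst T 6 2 * d)) + 4 * √(normConst T 6 1 * (9 * ∑ j, a j ^ 2)) +
    ∑ j, |4 * a j| * (|T| * √(normConst T 4 2) + |2 * T| * √(normConst T 4 1) +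
      |2 * T ^ 2| * √(normConst T 2 1)))), ?_, ?_⟩
  · have : 0 ≤ ∑ j, |4 * a j| * (|T| * √(normConst T 4 2) + |2 * T| * √(normConst T 4 1) +
      |2 * T ^ 2| * √(normConst T 2 1)) := Finset.sum_nonneg fun _ _ => by positivity
    positivity
  intro lam q m K K' F hlam hq hK hF hs
  have hs1 : ∀ x, x ∉ K' → F x = 0 := fun x hx =>
    hs x fun h => hx (hK (Classical.arbitrary _) x h).1
  obtain ⟨b1, b2, b3, b4, b5⟩ := pairCost_bounds (a := a) hlam m K' F
  set R := pairCost a lam m K' F with hR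
  have nn := fun n r => normConst_nonneg (T := T) hT n r
  have k1 : HBound lam q (lam • pairPol K' F) (√(normConst T 4 2) * √R) := by
    refine ((HBound.pairPol hT hlam hq K' F).smul lam).mono ?_
    rw [abs_of_pos hlam, ← Real.sqrt_mul (nn _ _), ← Real.sqrt_sq hlam.le, ← Real.sqrt_mul
      (sq_nonneg _), Real.sqrt_sq hlam.le, ← Finset.sum_div]
    refine Real.sqrt_le_sqrt ?_
    refine le_trans (le_of_eq ?_) (mul_le_mul_of_nonneg_left b1 (nn _ _))
    field_simp
  have k2 : HBound lam q (polS K' (pairPol K' F)) (√(16 * normConst T 4 1) * √R) :=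
    (HBound.polS_pairPol hT hlam hq hF hs1 fun x j h => hs1 _ h).of_sqrt
      (mul_nonneg (by norm_num) (nn _ _))
      (mul_le_mul_of_nonneg_left b2 (mul_nonneg (by norm_num) (nn _ _)))
  -- The main term: walkers starting at `t.1` in the background of the pair `t`, whose two sites
  -- serve as keys.
  have k3 : HBound lam q (∑ t ∈ K' ×ˢ K', (∑ j, driftTerm a F j t.1 t.2) •
        walker (Finsupp.single t.1 2 + Finsupp.single t.2 2) t.1)
      ((√(normConst T 6 3) + √(normConst T 6 2 * d)) * √R) := by
    refine (HBound.flow hT hlam hq (K' ×ˢ K') (fun t => ∑ j, driftTerm a F j t.1 t.2)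
      (fun t => t.1) (fun t => Finsupp.single t.1 2 + Finsupp.single t.2 2) (n := 4) (r := 2)
      (fun t _ => by simp) (fun t => ![t.1, t.2]) (two_keys_injOn _) (fun t _ k => ?_) m).mono ?_
    · fin_cases k <;> simp
    · rw [add_mul, ← Real.sqrt_mul (nn _ _), ← Real.sqrt_mul (mul_nonneg (nn _ _) d.cast_nonneg)]
      refine add_le_add (Real.sqrt_le_sqrt ?_) (Real.sqrt_le_sqrt ?_)
      · refine le_trans (le_of_eq ?_) (mul_le_mul_of_nonneg_left b4 (nn _ _))
        rw [driftEnergy, mul_inv]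
        ring
      · refine le_trans (le_of_eq ?_) (mul_le_mul_of_nonneg_left b3
          (mul_nonneg (nn 6 2) d.cast_nonneg))
        rw [driftEnergy]
        ring
  have k4 : HBound lam q (∑ j, ∑ x ∈ K', rotP x (x + e j) (∑ v ∈ K', (driftTerm a F j x v *
        ((1 + ((Finsupp.single x 2 + Finsupp.single v 2 : Site d →₀ ℕ) x : ℝ)) *
          (1 + ((Finsupp.single x 2 + Finsupp.single v 2 : Site d →₀ ℕ) (x + e j) : ℝ)))⁻¹) •
        monomial (Finsupp.single x 2 + Finsupp.single v 2 + Finsupp.single x 1 +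
          Finsupp.single (x + e j) 1) 1)) (√(normConst T 6 1 * (9 * ∑ j, a j ^ 2)) * √R) := by
    have ha : 0 ≤ 9 * ∑ j, a j ^ 2 :=
      mul_nonneg (by norm_num) (Finset.sum_nonneg fun _ _ => sq_nonneg _)
    refine HBound.of_sqrt (S := normConst T 6 1 * (9 * ∑ j, a j ^ 2) * gradEnergy K' F)
      (HBound.of_rot hlam hq K' _ ?_) (mul_nonneg (nn _ _) ha)
      (mul_le_mul_of_nonneg_left b2 (mul_nonneg (nn _ _) ha))
    rw [gradEnergy, Finset.mul_sum]
    refine Finset.sum_le_sum fun j _ => ?_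
    rw [Finset.mul_sum]
    refine Finset.sum_le_sum fun x _ => ?_
    refine (norm_sq_toL2_le hT (n := 6) (r := 1) _ _ _ (fun v _ => ?_) _ (one_key_injOn _)
      ?_).trans ?_
    · simp
    · intro v _ k
      simp
    · rw [mul_assoc]
      refine mul_le_mul_of_nonneg_left ?_ (nn _ _)
      rw [Finset.mul_sum]
      refine Finset.sum_le_sum fun v _ => ?_
      refine (sq_mul_le_sq (gradient_weight _ _ _).1 (gradient_weight _ _ _).2).trans
        ((sq_driftTerm_le F j x v).trans (mul_le_mul_of_nonneg_right ?_ (sq_nonneg _)))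
      exact mul_le_mul_of_nonneg_left (Finset.single_le_sum (f := fun j => a j ^ 2)
        (fun _ _ => sq_nonneg _) (Finset.mem_univ j)) (by norm_num)
  -- The terms that measure the lack of translation invariance are estimated crudely, at the price
  -- `1 / lam`; they will come only from the boundary of a large box.
  have hδ : ∀ (j : Fin d) (n r : ℕ) (S : ℝ), S ≤ shiftEnergy K' F →
      normConst T n r * S / lam ≤ normConst T n r * R := fun j n r S h => by
    rw [mul_div_assoc]
    exact mul_le_mul_of_nonneg_left ((div_le_div_of_nonneg_right h hlam.le).trans b5) (nn _ _)
  have k5 : ∀ j, HBound lam q (∑ t ∈ K' ×ˢ K', (F t.1 t.2 - F (t.1 + e j) (t.2 + e j)) •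
      (X (t.1 + e j) ^ 2 * X t.2 ^ 2 : Pol d)) (√(normConst T 4 2) * √R) := by
    intro j
    simp only [X_sq_mul_X_sq]
    refine HBound.of_sqrt (HBound.of_norm hlam hq (norm_sq_toL2_le hT (n := 4) (r := 2) _ _ _
      (fun t _ => by simp) (fun t => ![t.1 + e j, t.2]) ?_ ?_)) (nn _ _) (hδ j _ _ _ ?_)
    · intro t _ t' _ h
      exact Prod.ext (by simpa using congrFun h 0) (by simpa using congrFun h 1)
    · intro t _ k
      fin_cases k <;> simp
    · exact Finset.single_le_sum
        (f := fun j => ∑ t ∈ K' ×ˢ K', (F t.1 t.2 - F (t.1 + e j) (t.2 + e j)) ^ 2)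
        (fun _ _ => Finset.sum_nonneg fun _ _ => sq_nonneg _) (Finset.mem_univ j)
  have k6 : ∀ j, HBound lam q (∑ x ∈ K', (F x x - F (x + e j) (x + e j)) •
      (X x ^ 2 * X (x + e j) ^ 2 : Pol d)) (√(normConst T 4 1) * √R) := by
    intro j
    simp only [X_sq_mul_X_sq]
    refine HBound.of_sqrt (HBound.of_norm hlam hq (norm_sq_toL2_le hT (n := 4) (r := 1) _ _ _
      (fun t _ => by simp) _ (one_key_injOn _) ?_)) (nn _ _) (hδ j _ _ _ (sum_diag_le K' F j))
    intro t _ k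
    simp
  have k7 : ∀ j, HBound lam q (∑ x ∈ K', (F x (x + e j) - F (x + e j) (x + e j + e j)) •
      (X (x + e j) ^ 2 : Pol d)) (√(normConst T 2 1) * √R) := by
    intro j
    simp only [MvPolynomial.X_pow_eq_monomial]
    refine HBound.of_sqrt (HBound.of_norm hlam hq (norm_sq_toL2_le hT (n := 2) (r := 1) _ _ _
      (fun t _ => by simp) (fun x _ => x + e j) ?_ ?_)) (nn _ _)
      (hδ j _ _ _ (sum_offdiag_le hF hs1 j))
    · intro x _ y _ h
      simpa using congrFun h 0
    · intro t _ k
      simp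
  have k8 := k2.smul (-1)
  rw [neg_one_smul, abs_neg, abs_one, one_mul] at k8
  rw [fockA_pairPol hK hF hs, sub_eq_add_neg]
  refine HBound.mono (HBound.add (HBound.add k1 k8)
    (HBound.add (HBound.add (k3.smul 4) (k4.smul 4)) (HBound.sum fun j _ =>
      HBound.smul (4 * a j) (((k5 j).smul T).add ((k6 j).smul (2 * T)) |>.add
        ((k7 j).smul (2 * T ^ 2)))))) ?_
  have e1 : ∀ j : Fin d, |4 * a j| * (|T| * (√(normConst T 4 2) * √R) +
      |2 * T| * (√(normConst T 4 1) * √R) + |2 * T ^ 2| * (√(normConst T 2 1) * √R)) =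
      |4 * a j| * (|T| * √(normConst T 4 2) + |2 * T| * √(normConst T 4 1) +
        |2 * T ^ 2| * √(normConst T 2 1)) * √R := fun j => by ring
  simp only [e1, ← Finset.sum_mul]
  have := Real.sqrt_nonneg R
  rw [abs_of_pos (by norm_num : (0 : ℝ) < 4)]
  nlinarith

end PairEstimate

/-! ### Volumes and boundaries of boxes -/

section BoxCounting

variable {d : ℕ}

lemma mem_box {k : ℕ} {x : Site d} : x ∈ box d k ↔ ∀ i, -(k : ℤ) ≤ x i ∧ x i ≤ k := by
  simp [box, Fintype.mem_piFinset]

lemma card_box (d k : ℕ) : ((box d k).card : ℝ) = (2 * (k : ℝ) + 1) ^ d := by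
  have : ((k : ℤ) + 1 - -(k : ℤ)).toNat = 2 * k + 1 := by omega
  rw [box, Fintype.card_piFinset_const, Int.card_Icc, this]
  push_cast
  rfl

lemma e_apply (i j : Fin d) : (e i : Site d) j = if j = i then 1 else 0 := by
  simp [e, Pi.single_apply]

lemma box_succ {k : ℕ} (j : Fin d) {x : Site d} (hx : x ∈ box d k) :
    x ∈ box d (k + 1) ∧ x - e j ∈ box d (k + 1) ∧ x + e j ∈ box d (k + 1) := by
  simp only [mem_box, Pi.sub_apply, Pi.add_apply, e_apply] at *
  push_cast
  refine ⟨fun i => ?_, fun i => ?_, fun i => ?_⟩ <;> have := hx i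
  · omega
  · split_ifs <;> omega
  · split_ifs <;> omega

/-- Only the side in direction `j` shrinks, from `2k + 1` to `2k`. Multiplying by `2k + 1` avoids
the exponent `d - 1`. -/
lemma card_box_inter_shift (k : ℕ) (j : Fin d) :
    (2 * (k : ℝ) + 1) * ((box d k).filter fun x => x + e j ∈ box d k).card =
      2 * k * (2 * (k : ℝ) + 1) ^ d := by
  classical
  have h1 : (box d k).filter (fun x => x + e j ∈ box d k) =
      Fintype.piFinset fun i => Finset.Icc (-(k : ℤ)) (if i = j then k - 1 else k) := by
    ext x
    simp only [Finset.mem_filter, mem_box, Pi.add_apply, e_apply, Fintype.mem_piFinset,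
      Finset.mem_Icc]
    constructor
    · rintro ⟨h1, h2⟩ i
      have := h1 i
      have := h2 i
      split_ifs at * <;> omega
    · intro h
      refine ⟨fun i => ?_, fun i => ?_⟩ <;> have := h i <;> split_ifs at * <;> omega
  have h2 : ∀ i : Fin d, ((Finset.Icc (-(k : ℤ)) (if i = j then k - 1 else k)).card : ℝ) =
      if i = j then 2 * (k : ℝ) else 2 * k + 1 := by
    intro i
    rw [Int.card_Icc]
    split_ifs
    · have : ((k : ℤ) - 1 + 1 - -(k : ℤ)).toNat = 2 * k := by omega
      rw [this]; push_cast; rfl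
    · have : ((k : ℤ) + 1 - -(k : ℤ)).toNat = 2 * k + 1 := by omega
      rw [this]; push_cast; rfl
  rw [h1, Fintype.card_piFinset, Nat.cast_prod]
  simp only [h2]
  rw [← Finset.mul_prod_erase _ _ (Finset.mem_univ j), if_pos rfl,
    Finset.prod_congr rfl fun i hi => if_neg (Finset.ne_of_mem_erase hi), Finset.prod_const,
    Finset.card_erase_of_mem (Finset.mem_univ j), Finset.card_univ, Fintype.card_fin]
  obtain ⟨n, rfl⟩ : ∃ n, d = n + 1 := ⟨d - 1, by have := j.pos; omega⟩
  rw [Nat.add_sub_cancel, pow_succ]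
  ring

/-- The indicator function of the box. -/
noncomputable def boxInd (k : ℕ) (x : Site d) : ℝ := by
  classical exact if x ∈ box d k then 1 else 0

lemma boxInd_of_mem {k : ℕ} {x : Site d} (h : x ∈ box d k) : boxInd k x = 1 := by simp [boxInd, h]

lemma boxInd_of_notMem {k : ℕ} {x : Site d} (h : x ∉ box d k) : boxInd k x = 0 := by
  simp [boxInd, h]

lemma boxInd_nonneg (k : ℕ) (x : Site d) : 0 ≤ boxInd k x := by
  unfold boxInd; split_ifs <;> norm_num

lemma boxInd_sq (k : ℕ) (x : Site d) : boxInd k x ^ 2 = boxInd k x := by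
  unfold boxInd; split_ifs <;> norm_num

lemma boxInd_le_one (k : ℕ) (x : Site d) : boxInd k x ≤ 1 := by
  unfold boxInd; split_ifs <;> norm_num

lemma sum_boxInd (k : ℕ) : ∑ x ∈ box d (k + 1), boxInd k x = (2 * (k : ℝ) + 1) ^ d := by
  rw [← card_box]
  cases isEmpty_or_nonempty (Fin d) with
  | inl h =>
    have h1 : ∀ l, box d l = {0} := fun l => by
      ext x
      simp only [mem_box, Finset.mem_singleton]
      exact ⟨fun _ => Subsingleton.elim _ _, fun _ i => h.elim i⟩
    rw [h1, h1]
    simp [boxInd, h1]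
  | inr h =>
    rw [← Finset.sum_subset (fun x hx => (box_succ h.some hx).1) fun x _ hx => boxInd_of_notMem hx,
      Finset.sum_congr rfl fun x hx => boxInd_of_mem hx]
    simp

lemma sum_boxInd_mul_shift (k : ℕ) (j : Fin d) :
    (2 * (k : ℝ) + 1) * ∑ x ∈ box d (k + 1), boxInd k x * boxInd k (x + e j) =
      2 * k * (2 * (k : ℝ) + 1) ^ d := by
  classical
  rw [← card_box_inter_shift k j, Finset.card_eq_sum_ones, Nat.cast_sum,
    ← Finset.sum_subset (fun x hx => (box_succ j hx).1) fun x _ hx => by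
      rw [boxInd_of_notMem hx, zero_mul], Finset.sum_filter]
  congr 1
  refine Finset.sum_congr rfl fun x hx => ?_
  rw [boxInd_of_mem hx]
  simp [boxInd]

/-- The squared increments of an indicator count the two faces of the box orthogonal to `e j`, a
fraction `2 / (2k + 1)` of its volume. -/
lemma sum_boxInd_sub_sq (k : ℕ) (j : Fin d) :
    (2 * (k : ℝ) + 1) * ∑ x ∈ box d (k + 1), (boxInd k x - boxInd k (x + e j)) ^ 2 =
      2 * (2 * (k : ℝ) + 1) ^ d := by
  have h1 : ∑ x ∈ box d (k + 1), boxInd k (x + e j) = ∑ x ∈ box d (k + 1), boxInd k x :=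
    sum_shift j (fun x hx => ⟨(box_succ j hx).1, (box_succ j hx).2.1⟩) (boxInd k)
      fun x hx => boxInd_of_notMem hx
  have h2 := sum_boxInd_mul_shift k j
  have h3 : ∑ x ∈ box d (k + 1), (boxInd k x - boxInd k (x + e j)) ^ 2 =
      ∑ x ∈ box d (k + 1), boxInd k x + ∑ x ∈ box d (k + 1), boxInd k (x + e j) -
        2 * ∑ x ∈ box d (k + 1), boxInd k x * boxInd k (x + e j) := by
    rw [Finset.mul_sum, ← Finset.sum_add_distrib, ← Finset.sum_sub_distrib]
    refine Finset.sum_congr rfl fun x _ => ?_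
    linear_combination boxInd_sq k x + boxInd_sq k (x + e j)
  rw [h3, h1, sum_boxInd]
  linear_combination (-2) * h2

end BoxCounting

/-! ### Translation invariant test functions cut off to a box -/

section TestFunction

variable {d : ℕ} {a : Fin d → ℝ}

/-- The drift of a function of the difference of two sites. -/
noncomputable def drift (a : Fin d → ℝ) (f : Site d → ℝ) (z : Site d) : ℝ :=
  ∑ j, a j * (1 + if z = -e j then 2 else 0) * (f z - f (z + e j))

/-- An even function with bounds on its norm, its gradient and its drift. -/
structure IsTest (a : Fin d → ℝ) (f : Site d → ℝ) (E₀ E₁ E₂ : ℝ) : Prop where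
  even : ∀ z, f (-z) = f z
  norm : ∀ s : Finset (Site d), ∑ z ∈ s, f z ^ 2 ≤ E₀
  grad : ∀ s : Finset (Site d), ∑ z ∈ s, ∑ j, (f z - f (z + e j)) ^ 2 ≤ E₁
  drift : ∀ s : Finset (Site d), ∑ z ∈ s, AEM.drift a f z ^ 2 ≤ E₂

/-- The test function `f(x - v)` cut off to the box. -/
noncomputable def boxTest (f : Site d → ℝ) (k : ℕ) (x v : Site d) : ℝ :=
  f (x - v) * (boxInd k x * boxInd k v)

lemma boxTest_comm {f : Site d → ℝ} (hf : ∀ z, f (-z) = f z) (k : ℕ) (x v : Site d) :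
    boxTest f k x v = boxTest f k v x := by
  rw [boxTest, boxTest, ← hf, neg_sub, mul_comm (boxInd k x)]

lemma boxTest_eq_zero (f : Site d → ℝ) {k : ℕ} {x : Site d} (hx : x ∉ box d k) :
    boxTest f k x = 0 := by
  funext v
  simp [boxTest, boxInd_of_notMem hx]

lemma sum_sub_le {s : Finset (Site d)} {g : Site d → ℝ} {E : ℝ}
    (h : ∀ s : Finset (Site d), ∑ z ∈ s, g z ≤ E) (x : Site d) : ∑ v ∈ s, g (x - v) ≤ E := by
  classical
  have := h (s.image fun v => x - v)
  rwa [Finset.sum_image fun b _ b' _ h => by simpa using h] at this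

lemma sum_sub_le' {s : Finset (Site d)} {g : Site d → ℝ} {E : ℝ}
    (h : ∀ s : Finset (Site d), ∑ z ∈ s, g z ≤ E) (x : Site d) : ∑ v ∈ s, g (v - x) ≤ E := by
  classical
  have := h (s.image fun v => v - x)
  rwa [Finset.sum_image fun b _ b' _ h => by simpa using h] at this

lemma sum_weight_le {s : Finset (Site d)} {g : Site d → Site d → ℝ} {w : Site d → ℝ} {E N : ℝ}
    (hw : ∀ x, 0 ≤ w x) (hN : ∑ x ∈ s, w x = N) (h : ∀ x, ∑ v ∈ s, g x v ≤ E) :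
    ∑ x ∈ s, ∑ v ∈ s, w x * g x v ≤ N * E := by
  rw [← hN, Finset.sum_mul]
  refine Finset.sum_le_sum fun x _ => ?_
  rw [← Finset.mul_sum]
  exact mul_le_mul_of_nonneg_left (h x) (hw x)

variable {f : Site d → ℝ} {E₀ E₁ E₂ : ℝ}

lemma IsTest.sum_sq_le (h : IsTest a f E₀ E₁ E₂) (k : ℕ) :
    ∑ t ∈ box d (k + 1) ×ˢ box d (k + 1), boxTest f k t.1 t.2 ^ 2 ≤
      (2 * (k : ℝ) + 1) ^ d * E₀ := by
  rw [Finset.sum_product]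
  refine le_trans (Finset.sum_le_sum fun x _ => Finset.sum_le_sum fun v _ => ?_)
    (sum_weight_le (g := fun x v => f (x - v) ^ 2) (boxInd_nonneg k) (sum_boxInd k) fun x =>
      sum_sub_le h.norm x)
  rw [boxTest, mul_pow, mul_pow, boxInd_sq, boxInd_sq]
  nlinarith [mul_nonneg (boxInd_nonneg k x) (sq_nonneg (f (x - v))), boxInd_le_one k v]

/-- The boundary of the box. -/
noncomputable def bdry (d k : ℕ) : ℝ := 2 * (2 * (k : ℝ) + 1) ^ d / (2 * k + 1)

lemma sum_boxInd_sub_sq' (k : ℕ) (j : Fin d) :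
    ∑ x ∈ box d (k + 1), (boxInd k x - boxInd k (x + e j)) ^ 2 = bdry d k := by
  rw [bdry, eq_div_iff (by positivity), ← sum_boxInd_sub_sq k j, mul_comm]

/-- Discrete product rule: a bulk increment of `f` and a boundary increment of the indicator. -/
lemma boxTest_sub (f : Site d → ℝ) (k : ℕ) (j : Fin d) (x v : Site d) :
    boxTest f k x v - boxTest f k (x + e j) v = boxInd k v * (boxInd k x *
      (f (x - v) - f (x - v + e j)) + (boxInd k x - boxInd k (x + e j)) * f (x - v + e j)) := by
  rw [boxTest, boxTest, add_sub_right_comm]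
  ring

lemma sq_boxInd_mul_add_le (k : ℕ) (v x : Site d) (A B : ℝ) :
    (boxInd k v * (boxInd k x * A + B)) ^ 2 ≤ 2 * (boxInd k x * A ^ 2) + 2 * B ^ 2 := by
  rw [mul_pow, boxInd_sq]
  have h1 : (boxInd k x * A + B) ^ 2 ≤ 2 * (boxInd k x * A ^ 2) + 2 * B ^ 2 := by
    have : (boxInd k x * A) ^ 2 = boxInd k x * A ^ 2 := by rw [mul_pow, boxInd_sq]
    nlinarith [sq_nonneg (boxInd k x * A - B)]
  exact (mul_le_of_le_one_left (sq_nonneg _) (boxInd_le_one k v)).trans h1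

lemma IsTest.norm_shift (h : IsTest a f E₀ E₁ E₂) (j : Fin d) (s : Finset (Site d)) :
    ∑ z ∈ s, f (z + e j) ^ 2 ≤ E₀ := by
  classical
  have := h.norm (s.image fun z => z + e j)
  rwa [Finset.sum_image fun b _ b' _ h => by simpa using h] at this

lemma IsTest.gradEnergy_le (h : IsTest a f E₀ E₁ E₂) (k : ℕ) :
    gradEnergy (box d (k + 1)) (boxTest f k) ≤
      2 * ((2 * (k : ℝ) + 1) ^ d * E₁) + 2 * (d * (bdry d k * E₀)) := by
  have h1 : ∑ j, ∑ x ∈ box d (k + 1), ∑ v ∈ box d (k + 1), boxInd k x *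
      (f (x - v) - f (x - v + e j)) ^ 2 ≤ (2 * (k : ℝ) + 1) ^ d * E₁ := by
    refine le_trans (le_of_eq ?_) (sum_weight_le (s := box d (k + 1))
      (g := fun x v => ∑ j, (f (x - v) - f (x - v + e j)) ^ 2)
      (boxInd_nonneg k) (sum_boxInd k) fun x => sum_sub_le h.grad x)
    rw [Finset.sum_comm]
    refine Finset.sum_congr rfl fun x _ => ?_
    rw [Finset.sum_comm]
    exact Finset.sum_congr rfl fun v _ => (Finset.mul_sum _ _ _).symm
  have h2 : ∑ j : Fin d, ∑ x ∈ box d (k + 1), ∑ v ∈ box d (k + 1),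
      (boxInd k x - boxInd k (x + e j)) ^ 2 * f (x - v + e j) ^ 2 ≤ d * (bdry d k * E₀) := by
    refine (Finset.sum_le_card_nsmul _ _ _ fun j _ => sum_weight_le (fun x => sq_nonneg _)
      (sum_boxInd_sub_sq' k j) fun x => sum_sub_le (h.norm_shift j) x).trans (le_of_eq ?_)
    simp
  refine le_trans ?_ (add_le_add (mul_le_mul_of_nonneg_left h1 zero_le_two)
    (mul_le_mul_of_nonneg_left h2 zero_le_two))
  rw [gradEnergy]
  simp only [Finset.mul_sum, ← Finset.sum_add_distrib]
  refine Finset.sum_le_sum fun j _ => Finset.sum_le_sum fun x _ => Finset.sum_le_sum fun v _ => ?_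
  rw [boxTest_sub, ← mul_pow]
  exact sq_boxInd_mul_add_le k v x _ _

lemma IsTest.driftEnergy_le (h : IsTest a f E₀ E₁ E₂) (k : ℕ) :
    driftEnergy a (box d (k + 1)) (boxTest f k) ≤ 2 * ((2 * (k : ℝ) + 1) ^ d * E₂) +
      2 * (9 * d * (∑ j, a j ^ 2) * (bdry d k * E₀)) := by
  set b : Fin d → Site d → Site d → ℝ := fun j x v => a j * (1 + if v = x + e j then 2 else 0) *
    ((boxInd k x - boxInd k (x + e j)) * f (x - v + e j)) with hb
  have h0 : ∀ x v, ∑ j, driftTerm a (boxTest f k) j x v =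
      boxInd k v * (boxInd k x * AEM.drift a f (x - v) + ∑ j, b j x v) := by
    intro x v
    rw [AEM.drift, Finset.mul_sum, ← Finset.sum_add_distrib, Finset.mul_sum]
    refine Finset.sum_congr rfl fun j _ => ?_
    have : (x - v = -e j) ↔ (v = x + e j) := by
      constructor <;> intro h
      · rw [← sub_eq_zero] at h ⊢; rw [← neg_eq_zero, ← h]; abel
      · rw [h]; abel
    rw [driftTerm, boxTest_sub]
    simp only [hb, this]
    ring
  have h1 : ∑ x ∈ box d (k + 1), ∑ v ∈ box d (k + 1), boxInd k x * AEM.drift a f (x - v) ^ 2 ≤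
      (2 * (k : ℝ) + 1) ^ d * E₂ :=
    sum_weight_le (g := fun x v => AEM.drift a f (x - v) ^ 2) (boxInd_nonneg k) (sum_boxInd k)
      fun x => sum_sub_le h.drift x
  have h3 : ∀ x v, (∑ j, b j x v) ^ 2 ≤ d * ∑ j, 9 * a j ^ 2 *
      ((boxInd k x - boxInd k (x + e j)) ^ 2 * f (x - v + e j) ^ 2) := by
    intro x v
    refine sq_sum_le_card_mul_sum_sq.trans ?_
    rw [Finset.card_univ, Fintype.card_fin]
    refine mul_le_mul_of_nonneg_left (Finset.sum_le_sum fun j _ => ?_) d.cast_nonneg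
    rw [hb, ← mul_pow]
    simp only []
    rw [mul_pow]
    refine mul_le_mul_of_nonneg_right ?_ (sq_nonneg _)
    rw [mul_pow, mul_comm]
    refine mul_le_mul_of_nonneg_right ?_ (sq_nonneg _)
    split_ifs <;> norm_num
  have h2 : ∑ x ∈ box d (k + 1), ∑ v ∈ box d (k + 1), (∑ j, b j x v) ^ 2 ≤
      9 * d * (∑ j, a j ^ 2) * (bdry d k * E₀) := by
    refine (Finset.sum_le_sum fun x _ => Finset.sum_le_sum fun v _ => h3 x v).trans ?_
    have h4 : ∀ j : Fin d, ∑ x ∈ box d (k + 1), ∑ v ∈ box d (k + 1),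
        (boxInd k x - boxInd k (x + e j)) ^ 2 * f (x - v + e j) ^ 2 ≤ bdry d k * E₀ := fun j =>
      sum_weight_le (fun x => sq_nonneg _)
        (sum_boxInd_sub_sq' k j) fun x => sum_sub_le (h.norm_shift j) x
    calc _ = (d : ℝ) * ∑ j, 9 * a j ^ 2 * ∑ x ∈ box d (k + 1), ∑ v ∈ box d (k + 1),
          (boxInd k x - boxInd k (x + e j)) ^ 2 * f (x - v + e j) ^ 2 := by
          simp only [← Finset.mul_sum]
          congr 1
          simp only [Finset.mul_sum]
          rw [Finset.sum_comm]
          conv_rhs => rw [Finset.sum_comm]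
          rw [Finset.sum_comm]
          refine Finset.sum_congr rfl fun x _ => ?_
          rw [Finset.sum_comm]
      _ ≤ (d : ℝ) * ∑ j, 9 * a j ^ 2 * (bdry d k * E₀) :=
          mul_le_mul_of_nonneg_left (Finset.sum_le_sum fun j _ =>
            mul_le_mul_of_nonneg_left (h4 j) (by positivity)) d.cast_nonneg
      _ = _ := by
          rw [← Finset.sum_mul, ← Finset.mul_sum]
          ring
  refine le_trans ?_ (add_le_add (mul_le_mul_of_nonneg_left h1 zero_le_two)
    (mul_le_mul_of_nonneg_left h2 zero_le_two))
  rw [driftEnergy, Finset.sum_product]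
  simp only [Finset.mul_sum, ← Finset.sum_add_distrib]
  refine Finset.sum_le_sum fun x _ => Finset.sum_le_sum fun v _ => ?_
  rw [h0]
  exact sq_boxInd_mul_add_le k v x _ _

/-- `f (x - v)` is invariant under simultaneous shifts, so only the two indicators contribute. -/
lemma IsTest.shiftEnergy_le (h : IsTest a f E₀ E₁ E₂) (k : ℕ) :
    shiftEnergy (box d (k + 1)) (boxTest f k) ≤ 4 * (d * (bdry d k * E₀)) := by
  have hj : ∀ j : Fin d, ∑ t ∈ box d (k + 1) ×ˢ box d (k + 1),
      (boxTest f k t.1 t.2 - boxTest f k (t.1 + e j) (t.2 + e j)) ^ 2 ≤ 4 * (bdry d k * E₀) := by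
    intro j
    have h1 : ∑ x ∈ box d (k + 1), ∑ v ∈ box d (k + 1),
        (boxInd k x - boxInd k (x + e j)) ^ 2 * f (x - v) ^ 2 ≤ bdry d k * E₀ :=
      sum_weight_le (fun x => sq_nonneg _) (sum_boxInd_sub_sq' k j) fun x => sum_sub_le h.norm x
    have h2 : ∑ v ∈ box d (k + 1), ∑ x ∈ box d (k + 1),
        (boxInd k v - boxInd k (v + e j)) ^ 2 * f (x - v) ^ 2 ≤ bdry d k * E₀ :=
      sum_weight_le (fun x => sq_nonneg _) (sum_boxInd_sub_sq' k j) fun v => sum_sub_le' h.norm v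
    rw [Finset.sum_comm] at h2
    refine le_trans ?_ ((add_le_add (mul_le_mul_of_nonneg_left h1 zero_le_two)
      (mul_le_mul_of_nonneg_left h2 zero_le_two)).trans
      (le_of_eq (show 2 * (bdry d k * E₀) + 2 * (bdry d k * E₀) = 4 * (bdry d k * E₀) by ring)))
    rw [Finset.sum_product]
    simp only [Finset.mul_sum, ← Finset.sum_add_distrib]
    refine Finset.sum_le_sum fun x _ => Finset.sum_le_sum fun v _ => ?_
    rw [boxTest, boxTest, add_sub_add_right_eq_sub]
    have e1 : f (x - v) * (boxInd k x * boxInd k v) -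
        f (x - v) * (boxInd k (x + e j) * boxInd k (v + e j)) =
        (boxInd k (v + e j) * (boxInd k x - boxInd k (x + e j)) * f (x - v)) +
        (boxInd k x * (boxInd k v - boxInd k (v + e j)) * f (x - v)) := by ring
    have e2 : ∀ (y : Site d) (r s : ℝ), (boxInd k y * r * s) ^ 2 ≤ r ^ 2 * s ^ 2 := by
      intro y r s
      rw [mul_assoc, mul_pow, boxInd_sq, ← mul_pow]
      exact mul_le_of_le_one_left (sq_nonneg _) (boxInd_le_one k y)
    rw [e1]
    nlinarith [e2 (v + e j) (boxInd k x - boxInd k (x + e j)) (f (x - v)),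
      e2 x (boxInd k v - boxInd k (v + e j)) (f (x - v)),
      sq_nonneg ((boxInd k (v + e j) * (boxInd k x - boxInd k (x + e j)) * f (x - v)) -
        (boxInd k x * (boxInd k v - boxInd k (v + e j)) * f (x - v)))]
  refine (Finset.sum_le_card_nsmul _ _ _ fun j _ => hj j).trans (le_of_eq ?_)
  rw [Finset.card_univ, Fintype.card_fin, nsmul_eq_mul]
  ring

/-- The cost of the test function cut off to a large box, per site. -/
lemma IsTest.eventually_pairCost_le (h : IsTest a f E₀ E₁ E₂) {lam R : ℝ} (hlam : 0 < lam) (m : ℕ)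
    (hR : lam * E₀ + E₁ + (flowEnergy d m + ((2 ^ m) ^ d * lam)⁻¹) * E₂ < R) :
    ∀ᶠ k : ℕ in atTop, pairCost a lam m (box d (k + 1)) (boxTest f k) ≤
      (2 * (k : ℝ) + 1) ^ d * (2 * R) := by
  set M := flowEnergy d m + ((2 ^ m) ^ d * lam)⁻¹ with hM
  have hM0 : 0 ≤ M := add_nonneg (flowEnergy_nonneg d m) (by positivity)
  -- `κ` collects the coefficients of the boundary term `bdry d k * E₀`. Since `bdry d k` is of
  -- order `N / k`, the strict slack in `R` absorbs it for large `k`, even with the factor `1 /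
  -- lam`.
  set κ : ℝ := 2 * d + M * (2 * (9 * d * ∑ j, a j ^ 2)) + 4 * d / lam with hκ
  have hlim : Tendsto (fun k : ℕ => 2 * (κ * E₀) / (2 * (k : ℝ) + 1)) atTop (𝓝 0) := by
    refine tendsto_const_nhds.div_atTop ?_
    exact tendsto_atTop_add_const_right _ _
      (tendsto_natCast_atTop_atTop.const_mul_atTop zero_lt_two)
  have hpos : 0 < 2 * (R - (lam * E₀ + E₁ + M * E₂)) := by linarith
  have hE0 : 0 ≤ E₀ := by simpa using h.norm ∅
  filter_upwards [hlim.eventually (eventually_lt_nhds hpos)] with k hk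
  set N : ℝ := (2 * (k : ℝ) + 1) ^ d with hN
  have hN0 : 0 < N := by positivity
  have b1 := mul_le_mul_of_nonneg_left (h.sum_sq_le k) hlam.le
  have b2 := h.gradEnergy_le k
  have b3 := mul_le_mul_of_nonneg_left (h.driftEnergy_le k) hM0
  have b4 := div_le_div_of_nonneg_right (h.shiftEnergy_le k) hlam.le
  have b5 : bdry d k * E₀ * κ = N * (2 * (κ * E₀) / (2 * (k : ℝ) + 1)) := by
    rw [bdry, hN]; field_simp
  have b6 := mul_lt_mul_of_pos_left hk hN0
  rw [← b5] at b6
  have b7 : 4 * (d * (bdry d k * E₀)) / lam = 4 * d / lam * (bdry d k * E₀) := by ring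
  have b8 : 0 ≤ N * (lam * E₀) := by positivity
  rw [pairCost, ← hM]
  rw [b7] at b4
  rw [hκ] at b6
  nlinarith

end TestFunction

/-! ### Pairing with the current and the variational lower bound -/

section Current

variable {d : ℕ} {T : ℝ} {a : Fin d → ℝ}

open MvPolynomial (X pderiv monomial C)

/-- The sum of the shifted currents, as a Wick polynomial. -/
noncomputable def curPol (T : ℝ) (a : Fin d → ℝ) (i : Fin d) (s : Finset (Site d)) : Pol d :=
  ∑ x ∈ s, ((2 * (1 + a i * T)) • (X (x + e i) ^ 2 - X x ^ 2) +
    (2 * a i) • (X x ^ 2 * X (x + e i) ^ 2))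

lemma fock_one_X_mul [Nonempty (Fin d)] (hT : 0 < T) (x : Site d) (P : Pol d) :
    fock T 1 (X x * P) = 0 := by
  rw [fock_comm, fock_X_mul hT]
  simp [fock]

lemma fock_add_right (P Q R : Pol d) : fock T P (Q + R) = fock T P Q + fock T P R := by
  simp only [← inner_toL2_toL2, map_add, inner_add_right]

lemma fock_smul_right (c : ℝ) (P Q : Pol d) : fock T P (c • Q) = c * fock T P Q := by
  rw [fock_comm, fock_smul_left, fock_comm]

lemma fock_sum_right {ι : Type*} (s : Finset ι) (P : Pol d) (Q : ι → Pol d) :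
    fock T P (∑ i ∈ s, Q i) = ∑ i ∈ s, fock T P (Q i) := by
  simp only [← inner_toL2_toL2, map_sum, inner_sum]

lemma pderiv_pderiv_pairPol (s : Finset (Site d)) {F : Site d → Site d → ℝ}
    (hF : ∀ x v, F x v = F v x) (hs : ∀ x, x ∉ s → F x = 0) (u : Site d) :
    pderiv u (pderiv u (pairPol s F)) = (4 : ℝ) • (sqPol s (F u) + (2 * F u u) • X u ^ 2) := by
  rw [pderiv_pairPol s hF u (hs u), show (4 : Pol d) = C 4 from (map_ofNat C 4).symm, ← MvPolynomial.smul_eq_C_mul,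
    Derivation.map_smul, Derivation.leibniz, pderiv_sqPol s (F u) u fun h => by rw [hs u h]; rfl,
    MvPolynomial.pderiv_X_self]
  simp only [smul_eq_mul, MvPolynomial.smul_eq_C_mul, map_mul]
  ring

/-- Wick polynomials of different degrees are orthogonal; in particular the gradient part of the
current does not pair with the test function. -/
lemma fock_X_sq_pairPol [Nonempty (Fin d)] (hT : 0 < T) (s : Finset (Site d))
    {F : Site d → Site d → ℝ} (hF : ∀ x v, F x v = F v x) (hs : ∀ x, x ∉ s → F x = 0) (u : Site d) :
    fock T (X u ^ 2) (pairPol s F) = 0 := by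
  have h1 : (X u ^ 2 : Pol d) = X u * (X u * 1) := by ring
  have h2 : ∀ v : Site d, fock T 1 (X v ^ 2 : Pol d) = 0 := fun v => by
    rw [pow_two, fock_one_X_mul hT]
  rw [h1, fock_X_mul hT, fock_X_mul hT, pderiv_pderiv_pairPol s hF hs, fock_smul_right,
    fock_add_right, fock_smul_right, h2, sqPol, fock_sum_right]
  simp only [fock_smul_right, h2]
  simp

/-- Four annihilations give `T⁴`; the monomial occurs with coefficient `F u w + F w u` and each
square contributes `2`. -/
lemma fock_X_sq_mul_X_sq_pairPol [Nonempty (Fin d)] (hT : 0 < T) (s : Finset (Site d))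
    {F : Site d → Site d → ℝ} (hF : ∀ x v, F x v = F v x) (hs : ∀ x, x ∉ s → F x = 0)
    {u w : Site d} (huw : u ≠ w) :
    fock T (X u ^ 2 * X w ^ 2) (pairPol s F) = 8 * T ^ 4 * F u w := by
  have h1 : (X u ^ 2 * X w ^ 2 : Pol d) = X u * (X u * (X w * (X w * 1))) := by ring
  have h2 : pderiv w (X u ^ 2 : Pol d) = 0 := by rw [pderiv_X_sq, if_neg huw, zero_smul]
  have h3 : pderiv w ((4 : ℝ) • (sqPol s (F u) + (2 * F u u) • X u ^ 2)) =
      (8 * F u w) • (X w : Pol d) := by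
    rw [Derivation.map_smul, map_add, pderiv_sqPol s (F u) w fun h => by rw [hF, hs w h]; rfl,
      Derivation.map_smul, h2, smul_zero, add_zero, smul_smul]
    ring_nf
  rw [h1, fock_X_mul hT, fock_X_mul hT, fock_X_mul hT, fock_X_mul hT,
    pderiv_pderiv_pairPol s hF hs, h3, Derivation.map_smul, MvPolynomial.pderiv_X_self,
    fock_smul_right, fock_one_one]
  ring

lemma fock_pairPol_curPol [Nonempty (Fin d)] (hT : 0 < T) (s s' : Finset (Site d))
    {F : Site d → Site d → ℝ} (hF : ∀ x v, F x v = F v x) (hs : ∀ x, x ∉ s → F x = 0) (i : Fin d) :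
    fock T (pairPol s F) (curPol T a i s') = 16 * T ^ 4 * a i * ∑ x ∈ s', F x (x + e i) := by
  rw [curPol, fock_sum_right, Finset.mul_sum]
  refine Finset.sum_congr rfl fun x _ => ?_
  rw [sub_eq_add_neg, fock_add_right, fock_smul_right, fock_add_right,
    ← neg_one_smul ℝ, fock_smul_right, fock_smul_right, fock_comm, fock_X_sq_pairPol hT s hF hs,
    fock_comm, fock_X_sq_pairPol hT s hF hs, fock_comm,
    fock_X_sq_mul_X_sq_pairPol hT s hF hs (ne_add_e x i)]
  ring

/-- A pair `(u, L u)` of the graph for which `lam u - L u` is the sum of the currents in the box. -/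
def IsBoxSolution (T : ℝ) (a : Fin d → ℝ) (i : Fin d) (lam : ℝ) (k : ℕ) (q : L2 d T × L2 d T) :
    Prop :=
  q ∈ closedGraph d T a ∧ lam • q.1 - q.2 = toL2 T (curPol T a i (box d k))

lemma IsBoxSolution.energyNorm_eq {i : Fin d} {lam : ℝ} {k : ℕ} {q : L2 d T × L2 d T}
    (h : IsBoxSolution T a i lam k q) :
    energyNorm lam q = inner ℝ (toL2 T (curPol T a i (box d k))) q.1 := by
  rw [← h.2, inner_sub_left, inner_smul_left, real_inner_self_eq_norm_sq, energyNorm,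
    real_inner_comm q.2]
  rfl

/-- The variational lower bound from a test function. -/
theorem exists_lower_bound (hd : Nonempty (Fin d)) (hT : 0 < T) (a : Fin d → ℝ) :
    ∃ c : ℝ, 0 < c ∧ ∀ (i : Fin d) (lam : ℝ) (m : ℕ) (f : Site d → ℝ) (E₀ E₁ E₂ R : ℝ), 0 < lam →
      IsTest a f E₀ E₁ E₂ →
      lam * E₀ + E₁ + (flowEnergy d m + ((2 ^ m) ^ d * lam)⁻¹) * E₂ < R →
      ∀ᶠ k : ℕ in atTop, ∀ q, IsBoxSolution T a i lam k q →
        (2 * (k : ℝ) + 1) ^ d * (c * (a i * f (e i)) ^ 2 / R) ≤ energyNorm lam q := by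
  obtain ⟨c, hc, H⟩ := hbound_pairPol_sub hd hT a
  -- `32 = 16² / (4 · 2)`: the pairing constant `16 T⁴` squared, `4` from `(N / 2)²`, and `2` from
  -- the cost `N · 2R`.
  refine ⟨32 * T ^ 8 / c ^ 2, by positivity, ?_⟩
  intro i lam m f E₀ E₁ E₂ R hlam hf hR
  have hR0 : 0 < R := by
    refine lt_of_le_of_lt ?_ hR
    have h0 : 0 ≤ E₀ := by simpa using hf.norm ∅
    have h1 : 0 ≤ E₁ := by simpa using hf.grad ∅
    have h2 : 0 ≤ E₂ := by simpa using hf.drift ∅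
    have := flowEnergy_nonneg d m
    positivity
  filter_upwards [hf.eventually_pairCost_le hlam m hR, eventually_ge_atTop 1] with k hk hk1 q hq
  set N : ℝ := (2 * (k : ℝ) + 1) ^ d with hN
  have hN0 : 0 < N := by positivity
  set F := boxTest f k with hF
  set K' := box d (k + 1) with hK'
  have hsymm : ∀ x v, F x v = F v x := boxTest_comm hf.even k
  have hs : ∀ x, x ∉ box d k → F x = 0 := fun x => boxTest_eq_zero f
  have hs' : ∀ x, x ∉ K' → F x = 0 := fun x hx =>
    hs x fun h => hx (box_succ (Classical.arbitrary _) h).1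
  -- The enlarged box contains the lower end of every bond that touches the support of `F`, so the
  -- restricted operators `polS`, `fockA` are the full ones here.
  have hY : ∀ j, ∀ x ∉ K', rotP x (x + e j) (pairPol K' F) = 0 := by
    intro j x hx
    have h1 : F (x + e j) = 0 := hs _ fun h => hx (by simpa using (box_succ j h).2.1)
    rw [rotP_pairPol K' hsymm (fun _ => hs' x hx) (fun _ => h1), hs' x hx, h1]
    simp [sqPol]
  have h1 := H lam q m (box d k) K' F hlam hq.1 (fun j x hx => box_succ j hx) hsymm hs
  -- Duality: `⟨(lam - S + A) F, u⟩ = ⟨F, (lam - L) u⟩`, and the latter is the pairing of `F` with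
  -- the currents.
  have h2 : inner ℝ (toL2 T (lam • pairPol K' F - polS K' (pairPol K' F) +
      fockA T a K' (pairPol K' F))) q.1 = 16 * T ^ 4 * a i * ∑ x ∈ box d k, F x (x + e i) := by
    rw [← fock_pairPol_curPol hT K' (box d k) hsymm hs' i, ← inner_toL2_toL2, ← hq.2,
      inner_sub_right, inner_smul_right, inner_toL2_graph hY hq.1, sub_add, map_sub, map_smul,
      inner_sub_left, inner_smul_left]
    rfl
  have h3 : (2 * (k : ℝ) + 1) * ∑ x ∈ box d k, F x (x + e i) = f (e i) * (2 * k * N) := by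
    rw [hN, ← sum_boxInd_mul_shift k i, Finset.mul_sum, Finset.mul_sum, Finset.mul_sum,
      ← Finset.sum_subset (fun x hx => (box_succ i hx).1) fun x _ hx => by
        rw [boxInd_of_notMem hx]; ring]
    refine Finset.sum_congr rfl fun x _ => ?_
    rw [hF, boxTest, ← hf.even, neg_sub, add_sub_cancel_left]
    ring
  have hk1' : (1 : ℝ) ≤ k := by exact_mod_cast hk1
  -- The bonds inside the box are a fraction `2k / (2k + 1)` of its sites, at least one half since
  -- `k ≥ 1`.
  have h4 : (f (e i)) ^ 2 * (N / 2) ^ 2 ≤ (∑ x ∈ box d k, F x (x + e i)) ^ 2 := by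
    have h5 : ∑ x ∈ box d k, F x (x + e i) = f (e i) * (2 * k * N / (2 * k + 1)) := by
      rw [← mul_div_assoc, eq_div_iff (by positivity), ← h3]; ring
    rw [h5, mul_pow]
    refine mul_le_mul_of_nonneg_left (pow_le_pow_left₀ (by positivity) ?_ 2) (sq_nonneg _)
    rw [div_le_div_iff₀ two_pos (by positivity)]
    nlinarith
  unfold HBound at h1
  rw [h2] at h1
  have hE : 0 ≤ energyNorm lam q := by
    have := inner_graph_nonpos hq.1
    rw [energyNorm]
    nlinarith [sq_nonneg ‖q.1‖]
  have h6 := pow_le_pow_left₀ (abs_nonneg _) h1 2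
  have hcost : √(pairCost a lam m K' F) ^ 2 ≤ N * (2 * R) := by
    rw [Real.sq_sqrt ((mul_nonneg hlam.le (Finset.sum_nonneg fun _ _ => sq_nonneg _)).trans
      (pairCost_bounds (a := a) hlam m K' F).1)]
    exact hk
  rw [sq_abs, mul_pow _ (∑ x ∈ box d k, _), mul_pow (c * _), Real.sq_sqrt hE, mul_pow c] at h6
  have h7 : (16 * T ^ 4 * a i) ^ 2 * ((f (e i)) ^ 2 * (N / 2) ^ 2) ≤
      c ^ 2 * (N * (2 * R)) * energyNorm lam q :=
    (mul_le_mul_of_nonneg_left h4 (sq_nonneg _)).trans (h6.trans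
      (mul_le_mul_of_nonneg_right (mul_le_mul_of_nonneg_left hcost (sq_nonneg c)) hE))
  have h8 : N * (32 * T ^ 8 / c ^ 2 * (a i * f (e i)) ^ 2 / R) =
      ((16 * T ^ 4 * a i) ^ 2 * ((f (e i)) ^ 2 * (N / 2) ^ 2)) / (c ^ 2 * (N * (2 * R))) := by
    field_simp
    ring
  rw [h8, div_le_iff₀ (by positivity)]
  linarith

end Current

/-! ### Flow energies and the optimal scale in each dimension -/

section Scales

lemma flowEnergy_one_le (n : ℕ) : flowEnergy 1 n ≤ 2 * 2 ^ n := by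
  induction n with
  | zero => simp [flowEnergy]
  | succ n ih =>
    rw [flowEnergy, Finset.sum_range_succ, ← flowEnergy]
    have : (4 : ℝ) ^ n = 2 ^ n * 2 ^ n := by rw [← mul_pow]; norm_num
    rw [this, pow_one, mul_div_assoc, div_self (by positivity), pow_succ]
    linarith

lemma flowEnergy_two (n : ℕ) : flowEnergy 2 n = 2 * n := by
  rw [flowEnergy, Finset.sum_congr rfl (g := fun _ => (2 : ℝ))]
  · simp [mul_comm]
  · intro m _
    have : (4 : ℝ) ^ m = (2 ^ m) ^ 2 := by rw [← pow_mul, mul_comm, pow_mul]; norm_num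
    rw [this, div_self (by positivity), mul_one]

lemma flowEnergy_le {d : ℕ} (hd : 3 ≤ d) (n : ℕ) : flowEnergy d n ≤ 4 := by
  have h : ∀ m : ℕ, (2 : ℝ) * (4 ^ m / (2 ^ m) ^ d) ≤ 2 * (1 / 2) ^ m := by
    intro m
    refine mul_le_mul_of_nonneg_left ?_ zero_le_two
    rw [div_pow, one_pow, div_le_div_iff₀ (by positivity) (by positivity), one_mul]
    have : (4 : ℝ) ^ m * 2 ^ m = (2 ^ m) ^ 3 := by
      rw [← mul_pow, ← pow_mul, mul_comm m, pow_mul]; norm_num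
    rw [this]
    exact pow_le_pow_right₀ (one_le_pow₀ one_le_two) hd
  calc flowEnergy d n ≤ ∑ m ∈ Finset.range n, (2 : ℝ) * (1 / 2) ^ m :=
        Finset.sum_le_sum fun m _ => h m
    _ = 2 * ∑ m ∈ Finset.range n, (1 / 2 : ℝ) ^ m := (Finset.mul_sum _ _ _).symm
    _ ≤ 2 * 2 := mul_le_mul_of_nonneg_left (sum_geometric_two_le n) zero_le_two
    _ = 4 := by norm_num

/-- The diffusive scale `2 ^ m` of order `lam^(-1/2)`. In dimension one it balances the flow energy
with the residual `1 / (2 ^ m lam)`; in dimension two it makes the residual bounded. -/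
lemma exists_scale {lam : ℝ} (h0 : 0 < lam) (h1 : lam ≤ 1) :
    ∃ m : ℕ, 1 ≤ 4 ^ m * lam ∧ 4 ^ m * lam ≤ 4 := by
  obtain ⟨n, hn, hn'⟩ := exists_nat_pow_near (x := lam⁻¹) (y := 4) (one_le_inv₀ h0 |>.2 h1)
    (by norm_num)
  refine ⟨n + 1, ?_, ?_⟩
  · have := mul_le_mul_of_nonneg_right hn'.le h0.le
    rwa [inv_mul_cancel₀ h0.ne'] at this
  · have := mul_le_mul_of_nonneg_right hn h0.le
    rw [inv_mul_cancel₀ h0.ne'] at this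
    rw [pow_succ]
    linarith

lemma exists_flow_scale_one {lam : ℝ} (h0 : 0 < lam) (h1 : lam ≤ 1) :
    ∃ m : ℕ, flowEnergy 1 m + ((2 ^ m) ^ 1 * lam)⁻¹ ≤ 6 * (√lam)⁻¹ := by
  obtain ⟨m, hm, hm'⟩ := exists_scale h0 h1
  refine ⟨m, ?_⟩
  have h4 : (4 : ℝ) ^ m = 2 ^ m * 2 ^ m := by rw [← mul_pow]; norm_num
  have hp : (0 : ℝ) < 2 ^ m := by positivity
  have hs : 0 < √lam := Real.sqrt_pos.2 h0
  have hs2 : √lam * √lam = lam := Real.mul_self_sqrt h0.le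
  have e1 : ((2 : ℝ) ^ m * lam)⁻¹ ≤ 2 ^ m := by
    rw [inv_le_iff_one_le_mul₀ (by positivity)]
    rw [h4] at hm; linarith
  have e2 : (2 : ℝ) ^ m ≤ 2 * (√lam)⁻¹ := by
    rw [← div_eq_mul_inv, le_div_iff₀ hs]
    rw [h4, ← hs2] at hm'
    nlinarith [mul_pos hp hs]
  rw [pow_one]
  linarith [flowEnergy_one_le m]

lemma exists_flow_scale_two {lam : ℝ} (h0 : 0 < lam) (h1 : lam ≤ 1) :
    ∃ m : ℕ, flowEnergy 2 m + ((2 ^ m) ^ 2 * lam)⁻¹ ≤ 3 + 2 * |Real.log lam| := by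
  obtain ⟨m, hm, hm'⟩ := exists_scale h0 h1
  refine ⟨m, ?_⟩
  have h4 : ((2 : ℝ) ^ m) ^ 2 = 4 ^ m := by rw [← pow_mul, mul_comm, pow_mul]; norm_num
  have e1 : (((2 : ℝ) ^ m) ^ 2 * lam)⁻¹ ≤ 1 := by rw [h4]; exact inv_le_one_of_one_le₀ hm
  have e2 := Real.log_le_log (by positivity) hm'
  rw [Real.log_mul (by positivity) h0.ne', Real.log_pow] at e2
  have e3 : (1 : ℝ) ≤ Real.log 4 := by
    rw [show (4 : ℝ) = 2 ^ 2 by norm_num, Real.log_pow]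
    have := Real.log_two_gt_d9
    push_cast
    linarith
  have e4 : Real.log lam ≤ 0 := Real.log_nonpos h0.le h1
  rw [abs_of_nonpos e4, flowEnergy_two]
  have e5 : (m : ℝ) ≤ 1 - Real.log lam := by
    by_contra hc
    push Not at hc
    nlinarith
  linarith

/-- For `d ≥ 3` the energy is bounded at every scale, so any sufficiently large scale serves and
`lam` need not be small. -/
lemma exists_flow_scale {d : ℕ} (hd : 3 ≤ d) {lam : ℝ} (h0 : 0 < lam) :
    ∃ m : ℕ, flowEnergy d m + ((2 ^ m) ^ d * lam)⁻¹ ≤ 5 := by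
  obtain ⟨m, hm⟩ := pow_unbounded_of_one_lt lam⁻¹ (one_lt_two (α := ℝ))
  refine ⟨m, ?_⟩
  have h1 : (2 : ℝ) ^ m ≤ (2 ^ m) ^ d := le_self_pow₀ (one_le_pow₀ one_le_two) (by omega)
  have h2 : 1 ≤ (2 ^ m) ^ d * lam := by
    have := mul_le_mul_of_nonneg_right (hm.le.trans h1) h0.le
    rwa [inv_mul_cancel₀ h0.ne'] at this
  linarith [flowEnergy_le hd m, inv_le_one_of_one_le₀ h2]

end Scales

/-! ### The upper bound in dimension at least three -/

section UpperBound

variable {d : ℕ} {T lam : ℝ} {a : Fin d → ℝ} {q : L2 d T × L2 d T}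

open MvPolynomial (X pderiv monomial C)

lemma rotP_X_mul_X_eq {x y : Site d} (h : x ≠ y) :
    rotP x y (X x * X y : Pol d) = X y ^ 2 - X x ^ 2 := by
  rw [rotP_apply, Derivation.leibniz, Derivation.leibniz, MvPolynomial.pderiv_X_self,
    MvPolynomial.pderiv_X_self, MvPolynomial.pderiv_X_of_ne h, MvPolynomial.pderiv_X_of_ne h.symm]
  simp only [smul_eq_mul]
  ring

/-- The gradient part of the current on a bond is the field applied to `X_x X_{x+e_i}`. Each bond is
estimated on its own, so no keys are needed. -/
lemma hbound_gradient [Nonempty (Fin d)] (hT : 0 < T) (hlam : 0 < lam) (hq : q ∈ closedGraph d T a)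
    (i : Fin d) (s : Finset (Site d)) :
    HBound lam q (∑ x ∈ s, (X (x + e i) ^ 2 - X x ^ 2)) (√(normConst T 2 0 * s.card)) := by
  classical
  have h : ∑ x ∈ s, (X (x + e i) ^ 2 - X x ^ 2 : Pol d) = ∑ j, ∑ x ∈ s, rotP x (x + e j)
      (if j = i then X x * X (x + e j) else 0) := by
    rw [Finset.sum_eq_single i (fun j _ hj => by simp [hj]) (by simp)]
    refine Finset.sum_congr rfl fun x _ => ?_
    rw [if_pos rfl, rotP_X_mul_X_eq (ne_add_e x i)]
  have hm : ∀ x : Site d, ‖toL2 T (X x * X (x + e i) : Pol d)‖ ^ 2 ≤ normConst T 2 0 := by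
    intro x
    have h1 : (X x * X (x + e i) : Pol d) = ∑ _u : Unit, (1 : ℝ) •
        monomial (Finsupp.single x 1 + Finsupp.single (x + e i) 1) 1 := by
      rw [monomial_add_single_one, ← MvPolynomial.X]
      simp [mul_comm]
    rw [h1]
    refine (norm_sq_toL2_le hT (n := 2) (r := 0) _ _ _ (fun _ _ => by simp) (fun _ k => k.elim0)
      (fun _ _ _ _ _ => rfl) fun _ _ k => k.elim0).trans (by simp)
  rw [h]
  refine HBound.of_rot hlam hq s _ ?_
  rw [Finset.sum_eq_single i (fun j _ hj => by simp [hj]) (by simp)]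
  refine (Finset.sum_le_card_nsmul s _ (normConst T 2 0) fun x _ => ?_).trans (le_of_eq ?_)
  · rw [if_pos rfl]; exact hm x
  · rw [nsmul_eq_mul, mul_comm]

/-- The box current has dual norm at most `κ √N`, and its pairing with `u` is the energy `E` itself;
`E ≤ κ √N √E` then gives `E ≤ κ² N`. -/
theorem exists_upper_bound (hd : 3 ≤ d) (hT : 0 < T) (a : Fin d → ℝ) (i : Fin d) :
    ∃ c : ℝ, 0 < c ∧ ∀ (lam : ℝ) (k : ℕ) (q : L2 d T × L2 d T), 0 < lam →
      IsBoxSolution T a i lam k q → energyNorm lam q ≤ (2 * (k : ℝ) + 1) ^ d * c := by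
  have hne : Nonempty (Fin d) := ⟨i⟩
  set κ : ℝ := |2 * (1 + a i * T)| * √(normConst T 2 0) + |2 * a i| *
    (√(normConst T 4 2 * 5) + √(normConst T 4 1 * (d * 5))) with hκ
  refine ⟨κ ^ 2 + 1, by positivity, ?_⟩
  intro lam k q hlam hq
  have nn := fun n r => normConst_nonneg (T := T) hT n r
  obtain ⟨m, hm⟩ := exists_flow_scale hd hlam
  have hf0 := flowEnergy_nonneg d m
  have hf1 : 0 ≤ (((2 : ℝ) ^ m) ^ d * lam)⁻¹ := by positivity
  set N : ℝ := (2 * (k : ℝ) + 1) ^ d with hN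
  have hN0 : 0 ≤ N := by positivity
  have h1 := hbound_gradient hT hlam hq.1 i (box d k)
  rw [card_box, ← hN] at h1
  have h2 : HBound lam q (∑ x ∈ box d k, (X x ^ 2 * X (x + e i) ^ 2))
      ((√(normConst T 4 2 * 5) + √(normConst T 4 1 * (d * 5))) * √N) := by
    have e1 : ∑ x ∈ box d k, (X x ^ 2 * X (x + e i) ^ 2 : Pol d) =
        ∑ x ∈ box d k, (1 : ℝ) • walker (Finsupp.single x 2) (x + e i) := by
      refine Finset.sum_congr rfl fun x _ => ?_
      rw [X_sq_mul_X_sq, walker, Finsupp.single_eq_of_ne (add_e_ne x i)]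
      simp
    rw [e1]
    refine (HBound.flow hT hlam hq.1 (box d k) (fun _ => 1) (fun x => x + e i)
      (fun x => Finsupp.single x 2) (n := 2) (r := 1) (fun _ _ => by simp) _ (one_key_injOn _)
      (fun _ _ _ => by simp) m).mono ?_
    rw [add_mul, ← Real.sqrt_mul (mul_nonneg (nn _ _) (by norm_num)),
      ← Real.sqrt_mul (mul_nonneg (nn _ _) (by positivity))]
    have e2 : ∑ _x ∈ box d k, (1 : ℝ) ^ 2 = N := by
      rw [hN, ← card_box]; simp
    rw [e2]
    refine add_le_add (Real.sqrt_le_sqrt ?_) (Real.sqrt_le_sqrt ?_)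
    · have e3 : normConst T (2 + 2) (1 + 1) * ((((2 : ℝ) ^ m) ^ d)⁻¹ * N) / lam =
        normConst T 4 2 * (((2 ^ m) ^ d * lam)⁻¹ * N) := by rw [mul_inv]; ring
      rw [e3, mul_assoc]
      exact mul_le_mul_of_nonneg_left (mul_le_mul_of_nonneg_right (by linarith) hN0) (nn _ _)
    · rw [mul_assoc (normConst T 4 1)]
      refine mul_le_mul_of_nonneg_left (mul_le_mul_of_nonneg_right ?_ hN0) (nn _ _)
      exact mul_le_mul_of_nonneg_left (by linarith) d.cast_nonneg
  have h3 : HBound lam q (curPol T a i (box d k)) (κ * √N) := by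
    rw [curPol, Finset.sum_add_distrib, ← Finset.smul_sum, ← Finset.smul_sum]
    refine ((h1.smul _).add (h2.smul _)).mono (le_of_eq ?_)
    rw [Real.sqrt_mul (nn _ _), hκ]
    ring
  unfold HBound at h3
  rw [← hq.energyNorm_eq] at h3
  have hE : 0 ≤ energyNorm lam q := by
    have := inner_graph_nonpos hq.1
    rw [energyNorm]
    nlinarith [sq_nonneg ‖q.1‖]
  have h4 := Real.mul_self_sqrt hE
  have h5 : √(energyNorm lam q) ≤ κ * √N := by
    by_contra hc
    push Not at hc
    have h6 : 0 ≤ κ * √N := by positivity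
    have := (le_abs_self _).trans h3
    nlinarith
  have h7 := pow_le_pow_left₀ (Real.sqrt_nonneg _) h5 2
  rw [Real.sq_sqrt hE, mul_pow, Real.sq_sqrt hN0] at h7
  linarith

end UpperBound

/-! ### Test functions whose drift is bounded by their gradient -/

section SimpleTests

variable {d : ℕ} {T : ℝ} {a : Fin d → ℝ} {f : Site d → ℝ} {E₀ E₁ : ℝ}

/-- Plain Cauchy–Schwarz over the directions; the weight is at most `3`, whence `9`. -/
lemma IsTest.of_grad (h : ∀ z, f (-z) = f z) (h₀ : ∀ s : Finset (Site d), ∑ z ∈ s, f z ^ 2 ≤ E₀)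
    (h₁ : ∀ s : Finset (Site d), ∑ z ∈ s, ∑ j, (f z - f (z + e j)) ^ 2 ≤ E₁) :
    IsTest a f E₀ E₁ (9 * (∑ j, a j ^ 2) * E₁) := by
  refine ⟨h, h₀, h₁, fun s => ?_⟩
  have ha : 0 ≤ 9 * ∑ j, a j ^ 2 :=
    mul_nonneg (by norm_num) (Finset.sum_nonneg fun _ _ => sq_nonneg _)
  refine le_trans ?_ (mul_le_mul_of_nonneg_left (h₁ s) ha)
  rw [Finset.mul_sum]
  refine Finset.sum_le_sum fun z _ => ?_
  refine (Finset.sum_mul_sq_le_sq_mul_sq _ _ _).trans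
    (mul_le_mul_of_nonneg_right ?_ (Finset.sum_nonneg fun _ _ => sq_nonneg _))
  rw [Finset.mul_sum]
  refine Finset.sum_le_sum fun j _ => ?_
  rw [mul_pow, mul_comm]
  refine mul_le_mul_of_nonneg_right ?_ (sq_nonneg _)
  split_ifs <;> norm_num

lemma sum_grad_le (h₀ : ∀ s : Finset (Site d), ∑ z ∈ s, f z ^ 2 ≤ E₀) (s : Finset (Site d)) :
    ∑ z ∈ s, ∑ j, (f z - f (z + e j)) ^ 2 ≤ 4 * d * E₀ := by
  classical
  have h1 : ∀ j : Fin d, ∑ z ∈ s, f (z + e j) ^ 2 ≤ E₀ := fun j => by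
    have := h₀ (s.image fun z => z + e j)
    rwa [Finset.sum_image fun b _ b' _ h => by simpa using h] at this
  rw [Finset.sum_comm]
  have h2 : ∀ j : Fin d, ∑ z ∈ s, (f z - f (z + e j)) ^ 2 ≤ 4 * E₀ := by
    intro j
    calc _ ≤ ∑ z ∈ s, (2 * f z ^ 2 + 2 * f (z + e j) ^ 2) :=
          Finset.sum_le_sum fun z _ => by nlinarith [sq_nonneg (f z + f (z + e j))]
      _ ≤ _ := by
          rw [Finset.sum_add_distrib, ← Finset.mul_sum, ← Finset.mul_sum]
          linarith [h₀ s, h1 j]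
  refine (Finset.sum_le_card_nsmul _ _ _ fun j _ => h2 j).trans (le_of_eq ?_)
  rw [Finset.card_univ, Fintype.card_fin, nsmul_eq_mul]
  ring

/-- In large boxes, the squared resolvent norm of the current is at least `b` per site. -/
def LowerBound (T : ℝ) (a : Fin d → ℝ) (i : Fin d) (lam b : ℝ) : Prop :=
  ∀ᶠ k : ℕ in atTop, ∀ q, IsBoxSolution T a i lam k q → (2 * (k : ℝ) + 1) ^ d * b ≤ energyNorm lam q

lemma LowerBound.mono {i : Fin d} {lam b b' : ℝ} (h : LowerBound T a i lam b) (hb : b' ≤ b) :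
    LowerBound T a i lam b' := by
  filter_upwards [h] with k hk q hq
  exact (mul_le_mul_of_nonneg_left hb (by positivity)).trans (hk q hq)

/-- The lower bound from a test function that lives on the neighbours of the origin. -/
lemma exists_lowerBound_of_scale (hT : 0 < T) {i : Fin d} (hi : a i ≠ 0) {M : ℝ} (hM : 0 ≤ M) :
    ∃ c : ℝ, 0 < c ∧ ∀ lam : ℝ, 0 < lam → lam ≤ 1 → ∀ m : ℕ,
      flowEnergy d m + ((2 ^ m) ^ d * lam)⁻¹ ≤ M → LowerBound T a i lam c := by
  classical
  obtain ⟨c, hc, H⟩ := exists_lower_bound ⟨i⟩ hT a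
  have ha : 0 ≤ ∑ j, a j ^ 2 := Finset.sum_nonneg fun _ _ => sq_nonneg _
  -- With `E₀ = 2` and `lam ≤ 1`: the norm costs `2`, the gradient `8 d`, the drift `M` times its
  -- bound, and `1` makes the inequality strict.
  set R : ℝ := 2 + 8 * d + M * (9 * (∑ j, a j ^ 2) * (8 * d)) + 1 with hR
  have hR0 : 0 < R := by positivity
  refine ⟨c * a i ^ 2 / R, by positivity, ?_⟩
  intro lam h0 h1 m hm
  set f : Site d → ℝ := fun z => if z = e i ∨ z = -e i then 1 else 0 with hf
  have hfn : ∀ s : Finset (Site d), ∑ z ∈ s, f z ^ 2 ≤ 2 := by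
    intro s
    have e1 : ∀ z, f z ^ 2 = if z ∈ ({e i, -e i} : Finset (Site d)) then 1 else 0 := by
      intro z; simp [hf]
    simp only [e1, Finset.sum_ite_mem, Finset.sum_const, nsmul_eq_mul, mul_one]
    exact_mod_cast (Finset.card_le_card Finset.inter_subset_right).trans Finset.card_le_two
  have hev : ∀ z, f (-z) = f z := by
    intro z
    simp only [hf]
    congr 1
    rw [neg_inj, neg_eq_iff_eq_neg, or_comm]
  have ht := IsTest.of_grad (a := a) hev hfn (sum_grad_le hfn)
  have h8 : 4 * (d : ℝ) * 2 = 8 * d := by ring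
  rw [h8] at ht
  have := H i lam m f _ _ _ R h0 ht ?_
  · have e1 : f (e i) = 1 := by simp [hf]
    rw [e1, mul_one] at this
    exact this
  · have e1 := mul_le_mul_of_nonneg_right hm (show 0 ≤ 9 * (∑ j, a j ^ 2) * (8 * (d : ℝ)) by
      positivity)
    rw [hR]
    linarith

end SimpleTests

/-! ### Dimension one: the tent function -/

section Tent

variable {T : ℝ} {a : Fin 1 → ℝ}

/-- The tent function of slope `ε`. -/
noncomputable def tent (ε : ℝ) (z : Site 1) : ℝ := max 0 (1 - ε * |(z 0 : ℝ)|)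

lemma tent_eq_zero {ε : ℝ} (hε : 0 < ε) {z : Site 1} (hz : z ∉ box 1 ⌊ε⁻¹⌋₊) : tent ε z = 0 := by
  rw [mem_box] at hz
  push Not at hz
  obtain ⟨i, hi⟩ := hz
  rw [Subsingleton.elim i 0] at hi
  have h1 : ((⌊ε⁻¹⌋₊ : ℤ) + 1) ≤ |z 0| := by
    rcases abs_cases (z 0) with h | h <;> omega
  have h2 : ε⁻¹ ≤ |(z 0 : ℝ)| := by
    have h3 : (((⌊ε⁻¹⌋₊ : ℤ) + 1 : ℤ) : ℝ) ≤ ((|z 0| : ℤ) : ℝ) := by exact_mod_cast h1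
    push_cast at h3
    exact (Nat.lt_floor_add_one _).le.trans h3
  have h4 := mul_le_mul_of_nonneg_left h2 hε.le
  rw [mul_inv_cancel₀ hε.ne'] at h4
  exact max_eq_left (by linarith)

lemma abs_tent_sub_le {ε : ℝ} (hε : 0 < ε) (z : Site 1) (j : Fin 1) :
    |tent ε z - tent ε (z + e j)| ≤ ε := by
  have h1 := abs_max_sub_max_le_abs (1 - ε * |(z 0 : ℝ)|) (1 - ε * |((z + e j) 0 : ℝ)|) 0
  have h2 : |(((z + e j) 0 : ℤ) : ℝ)| = |(z 0 : ℝ) + 1| := by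
    rw [Pi.add_apply, e_apply, if_pos (Subsingleton.elim _ _)]; push_cast; rfl
  rw [tent, tent, max_comm 0, max_comm 0]
  refine h1.trans ?_
  rw [h2]
  have h3 := abs_abs_sub_abs_le_abs_sub ((z 0 : ℝ) + 1) (z 0)
  rw [add_sub_cancel_left, abs_one] at h3
  have : 1 - ε * |(z 0 : ℝ)| - (1 - ε * |(z 0 : ℝ) + 1|) = ε * (|(z 0 : ℝ) + 1| - |(z 0 : ℝ)|) := by
    ring
  rw [this, abs_mul, abs_of_pos hε]
  exact mul_le_of_le_one_right hε.le h3

/-- The support has at most `2/ε + 1 ≤ 3/ε` sites. The increments, each at most `ε`, live on one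
further layer, hence on at most `5/ε` sites. -/
lemma isTest_tent {ε : ℝ} (hε : 0 < ε) (hε1 : ε ≤ 1) :
    IsTest a (tent ε) (3 * ε⁻¹) (5 * ε) (9 * (∑ j, a j ^ 2) * (5 * ε)) := by
  classical
  have hinv : 1 ≤ ε⁻¹ := (one_le_inv₀ hε).2 hε1
  have hfl : (⌊ε⁻¹⌋₊ : ℝ) ≤ ε⁻¹ := Nat.floor_le (by positivity)
  have hsum : ∀ (n : ℕ) (s : Finset (Site 1)) (g : Site 1 → ℝ) (c : ℝ), 0 ≤ c → (∀ z, g z ≤ c) →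
      (∀ z, z ∉ box 1 n → g z = 0) → ∑ z ∈ s, g z ≤ (2 * (n : ℝ) + 1) * c := by
    intro n s g c hc hg h0
    calc ∑ z ∈ s, g z ≤ ∑ z ∈ s, if z ∈ box 1 n then c else 0 := by
          refine Finset.sum_le_sum fun z _ => ?_
          split_ifs with h
          · exact hg z
          · exact (h0 z h).le
      _ = (s ∩ box 1 n).card * c := by
          rw [Finset.sum_ite_mem, Finset.sum_const, nsmul_eq_mul]
      _ ≤ (box 1 n).card * c := by
          gcongr
          exact Finset.inter_subset_right
      _ = _ := by rw [card_box, pow_one]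
  refine IsTest.of_grad (fun z => ?_) (fun s => ?_) (fun s => ?_)
  · simp [tent]
  · refine (hsum ⌊ε⁻¹⌋₊ s _ 1 zero_le_one (fun z => ?_) fun z hz => ?_).trans ?_
    · have h0 : 0 ≤ tent ε z := le_max_left _ _
      have h1 : tent ε z ≤ 1 := max_le zero_le_one
        (by linarith [mul_nonneg hε.le (abs_nonneg (z 0 : ℝ))])
      exact pow_le_one₀ h0 h1
    · rw [tent_eq_zero hε hz]; norm_num
    · linarith
  · refine (hsum (⌊ε⁻¹⌋₊ + 1) s _ (ε ^ 2) (sq_nonneg _) (fun z => ?_) fun z hz => ?_).trans ?_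
    · rw [Fin.sum_univ_one]
      exact sq_le_sq.2 ((abs_tent_sub_le hε z 0).trans (le_abs_self ε))
    · have h1 : z ∉ box 1 ⌊ε⁻¹⌋₊ := fun h => hz (box_succ 0 h).1
      have h2 : z + e 0 ∉ box 1 ⌊ε⁻¹⌋₊ := fun h => hz (by simpa using (box_succ 0 h).2.1)
      rw [Fin.sum_univ_one, tent_eq_zero hε h1, tent_eq_zero hε h2]
      norm_num
    · push_cast
      have : (2 * ((⌊ε⁻¹⌋₊ : ℝ) + 1) + 1) * ε ^ 2 ≤ (5 * ε⁻¹) * ε ^ 2 :=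
        mul_le_mul_of_nonneg_right (by linarith) (sq_nonneg _)
      refine this.trans (le_of_eq ?_)
      field_simp

/-- With slope `ε` the cost is of order `lam/ε + ε + lam^(-1/2) ε`, optimal at `ε` of order
`lam^(3/4)`, where it is of order `lam^(1/4)`. -/
theorem exists_lowerBound_one (hT : 0 < T) {i : Fin 1} (hi : a i ≠ 0) :
    ∃ c : ℝ, 0 < c ∧ ∀ lam : ℝ, 0 < lam → lam ≤ 1 →
      LowerBound T a i lam (c * lam ^ (-(1 / 4) : ℝ)) := by
  obtain ⟨c, hc, H⟩ := exists_lower_bound ⟨i⟩ hT a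
  set A : ℝ := ∑ j, a j ^ 2 with hA
  have hA0 : 0 ≤ A := Finset.sum_nonneg fun _ _ => sq_nonneg _
  refine ⟨c * (a i ^ 2 / 4) / (10 + 135 * A), by positivity, ?_⟩
  intro lam h0 h1
  obtain ⟨m, hm⟩ := exists_flow_scale_one h0 h1
  -- The slope is `t³ / 2`; the half ensures that the tent is at least `1/2` at `e i` for every `lam
  -- ≤ 1`.
  set t : ℝ := lam ^ (1 / 4 : ℝ) with ht
  have ht0 : 0 < t := Real.rpow_pos_of_pos h0 _
  have ht1 : t ≤ 1 := Real.rpow_le_one h0.le h1 (by norm_num)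
  have ht4 : lam = t ^ 4 := by
    rw [ht, ← Real.rpow_natCast, ← Real.rpow_mul h0.le]; norm_num
  have hts : √lam = t ^ 2 := by
    rw [ht4, show t ^ 4 = (t ^ 2) ^ 2 by ring, Real.sqrt_sq (by positivity)]
  have ht3 : t ^ 3 ≤ t := by
    calc t ^ 3 = t ^ 2 * t := by ring
      _ ≤ 1 * t := mul_le_mul_of_nonneg_right (pow_le_one₀ ht0.le ht1) ht0.le
      _ = t := one_mul t
  have hε : 0 < t ^ 3 / 2 := by positivity
  have hR : lam * (3 * (t ^ 3 / 2)⁻¹) + 5 * (t ^ 3 / 2) +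
      (flowEnergy 1 m + ((2 ^ m) ^ 1 * lam)⁻¹) * (9 * A * (5 * (t ^ 3 / 2))) <
      (10 + 135 * A) * t := by
    have e1 : lam * (3 * (t ^ 3 / 2)⁻¹) = 6 * t := by rw [ht4]; field_simp; ring
    have e2 := mul_le_mul_of_nonneg_right hm (show 0 ≤ 9 * A * (5 * (t ^ 3 / 2)) by positivity)
    have e3 : 6 * (√lam)⁻¹ * (9 * A * (5 * (t ^ 3 / 2))) = 135 * A * t := by
      rw [hts]; field_simp; ring
    rw [e1]
    rw [e3] at e2
    linarith
  have := H i lam m _ _ _ _ _ h0 (isTest_tent hε (by linarith)) hR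
  refine LowerBound.mono this ?_
  have e1 : tent (t ^ 3 / 2) (e i) = 1 - t ^ 3 / 2 := by
    rw [tent, e_apply, if_pos (Subsingleton.elim _ _)]
    norm_num
    linarith
  have e2 : lam ^ (-(1 / 4) : ℝ) = t⁻¹ := by rw [ht, Real.rpow_neg h0.le]
  rw [e1, e2]
  have e3 : (1 : ℝ) / 4 ≤ (1 - t ^ 3 / 2) ^ 2 := by nlinarith
  rw [show c * (a i ^ 2 / 4) / (10 + 135 * A) * t⁻¹ =
    c * (a i ^ 2 * (1 / 4)) / ((10 + 135 * A) * t) by field_simp, mul_pow]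
  gcongr

end Tent

/-! ### Sums over dyadic shells -/

section ShellSums

/-- A sum over dyadic shells, if the number of points below level `t` is at most `K t`. -/
lemma exists_sum_le_shells {α : Type*} {w : α → ℝ} {K : ℝ} (hw : ∀ z, 1 ≤ w z)
    (hK : ∀ (s : Finset α) (t : ℝ), 1 ≤ t → (∀ z ∈ s, w z ≤ t) → (s.card : ℝ) ≤ K * t)
    (s : Finset α) (g : α → ℝ) (b : ℕ → ℝ) (hb : ∀ n, 0 ≤ b n)
    (hg : ∀ z n, (2 : ℝ) ^ n ≤ w z → w z < 2 ^ (n + 1) → g z ≤ b n) :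
    ∃ m : ℕ, ∑ z ∈ s, g z ≤ ∑ n ∈ Finset.range m, K * 2 ^ (n + 1) * b n := by
  classical
  have hex : ∀ z, ∃ n : ℕ, (2 : ℝ) ^ n ≤ w z ∧ w z < 2 ^ (n + 1) := fun z =>
    exists_nat_pow_near (hw z) one_lt_two
  choose n hn hn' using hex
  refine ⟨s.sup n + 1, ?_⟩
  have hmap : ∀ z ∈ s, n z ∈ Finset.range (s.sup n + 1) := fun z hz =>
    Finset.mem_range.2 (Nat.lt_succ_of_le (Finset.le_sup hz))
  rw [← Finset.sum_fiberwise_of_maps_to hmap]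
  refine Finset.sum_le_sum fun l _ => ?_
  calc ∑ z ∈ s with n z = l, g z ≤ ∑ z ∈ s with n z = l, b l :=
        Finset.sum_le_sum fun z hz => by
          have h := (Finset.mem_filter.1 hz).2
          exact hg z l (h ▸ hn z) (h ▸ hn' z)
    _ = (s.filter fun z => n z = l).card * b l := by rw [Finset.sum_const, nsmul_eq_mul]
    _ ≤ K * 2 ^ (l + 1) * b l := mul_le_mul_of_nonneg_right
        (hK _ _ (one_le_pow₀ one_le_two) fun z hz => by
          have h := (Finset.mem_filter.1 hz).2
          exact (h ▸ hn' z).le) (hb l)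

variable {α : Type*} {w : α → ℝ} {K : ℝ}

lemma sum_inv_sq_le (hK0 : 0 ≤ K) (hw : ∀ z, 1 ≤ w z)
    (hK : ∀ (s : Finset α) (t : ℝ), 1 ≤ t → (∀ z ∈ s, w z ≤ t) → (s.card : ℝ) ≤ K * t)
    (s : Finset α) : ∑ z ∈ s, (w z ^ 2)⁻¹ ≤ 4 * K := by
  obtain ⟨m, hm⟩ := exists_sum_le_shells hw hK s (fun z => (w z ^ 2)⁻¹) (fun n => ((2 ^ n) ^ 2)⁻¹)
    (fun n => by positivity) fun z n h _ => by gcongr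
  refine hm.trans ?_
  have h1 : ∀ n : ℕ, K * 2 ^ (n + 1) * ((2 ^ n) ^ 2)⁻¹ = 2 * K * (1 / 2 : ℝ) ^ n := fun n => by
    rw [pow_succ, div_pow, one_pow]; field_simp
  rw [Finset.sum_congr rfl fun n _ => h1 n, ← Finset.mul_sum]
  have := mul_le_mul_of_nonneg_left (sum_geometric_two_le m) (show 0 ≤ 2 * K by linarith)
  linarith

/-- Each of the `ν` shells below the truncation level contributes at most `2K`; the shells above
form a geometric series of total at most `4K`. -/
lemma sum_log_le {ρ : ℝ} {ν : ℕ} (hν : ρ ≤ 2 ^ ν) (hρ : 0 ≤ ρ) (hK0 : 0 ≤ K) (hw : ∀ z, 1 ≤ w z)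
    (hK : ∀ (s : Finset α) (t : ℝ), 1 ≤ t → (∀ z ∈ s, w z ≤ t) → (s.card : ℝ) ≤ K * t)
    {g : α → ℝ} (h1 : ∀ z, g z ≤ (w z)⁻¹) (h2 : ∀ z, g z ≤ ρ ^ 2 * (w z ^ 3)⁻¹)
    (s : Finset α) : ∑ z ∈ s, g z ≤ 2 * K * (ν + 2) := by
  obtain ⟨m, hm⟩ := exists_sum_le_shells hw hK s g
    (fun n => (2 ^ n)⁻¹ * if n < ν then 1 else (1 / 2) ^ (n - ν))
    (fun n => by positivity) fun z n h _ => by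
      split_ifs with hn
      · rw [mul_one]
        exact (h1 z).trans (by gcongr)
      · push Not at hn
        have hwz : 0 < w z := zero_lt_one.trans_le (hw z)
        have h3 : ρ ^ 2 * (w z ^ 3)⁻¹ ≤ (2 ^ ν) ^ 2 * ((2 ^ n) ^ 3)⁻¹ := by gcongr
        refine (h2 z).trans (h3.trans ?_)
        obtain ⟨l, rfl⟩ := Nat.exists_eq_add_of_le hn
        rw [Nat.add_sub_cancel_left, pow_add, div_pow, one_pow]
        have : (1 : ℝ) ≤ 2 ^ l := one_le_pow₀ one_le_two
        rw [← div_eq_mul_inv, div_le_iff₀ (by positivity)]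
        field_simp
        exact this
  refine hm.trans ?_
  have e1 : ∀ n : ℕ, K * 2 ^ (n + 1) * ((2 ^ n)⁻¹ * if n < ν then 1 else (1 / 2) ^ (n - ν)) =
      2 * K * (if n < ν then 1 else (1 / 2 : ℝ) ^ (n - ν)) := fun n => by
    rw [pow_succ]; field_simp
  rw [Finset.sum_congr rfl fun n _ => e1 n, ← Finset.mul_sum]
  refine mul_le_mul_of_nonneg_left ?_ (by linarith)
  calc ∑ n ∈ Finset.range m, (if n < ν then (1 : ℝ) else (1 / 2) ^ (n - ν))
      ≤ ∑ n ∈ Finset.range (ν + m), (if n < ν then (1 : ℝ) else (1 / 2) ^ (n - ν)) :=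
        Finset.sum_le_sum_of_subset_of_nonneg (Finset.range_subset_range.2 (by omega))
          fun n _ _ => by positivity
    _ = ∑ n ∈ Finset.range ν, (1 : ℝ) + ∑ n ∈ Finset.range m, (1 / 2 : ℝ) ^ n := by
        rw [Finset.sum_range_add]
        congr 1
        · exact Finset.sum_congr rfl fun n hn => if_pos (Finset.mem_range.1 hn)
        · exact Finset.sum_congr rfl fun n _ => by simp
    _ ≤ ν + 2 := by
        have := sum_geometric_two_le m
        simp only [Finset.sum_const, Finset.card_range, nsmul_eq_mul, mul_one]
        linarith

end ShellSums

/-! ### Increments of the truncated logarithm -/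

section LogPotential

/-- A unit step changes the form by at most the order of the square root of `1 + Q`, and `1 + Q` by
a bounded factor. The constants do not depend on `M`, since `M ≥ 1`. -/
lemma quad_increment {M : ℝ} (hM : 1 ≤ M) (A B α β : ℝ) :
    ((B + β) ^ 2 + (A + α) ^ 2 / M - (B ^ 2 + A ^ 2 / M)) ^ 2 ≤
      (12 * (α ^ 2 + β ^ 2) + 3 * (α ^ 2 + β ^ 2) ^ 2) * (1 + (B ^ 2 + A ^ 2 / M)) ∧
    1 + ((B + β) ^ 2 + (A + α) ^ 2 / M) ≤
      (2 + 2 * (α ^ 2 + β ^ 2)) * (1 + (B ^ 2 + A ^ 2 / M)) := by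
  have hM0 : 0 < M := by linarith
  set u := M⁻¹ with hu
  have hu0 : 0 < u := inv_pos.2 hM0
  have hu1 : u ≤ 1 := inv_le_one_of_one_le₀ hM
  simp only [div_eq_mul_inv, ← hu]
  have hA : 0 ≤ A ^ 2 * u := by positivity
  have hα : α ^ 2 * u ≤ α ^ 2 := mul_le_of_le_one_right (sq_nonneg α) hu1
  have hα0 : 0 ≤ α ^ 2 * u := by positivity
  constructor
  · have e1 : (B + β) ^ 2 + (A + α) ^ 2 * u - (B ^ 2 + A ^ 2 * u) =
        2 * B * β + 2 * A * α * u + (β ^ 2 + α ^ 2 * u) := by ring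
    have e2 : ∀ x y z : ℝ, (x + y + z) ^ 2 ≤ 3 * (x ^ 2 + y ^ 2 + z ^ 2) := fun x y z => by
      nlinarith [sq_nonneg (x - y), sq_nonneg (x - z), sq_nonneg (y - z)]
    rw [e1]
    refine (e2 _ _ _).trans ?_
    have e3 : (2 * A * α * u) ^ 2 ≤ 4 * (A ^ 2 * u) * α ^ 2 := by
      have : (2 * A * α * u) ^ 2 = 4 * (A ^ 2 * u) * (α ^ 2 * u) := by ring
      rw [this]
      exact mul_le_mul_of_nonneg_left hα (by positivity)
    have e4 : (β ^ 2 + α ^ 2 * u) ^ 2 ≤ (α ^ 2 + β ^ 2) ^ 2 :=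
      pow_le_pow_left₀ (by positivity) (by linarith) 2
    have p1 : 0 ≤ B ^ 2 * α ^ 2 := by positivity
    have p2 : 0 ≤ A ^ 2 * u * β ^ 2 := by positivity
    have p3 : 0 ≤ (α ^ 2 + β ^ 2) ^ 2 * (B ^ 2 + A ^ 2 * u) := by positivity
    have p4 : 0 ≤ α ^ 2 + β ^ 2 := by positivity
    nlinarith
  · have e1 : (B + β) ^ 2 ≤ 2 * B ^ 2 + 2 * β ^ 2 := by nlinarith [sq_nonneg (B - β)]
    have e2 : (A + α) ^ 2 * u ≤ (2 * A ^ 2 + 2 * α ^ 2) * u :=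
      mul_le_mul_of_nonneg_right (by nlinarith [sq_nonneg (A - α)]) hu0.le
    have p1 : 0 ≤ (α ^ 2 + β ^ 2) * (B ^ 2 + A ^ 2 * u) := by positivity
    nlinarith

/-- The logarithmic potential, truncated at the level `ρ`. -/
noncomputable def logPot (ρ Q : ℝ) : ℝ := Real.log ((ρ + Q) / (1 + Q))

/-- The coefficient of `Q' - Q` is minus the derivative of the potential. Convexity makes the error
of the linearization nonnegative, and the quadratic bound on `Q' - Q` makes it of order `1 / (1 +
Q)`. Both come from `1 - 1/x ≤ log x ≤ x - 1`. -/
lemma logPot_increment {ρ Q Q' C₁ C₂ : ℝ} (hρ : 1 ≤ ρ) (hQ : 0 ≤ Q) (hQ' : 0 ≤ Q') (hC₂ : 1 ≤ C₂)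
    (hδ : (Q' - Q) ^ 2 ≤ C₁ * (1 + Q)) (hw : 1 + Q ≤ C₂ * (1 + Q')) :
    (logPot ρ Q' - logPot ρ Q) ^ 2 ≤ C₁ * C₂ ^ 2 * (ρ ^ 2 / ((ρ + Q) ^ 2 * (1 + Q))) ∧
    0 ≤ logPot ρ Q' - logPot ρ Q + (ρ - 1) / ((ρ + Q) * (1 + Q)) * (Q' - Q) ∧
    logPot ρ Q' - logPot ρ Q + (ρ - 1) / ((ρ + Q) * (1 + Q)) * (Q' - Q) ≤ C₁ * C₂ / (1 + Q) := by
  have hV : 0 < ρ + Q := by linarith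
  have hV' : 0 < ρ + Q' := by linarith
  have hw0 : 0 < 1 + Q := by linarith
  have hw0' : 0 < 1 + Q' := by linarith
  have hC₂0 : 0 < C₂ := by linarith
  have hVC : ρ + Q ≤ C₂ * (ρ + Q') := by nlinarith
  have hr : logPot ρ Q' - logPot ρ Q =
      Real.log (((ρ + Q') * (1 + Q)) / ((ρ + Q) * (1 + Q'))) := by
    rw [logPot, logPot, Real.log_div hV'.ne' hw0'.ne', Real.log_div hV.ne' hw0.ne',
      Real.log_div (by positivity) (by positivity), Real.log_mul hV'.ne' hw0.ne',
      Real.log_mul hV.ne' hw0'.ne']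
    ring
  have up : logPot ρ Q' - logPot ρ Q ≤ -((ρ - 1) * (Q' - Q)) / ((ρ + Q) * (1 + Q')) := by
    rw [hr]
    refine (Real.log_le_sub_one_of_pos (by positivity)).trans (le_of_eq ?_)
    field_simp
    ring
  have lo : -((ρ - 1) * (Q' - Q)) / ((ρ + Q') * (1 + Q)) ≤ logPot ρ Q' - logPot ρ Q := by
    rw [hr]
    refine le_trans (le_of_eq ?_) (Real.one_sub_inv_le_log_of_pos (by positivity))
    field_simp
    ring
  have hC₁ : 0 ≤ C₁ := by
    by_contra hc
    push Not at hc
    nlinarith [sq_nonneg (Q' - Q)]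
  have b1 : |(ρ - 1) * (Q' - Q)| / ((ρ + Q) * (1 + Q')) ≤
      ρ * |Q' - Q| * C₂ / ((ρ + Q) * (1 + Q)) := by
    rw [div_le_div_iff₀ (by positivity) (by positivity), abs_mul, abs_of_nonneg (by linarith)]
    calc (ρ - 1) * |Q' - Q| * ((ρ + Q) * (1 + Q))
        ≤ ρ * |Q' - Q| * ((ρ + Q) * (C₂ * (1 + Q'))) := by gcongr; linarith
      _ = _ := by ring
  have b2 : |(ρ - 1) * (Q' - Q)| / ((ρ + Q') * (1 + Q)) ≤
      ρ * |Q' - Q| * C₂ / ((ρ + Q) * (1 + Q)) := by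
    rw [div_le_div_iff₀ (by positivity) (by positivity), abs_mul, abs_of_nonneg (by linarith)]
    calc (ρ - 1) * |Q' - Q| * ((ρ + Q) * (1 + Q))
        ≤ ρ * |Q' - Q| * ((C₂ * (ρ + Q')) * (1 + Q)) := by gcongr; linarith
      _ = _ := by ring
  refine ⟨?_, ?_, ?_⟩
  · have h1 : |logPot ρ Q' - logPot ρ Q| ≤ ρ * |Q' - Q| * C₂ / ((ρ + Q) * (1 + Q)) := by
      rw [abs_le]
      constructor
      · refine le_trans ?_ lo
        refine (neg_le_neg b2).trans ?_
        rw [← neg_div]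
        exact div_le_div_of_nonneg_right (neg_le_neg (le_abs_self _)) (by positivity)
      · refine up.trans (le_trans ?_ b1)
        exact div_le_div_of_nonneg_right (neg_le_abs _) (by positivity)
    rw [← sq_abs]
    refine (pow_le_pow_left₀ (abs_nonneg _) h1 2).trans ?_
    rw [div_pow, mul_pow, mul_pow, sq_abs]
    calc ρ ^ 2 * (Q' - Q) ^ 2 * C₂ ^ 2 / ((ρ + Q) * (1 + Q)) ^ 2
        ≤ ρ ^ 2 * (C₁ * (1 + Q)) * C₂ ^ 2 / ((ρ + Q) * (1 + Q)) ^ 2 := by gcongr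
      _ = _ := by field_simp
  · have e1 : -((ρ - 1) * (Q' - Q)) / ((ρ + Q') * (1 + Q)) +
        (ρ - 1) / ((ρ + Q) * (1 + Q)) * (Q' - Q) =
        (ρ - 1) * (Q' - Q) ^ 2 / ((ρ + Q) * (ρ + Q') * (1 + Q)) := by
      field_simp
      ring
    have e2 : 0 ≤ (ρ - 1) * (Q' - Q) ^ 2 / ((ρ + Q) * (ρ + Q') * (1 + Q)) :=
      div_nonneg (mul_nonneg (by linarith) (sq_nonneg _)) (by positivity)
    linarith
  · have e1 : -((ρ - 1) * (Q' - Q)) / ((ρ + Q) * (1 + Q')) +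
        (ρ - 1) / ((ρ + Q) * (1 + Q)) * (Q' - Q) =
        (ρ - 1) * (Q' - Q) ^ 2 / ((ρ + Q) * (1 + Q') * (1 + Q)) := by
      field_simp
      ring
    have e2 : (ρ - 1) * (Q' - Q) ^ 2 / ((ρ + Q) * (1 + Q') * (1 + Q)) ≤ C₁ * C₂ / (1 + Q) := by
      rw [div_le_div_iff₀ (by positivity) (by positivity)]
      calc (ρ - 1) * (Q' - Q) ^ 2 * (1 + Q) ≤ (ρ + Q) * (C₁ * (1 + Q)) * (C₂ * (1 + Q')) := by
            gcongr
            linarith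
        _ = _ := by ring
    linarith

lemma logPot_nonneg {ρ Q : ℝ} (hρ : 1 ≤ ρ) (hQ : 0 ≤ Q) : 0 ≤ logPot ρ Q := by
  refine Real.log_nonneg ?_
  rw [le_div_iff₀ (by linarith)]
  linarith

lemma logPot_le {ρ Q : ℝ} (hρ : 1 ≤ ρ) (hQ : 0 ≤ Q) : logPot ρ Q ≤ ρ / (1 + Q) := by
  have hw0 : 0 < 1 + Q := by linarith
  refine (Real.log_le_sub_one_of_pos (div_pos (by linarith) hw0)).trans ?_
  rw [sub_le_iff_le_add, div_le_iff₀ hw0, add_mul, div_mul_cancel₀ _ hw0.ne']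
  linarith

end LogPotential

/-! ### Lattice points in rotated rectangles and ellipses -/

section Counting

lemma card_le_of_abs_sub_le (u : Finset ℤ) {c W : ℝ} (hW : 0 ≤ W) (h : ∀ n ∈ u, |(n : ℝ) - c| ≤ W) :
    (u.card : ℝ) ≤ 2 * W + 1 := by
  have h1 : u ⊆ Finset.Icc ⌈c - W⌉ ⌊c + W⌋ := fun n hn => by
    have := abs_le.1 (h n hn)
    rw [Finset.mem_Icc, Int.ceil_le, Int.le_floor]
    constructor <;> linarith
  have h2 := Finset.card_le_card h1
  rw [Int.card_Icc] at h2
  have h3 : ((⌊c + W⌋ + 1 - ⌈c - W⌉).toNat : ℝ) ≤ 2 * W + 1 := by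
    have h4 : (((⌊c + W⌋ + 1 - ⌈c - W⌉).toNat : ℤ) : ℝ) = ((max (⌊c + W⌋ + 1 - ⌈c - W⌉) 0 : ℤ) : ℝ) := by
      rw [Int.toNat_eq_max]
    rw [Int.cast_natCast] at h4
    rw [h4]
    push_cast
    refine max_le ?_ (by linarith)
    linarith [Int.floor_le (c + W), Int.le_ceil (c - W)]
  exact (Nat.cast_le.2 h2).trans h3

/-- The number of lattice points in a rotated rectangle. -/
lemma card_rotated_rectangle_le {p r : ℝ} (hp : p ≠ 0) {U V : ℝ} (hU : 0 ≤ U) (hUV : U ≤ V)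
    {α : Type*} (s : Finset α) (x y : α → ℤ) (hinj : ∀ z ∈ s, ∀ z' ∈ s, x z = x z' → y z = y z' → z = z')
    (hA : ∀ z ∈ s, |p * x z + r * y z| ≤ V) (hB : ∀ z ∈ s, |p * y z - r * x z| ≤ U) :
    (s.card : ℝ) ≤ (2 * (U / |p|) + 1) * (2 * ((|p| + |r|) / (p ^ 2 + r ^ 2) * V) + 1) := by
  classical
  have hV : 0 ≤ V := hU.trans hUV
  have hp0 : 0 < |p| := abs_pos.2 hp
  have hS : 0 < p ^ 2 + r ^ 2 := by positivity
  have h1 : ((s.image x).card : ℝ) ≤ 2 * ((|p| + |r|) / (p ^ 2 + r ^ 2) * V) + 1 := by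
    refine card_le_of_abs_sub_le (c := 0) _ (by positivity) fun n hn => ?_
    obtain ⟨z, hz, rfl⟩ := Finset.mem_image.1 hn
    -- The rotation is inverted to bound the range of `x`.
    have e1 : (x z : ℝ) - 0 = (p * (p * x z + r * y z) - r * (p * y z - r * x z)) /
        (p ^ 2 + r ^ 2) := by field_simp; ring
    rw [e1, abs_div, abs_of_pos hS, div_mul_eq_mul_div]
    refine div_le_div_of_nonneg_right ?_ hS.le
    refine (abs_sub _ _).trans ?_
    rw [abs_mul, abs_mul, add_mul]
    exact add_le_add (mul_le_mul_of_nonneg_left (hA z hz) (abs_nonneg _))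
      (mul_le_mul_of_nonneg_left ((hB z hz).trans hUV) (abs_nonneg _))
  -- For a given `x` the second constraint confines `y` to an interval of half-length `U / |p|`.
  have h2 : s.card ≤ ⌊2 * (U / |p|) + 1⌋₊ * (s.image x).card := by
    refine Finset.card_le_mul_card_image s _ fun n hn => ?_
    refine Nat.le_floor ?_
    have h3 : (s.filter fun z => x z = n).card = ((s.filter fun z => x z = n).image y).card := by
      rw [Finset.card_image_of_injOn]
      intro z hz z' hz' h
      rw [Finset.mem_coe, Finset.mem_filter] at hz hz'
      exact hinj z hz.1 z' hz'.1 (hz.2.trans hz'.2.symm) h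
    rw [h3]
    refine card_le_of_abs_sub_le (c := r * n / p) _ (by positivity) fun l hl => ?_
    obtain ⟨z, hz, rfl⟩ := Finset.mem_image.1 hl
    rw [Finset.mem_filter] at hz
    have e1 : (y z : ℝ) - r * n / p = (p * y z - r * x z) / p := by
      rw [hz.2]; field_simp
    rw [e1, abs_div]
    exact div_le_div_of_nonneg_right (hB z hz.1) hp0.le
  have h4 : (s.card : ℝ) ≤ (⌊2 * (U / |p|) + 1⌋₊ : ℝ) * (s.image x).card := by exact_mod_cast h2
  refine h4.trans (mul_le_mul (Nat.floor_le (by positivity)) h1 (Nat.cast_nonneg _) (by positivity))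

/-- The number of lattice points in an ellipse. -/
lemma card_ellipse_le {p r : ℝ} (hp : p ≠ 0) {M : ℝ} (hM : 1 ≤ M)
    {α : Type*} (x y : α → ℤ) (hinj : ∀ z z', x z = x z' → y z = y z' → z = z')
    (s : Finset α) (t : ℝ) (ht : 1 ≤ t)
    (h : ∀ z ∈ s, 1 + ((p * y z - r * x z) ^ 2 + (p * x z + r * y z) ^ 2 / M) ≤ t) :
    (s.card : ℝ) ≤ (2 / |p| + 1) * (2 * ((|p| + |r|) / (p ^ 2 + r ^ 2)) + 1) * √M * t := by
  have hp0 : 0 < |p| := abs_pos.2 hp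
  have hM0 : 0 < M := by linarith
  have hsM : 1 ≤ √M := Real.one_le_sqrt.2 hM
  have hst : 1 ≤ √t := Real.one_le_sqrt.2 ht
  have hq : ∀ z, 0 ≤ (p * y z - r * x z) ^ 2 ∧ 0 ≤ (p * x z + r * y z) ^ 2 / M := fun z =>
    ⟨by positivity, by positivity⟩
  -- The ellipse lies in a rectangle with half-sides `√t` and `√M √t`; since these are at least `1`,
  -- the additive constants of the count are absorbed.
  have h1 := card_rotated_rectangle_le (r := r) hp (U := √t) (V := √M * √t) (by positivity)
    (le_mul_of_one_le_left (by positivity) hsM) s x y (fun z _ z' _ => hinj z z')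
    (fun z hz => by
      rw [← Real.sqrt_mul hM0.le]
      refine Real.abs_le_sqrt ?_
      have := h z hz
      have h2 : (p * x z + r * y z) ^ 2 / M ≤ t := by linarith [(hq z).1]
      rw [div_le_iff₀ hM0] at h2
      linarith)
    (fun z hz => by
      refine Real.abs_le_sqrt ?_
      have := h z hz
      linarith [(hq z).2])
  refine h1.trans ?_
  set κ := (|p| + |r|) / (p ^ 2 + r ^ 2) with hκ
  have hκ0 : 0 ≤ κ := by positivity
  have e1 : 2 * (√t / |p|) + 1 ≤ (2 / |p| + 1) * √t := by
    have : 2 * (√t / |p|) = 2 / |p| * √t := by ring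
    rw [this, add_mul]; linarith
  have e2 : 2 * (κ * (√M * √t)) + 1 ≤ (2 * κ + 1) * (√M * √t) := by
    have : 1 ≤ √M * √t := one_le_mul_of_one_le_of_one_le hsM hst
    nlinarith
  refine (mul_le_mul e1 e2 (by positivity) (by positivity)).trans (le_of_eq ?_)
  have := Real.mul_self_sqrt (show 0 ≤ t by linarith)
  linear_combination ((2 / |p| + 1) * (2 * κ + 1) * √M) * this

end Counting

/-! ### Dimension two: the anisotropic logarithmic test function -/

section LogTest

variable {a : Fin 2 → ℝ} {i j : Fin 2}

lemma sum_fin_two_eq (hij : i ≠ j) (h : Fin 2 → ℝ) : ∑ l, h l = h i + h j :=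
  Fintype.sum_eq_add i j hij fun l hl => by omega

/-- A quadratic form that is flat in the direction of the drift. -/
noncomputable def flatQ (a : Fin 2 → ℝ) (i j : Fin 2) (M : ℝ) (z : Site 2) : ℝ :=
  (a i * z j - a j * z i) ^ 2 + (a i * z i + a j * z j) ^ 2 / M

lemma flatQ_nonneg {M : ℝ} (hM : 1 ≤ M) (z : Site 2) : 0 ≤ flatQ a i j M z := by
  have : 0 < M := by linarith
  unfold flatQ; positivity

lemma flatQ_neg (M : ℝ) (z : Site 2) : flatQ a i j M (-z) = flatQ a i j M z := by
  simp only [flatQ, Pi.neg_apply]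
  push_cast
  ring

lemma flatQ_add_left (hij : i ≠ j) (M : ℝ) (z : Site 2) : flatQ a i j M (z + e i) =
    ((a i * z j - a j * z i) + -a j) ^ 2 + ((a i * z i + a j * z j) + a i) ^ 2 / M := by
  simp only [flatQ, Pi.add_apply, e_apply, hij.symm, if_true, if_false]
  push_cast
  ring

lemma flatQ_add_right (hij : i ≠ j) (M : ℝ) (z : Site 2) : flatQ a i j M (z + e j) =
    ((a i * z j - a j * z i) + a i) ^ 2 + ((a i * z i + a j * z j) + a j) ^ 2 / M := by
  simp only [flatQ, Pi.add_apply, e_apply, hij, if_true, if_false]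
  push_cast
  ring

lemma flatQ_increment (hij : i ≠ j) {M : ℝ} (hM : 1 ≤ M) (z : Site 2) (l : Fin 2) :
    (flatQ a i j M (z + e l) - flatQ a i j M z) ^ 2 ≤
      (12 * (a i ^ 2 + a j ^ 2) + 3 * (a i ^ 2 + a j ^ 2) ^ 2) * (1 + flatQ a i j M z) ∧
    1 + flatQ a i j M z ≤ (2 + 2 * (a i ^ 2 + a j ^ 2)) * (1 + flatQ a i j M (z + e l)) := by
  have hl : l = i ∨ l = j := by omega
  rcases hl with rfl | rfl
  · rw [flatQ_add_left hij]
    have h1 := (quad_increment hM (a l * z l + a j * z j) (a l * z j - a j * z l) (a l) (-a j)).1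
    have h2 := (quad_increment hM (a l * z l + a j * z j + a l) (a l * z j - a j * z l + -a j)
      (-a l) (a j)).2
    rw [neg_sq] at h1 h2
    rw [neg_add_cancel_right, add_neg_cancel_right] at h2
    exact ⟨h1, h2⟩
  · rw [flatQ_add_right hij]
    have h1 := (quad_increment hM (a i * z i + a l * z l) (a i * z l - a l * z i) (a l) (a i)).1
    have h2 := (quad_increment hM (a i * z i + a l * z l + a l) (a i * z l - a l * z i + a i)
      (-a l) (-a i)).2
    rw [neg_sq, neg_sq] at h2
    rw [add_neg_cancel_right, add_neg_cancel_right] at h2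
    rw [add_comm (a l ^ 2)] at h1 h2
    exact ⟨h1, h2⟩

lemma flatQ_neg_e_le (hij : i ≠ j) {M : ℝ} (hM : 1 ≤ M) (l : Fin 2) :
    flatQ a i j M (-e l) ≤ a i ^ 2 + a j ^ 2 := by
  have h0 : 0 < M := by linarith
  have h1 : ∀ x : ℝ, x ^ 2 / M ≤ x ^ 2 := fun x => div_le_self (sq_nonneg x) hM
  have hl : l = i ∨ l = j := by omega
  rcases hl with rfl | rfl
  · have h := flatQ_add_left (a := a) hij M 0
    rw [flatQ_neg, ← zero_add (e l), h]
    simp only [Pi.zero_apply, Int.cast_zero]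
    have := h1 (a l)
    ring_nf at this ⊢
    linarith
  · have h := flatQ_add_right (a := a) hij M 0
    rw [flatQ_neg, ← zero_add (e l), h]
    simp only [Pi.zero_apply, Int.cast_zero]
    have := h1 (a l)
    ring_nf at this ⊢
    linarith

/-- Along the drift the coordinate orthogonal to `a` does not change to first order: its
contributions `-a i * a j` and `a j * a i` cancel. There remain constants of second order and the
slope in the flat direction, damped by `1 / M`. -/
lemma abs_sum_flatQ_increment_le (hij : i ≠ j) {M : ℝ} (hM : 1 ≤ M) (z : Site 2) :
    |a i * (flatQ a i j M (z + e i) - flatQ a i j M z) +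
      a j * (flatQ a i j M (z + e j) - flatQ a i j M z)| ≤
    (|a i * a j ^ 2 + a j * a i ^ 2| + |a i ^ 3 + a j ^ 3|) +
      2 * (a i ^ 2 + a j ^ 2) * (|a i * z i + a j * z j| / M) := by
  have h0 : 0 < M := by linarith
  rw [flatQ_add_left hij, flatQ_add_right hij, flatQ]
  set A := a i * (z i : ℝ) + a j * z j with hA
  have e1 : a i * ((a i * z j - a j * z i + -a j) ^ 2 + (A + a i) ^ 2 / M -
      ((a i * z j - a j * z i) ^ 2 + A ^ 2 / M)) +
      a j * ((a i * z j - a j * z i + a i) ^ 2 + (A + a j) ^ 2 / M -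
      ((a i * z j - a j * z i) ^ 2 + A ^ 2 / M)) =
      (a i * a j ^ 2 + a j * a i ^ 2) + (a i ^ 3 + a j ^ 3) / M +
        2 * (a i ^ 2 + a j ^ 2) * (A / M) := by
    field_simp
    ring
  rw [e1]
  refine (abs_add_three _ _ _).trans ?_
  have e2 : |(a i ^ 3 + a j ^ 3) / M| ≤ |a i ^ 3 + a j ^ 3| := by
    rw [abs_div, abs_of_pos h0]
    exact div_le_self (abs_nonneg _) hM
  have e3 : |2 * (a i ^ 2 + a j ^ 2) * (A / M)| = 2 * (a i ^ 2 + a j ^ 2) * (|A| / M) := by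
    rw [abs_mul, abs_div, abs_of_pos h0, abs_of_nonneg (by positivity)]
  rw [e3]
  linarith

/-- The logarithmic test function in dimension two. -/
noncomputable def logTest (a : Fin 2 → ℝ) (i j : Fin 2) (M ρ : ℝ) (z : Site 2) : ℝ :=
  logPot ρ (flatQ a i j M z)

lemma abs_le_one_add_of_sq_le {x c : ℝ} (h : x ^ 2 ≤ c) : |x| ≤ 1 + c := by
  rw [← sq_abs] at h
  nlinarith [sq_nonneg (|x| - 1)]

lemma sq_drift_le {D S M A V w ρ : ℝ} (hM : 0 < M) (hV : 0 < V) (hw : 0 < w)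
    (hD : D ^ 2 ≤ ρ ^ 2 / (V ^ 2 * w ^ 2)) (hA : A ^ 2 / M ≤ w) :
    (D * (2 * S * (|A| / M))) ^ 2 ≤ 4 * S ^ 2 / M * (ρ ^ 2 / (V ^ 2 * w)) := by
  have hA0 : 0 ≤ A ^ 2 / M := by positivity
  calc (D * (2 * S * (|A| / M))) ^ 2 = 4 * S ^ 2 / M * (D ^ 2 * (A ^ 2 / M)) := by
        rw [mul_pow, mul_pow, div_pow, sq_abs]
        field_simp
        ring
    _ ≤ 4 * S ^ 2 / M * (ρ ^ 2 / (V ^ 2 * w ^ 2) * w) :=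
        mul_le_mul_of_nonneg_left (mul_le_mul hD hA hA0 (by positivity)) (by positivity)
    _ = _ := by field_simp

/-- The gradient density has a sum that grows with `log ρ`. The drift gains: the linearized part is
smaller by the factor `1 / M` after squaring, and the remainder is of order `1 / (1 + Q)`, whose
square has a sum bounded independently of `ρ`. -/
lemma exists_drift_logTest_sq_le (a : Fin 2 → ℝ) (hij : i ≠ j) :
    ∃ C : ℝ, 0 ≤ C ∧ ∀ M ρ : ℝ, 1 ≤ M → 1 ≤ ρ → ∀ z,
      (∑ l, (logTest a i j M ρ z - logTest a i j M ρ (z + e l)) ^ 2 ≤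
        C * (ρ ^ 2 / ((ρ + flatQ a i j M z) ^ 2 * (1 + flatQ a i j M z)))) ∧
      drift a (logTest a i j M ρ) z ^ 2 ≤ C * ((1 + flatQ a i j M z) ^ 2)⁻¹ +
        C / M * (ρ ^ 2 / ((ρ + flatQ a i j M z) ^ 2 * (1 + flatQ a i j M z))) := by
  set S := a i ^ 2 + a j ^ 2 with hS
  have hS0 : 0 ≤ S := by positivity
  set C₁ := 12 * S + 3 * S ^ 2 with hC₁
  set C₂ := 2 + 2 * S with hC₂
  set C₃ := 1 + C₁ * C₂ ^ 2 with hC₃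
  set C₄ := |a i * a j ^ 2 + a j * a i ^ 2| + |a i ^ 3 + a j ^ 3| with hC₄
  set C₅ := C₄ + (|a i| + |a j|) * (C₁ * C₂) + 2 * (|a i| + |a j|) * (C₃ * (1 + S)) with hC₅
  have hC₁0 : 0 ≤ C₁ := by positivity
  have hC₃0 : 0 ≤ C₃ := by positivity
  have hC₄0 : 0 ≤ C₄ := by positivity
  have hC₅0 : 0 ≤ C₅ := by positivity
  refine ⟨2 * (C₁ * C₂ ^ 2) + 2 * C₅ ^ 2 + 8 * S ^ 2, by positivity, ?_⟩
  intro M ρ hM hρ z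
  have hM0 : 0 < M := by linarith
  set f := logTest a i j M ρ with hf
  set Q := flatQ a i j M z with hQdef
  have hQ : 0 ≤ Q := flatQ_nonneg hM z
  have hV : 0 < ρ + Q := by linarith
  have hw : 0 < 1 + Q := by linarith
  set g := ρ ^ 2 / ((ρ + Q) ^ 2 * (1 + Q)) with hg
  have hg0 : 0 ≤ g := by positivity
  set D := (ρ - 1) / ((ρ + Q) * (1 + Q)) with hD
  have inc : ∀ l, (f (z + e l) - f z) ^ 2 ≤ C₁ * C₂ ^ 2 * g ∧
      0 ≤ f (z + e l) - f z + D * (flatQ a i j M (z + e l) - Q) ∧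
      f (z + e l) - f z + D * (flatQ a i j M (z + e l) - Q) ≤ C₁ * C₂ / (1 + Q) := fun l =>
    logPot_increment hρ hQ (flatQ_nonneg hM _) (by rw [hC₂]; linarith)
      (flatQ_increment hij hM z l).1 (flatQ_increment hij hM z l).2
  have hneg : ∀ l, flatQ a i j M (-e l) ≤ S := flatQ_neg_e_le hij hM
  have habs : |a i * (flatQ a i j M (z + e i) - Q) + a j * (flatQ a i j M (z + e j) - Q)| ≤
      C₄ + 2 * S * (|a i * z i + a j * z j| / M) := abs_sum_flatQ_increment_le hij hM z
  clear_value C₁ C₂ C₃ C₄ C₅ S f g D Q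
  have hg1 : g ≤ 1 := by
    rw [hg, div_le_one (by positivity)]
    calc ρ ^ 2 ≤ (ρ + Q) ^ 2 := pow_le_pow_left₀ (by linarith) (by linarith) 2
      _ ≤ _ := le_mul_of_one_le_right (by positivity) (by linarith)
  constructor
  · rw [sum_fin_two_eq hij, ← neg_sq, neg_sub, ← neg_sq (f z - f (z + e j)), neg_sub]
    have h1 := (inc i).1
    have h2 := (inc j).1
    have h3 : 0 ≤ (2 * C₅ ^ 2 + 8 * S ^ 2) * g := by positivity
    have h4 : (2 * (C₁ * C₂ ^ 2) + 2 * C₅ ^ 2 + 8 * S ^ 2) * g =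
      C₁ * C₂ ^ 2 * g + C₁ * C₂ ^ 2 * g + (2 * C₅ ^ 2 + 8 * S ^ 2) * g := by ring
    linarith
  have hD0 : 0 ≤ D := by rw [hD]; exact div_nonneg (by linarith) (by positivity)
  have hD1 : D ≤ 1 / (1 + Q) := by
    rw [hD, div_le_div_iff₀ (by positivity) hw, one_mul]
    exact mul_le_mul_of_nonneg_right (by linarith) hw.le
  have hD2 : D ^ 2 ≤ ρ ^ 2 / ((ρ + Q) ^ 2 * (1 + Q) ^ 2) := by
    rw [hD, div_pow, mul_pow]
    have h1 : (ρ - 1) ^ 2 ≤ ρ ^ 2 := pow_le_pow_left₀ (by linarith) (by linarith) 2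
    exact div_le_div_of_nonneg_right h1 (by positivity)
  set X := D * (2 * S * (|a i * z i + a j * z j| / M)) with hX
  have hX0 : 0 ≤ X := by positivity
  have hX2 : X ^ 2 ≤ 4 * S ^ 2 / M * g := by
    have h1 : (a i * (z i : ℝ) + a j * z j) ^ 2 / M ≤ 1 + Q := by
      rw [hQdef, flatQ]
      linarith [sq_nonneg (a i * (z j : ℝ) - a j * z i)]
    rw [hX, hg]
    exact sq_drift_le hM0 hV hw hD2 h1
  clear_value X
  -- Each direction is compared with its linearization. The extra weight acts only at `z = -e l`,
  -- where `1 + Q` is bounded and the correction can be charged to `1 / (1 + Q)`.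
  have term : ∀ l : Fin 2, |a l * (1 + if z = -e l then 2 else 0) * (f z - f (z + e l)) -
      D * (a l * (flatQ a i j M (z + e l) - Q))| ≤
      |a l| * (C₁ * C₂ / (1 + Q)) + 2 * |a l| * (C₃ * (1 + S) / (1 + Q)) := by
    intro l
    have e1 : a l * (1 + if z = -e l then 2 else 0) * (f z - f (z + e l)) -
        D * (a l * (flatQ a i j M (z + e l) - Q)) =
        -(a l * (f (z + e l) - f z + D * (flatQ a i j M (z + e l) - Q))) +
          a l * ((if z = -e l then 2 else 0) * (f z - f (z + e l))) := by ring
    have e2 : |(if z = -e l then (2 : ℝ) else 0) * (f z - f (z + e l))| ≤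
        2 * (C₃ * (1 + S) / (1 + Q)) := by
      split_ifs with h
      · rw [abs_mul, abs_two]
        refine mul_le_mul_of_nonneg_left ?_ zero_le_two
        have h1 : |f z - f (z + e l)| ≤ C₃ := by
          rw [abs_sub_comm, hC₃]
          have h2 : (f (z + e l) - f z) ^ 2 ≤ C₁ * C₂ ^ 2 :=
            (inc l).1.trans (mul_le_of_le_one_right (by positivity) hg1)
          exact abs_le_one_add_of_sq_le h2
        have h3 : Q ≤ S := by rw [hQdef, h]; exact hneg l
        rw [le_div_iff₀ hw]
        exact mul_le_mul h1 (by linarith) hw.le hC₃0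
      · rw [zero_mul, abs_zero]
        positivity
    rw [e1]
    refine (abs_add_le _ _).trans ?_
    rw [abs_neg, abs_mul, abs_mul, abs_of_nonneg (inc l).2.1]
    have h4 := mul_le_mul_of_nonneg_left (inc l).2.2 (abs_nonneg (a l))
    have h5 := mul_le_mul_of_nonneg_left e2 (abs_nonneg (a l))
    linarith
  have hdrift : |drift a f z| ≤ C₅ / (1 + Q) + X := by
    have e1 : drift a f z = ∑ l, (a l * (1 + if z = -e l then 2 else 0) * (f z - f (z + e l)) -
        D * (a l * (flatQ a i j M (z + e l) - Q))) +
        D * (a i * (flatQ a i j M (z + e i) - Q) + a j * (flatQ a i j M (z + e j) - Q)) := by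
      rw [Finset.sum_sub_distrib, ← Finset.mul_sum, drift,
        sum_fin_two_eq hij fun l => a l * (flatQ a i j M (z + e l) - Q)]
      ring
    have e2 : |D * (a i * (flatQ a i j M (z + e i) - Q) + a j * (flatQ a i j M (z + e j) - Q))| ≤
        C₄ / (1 + Q) + X := by
      rw [abs_mul, abs_of_nonneg hD0]
      refine (mul_le_mul_of_nonneg_left habs hD0).trans ?_
      rw [mul_add, ← hX]
      have := mul_le_mul_of_nonneg_right hD1 hC₄0
      rw [one_div_mul_eq_div] at this
      linarith
    rw [e1]
    refine (abs_add_le _ _).trans ((add_le_add (Finset.abs_sum_le_sum_abs _ _) e2).trans ?_)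
    rw [sum_fin_two_eq hij]
    have e3 : C₅ / (1 + Q) = C₄ / (1 + Q) + (|a i| * (C₁ * C₂ / (1 + Q)) +
        2 * |a i| * (C₃ * (1 + S) / (1 + Q)) + (|a j| * (C₁ * C₂ / (1 + Q)) +
        2 * |a j| * (C₃ * (1 + S) / (1 + Q)))) := by
      rw [hC₅]; ring
    linarith [term i, term j]
  rw [← sq_abs]
  refine (pow_le_pow_left₀ (abs_nonneg _) hdrift 2).trans ?_
  have h1 : (C₅ / (1 + Q) + X) ^ 2 ≤ 2 * ((C₅ / (1 + Q)) ^ 2 + X ^ 2) := add_sq_le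
  have h2 : (C₅ / (1 + Q)) ^ 2 = C₅ ^ 2 * ((1 + Q) ^ 2)⁻¹ := by rw [div_pow, div_eq_mul_inv]
  have h3 : 0 ≤ (2 * (C₁ * C₂ ^ 2) + 8 * S ^ 2) * ((1 + Q) ^ 2)⁻¹ := by positivity
  have h4 : 0 ≤ (2 * (C₁ * C₂ ^ 2) + 2 * C₅ ^ 2) / M * g := by positivity
  have h5 : (2 * (C₁ * C₂ ^ 2) + 2 * C₅ ^ 2 + 8 * S ^ 2) / M * g =
      (2 * (C₁ * C₂ ^ 2) + 2 * C₅ ^ 2) / M * g + 2 * (4 * S ^ 2 / M * g) := by ring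
  rw [h5]
  rw [h2] at h1
  linarith

/-- The level set `1 + Q ≤ t` has at most the order of `√M t` points, which explains the factor
`√M`; `ν + 2` is the logarithmic sum over shells up to `ρ`. -/
lemma exists_isTest_logTest (hij : i ≠ j) (hi : a i ≠ 0) :
    ∃ C : ℝ, 0 < C ∧ ∀ (M ρ : ℝ) (ν : ℕ), 1 ≤ M → 1 ≤ ρ → ρ ≤ 2 ^ ν →
      IsTest a (logTest a i j M ρ) (C * √M * ρ ^ 2) (C * √M * (ν + 2))
        (C * √M + C / M * √M * (ν + 2)) := by
  obtain ⟨C, hC, H⟩ := exists_drift_logTest_sq_le a hij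
  set K₀ := (2 / |a i| + 1) * (2 * ((|a i| + |a j|) / (a i ^ 2 + a j ^ 2)) + 1) with hK₀
  have hK₀0 : 0 < K₀ := by positivity
  refine ⟨4 * K₀ * (C + 1), by positivity, ?_⟩
  intro M ρ ν hM hρ hν
  have hM0 : 0 < M := by linarith
  have hK0 : 0 ≤ K₀ * √M := by positivity
  set w : Site 2 → ℝ := fun z => 1 + flatQ a i j M z with hw
  have hQ : ∀ z, 0 ≤ flatQ a i j M z := flatQ_nonneg hM
  have hw1 : ∀ z, 1 ≤ w z := fun z => by simp only [hw]; linarith [hQ z]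
  have hcount : ∀ (s : Finset (Site 2)) (t : ℝ), 1 ≤ t → (∀ z ∈ s, w z ≤ t) →
      (s.card : ℝ) ≤ K₀ * √M * t := fun s t ht h =>
    card_ellipse_le (r := a j) hi hM (fun z : Site 2 => z i) (fun z => z j)
      (fun z z' h1 h2 => by
        funext l
        have hl : l = i ∨ l = j := by omega
        rcases hl with rfl | rfl <;> assumption) s t ht h
  set g : Site 2 → ℝ := fun z => ρ ^ 2 / ((ρ + flatQ a i j M z) ^ 2 * w z) with hg
  have hw0 : ∀ z, 0 < w z := fun z => zero_lt_one.trans_le (hw1 z)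
  have hgsum : ∀ s : Finset (Site 2), ∑ z ∈ s, g z ≤ 2 * (K₀ * √M) * (ν + 2) := by
    refine sum_log_le hν (by linarith) hK0 hw1 hcount (fun z => ?_) fun z => ?_
    · have h1 := hw0 z
      have h2 := hQ z
      rw [hg]
      simp only []
      rw [div_le_iff₀ (by positivity)]
      calc ρ ^ 2 ≤ (ρ + flatQ a i j M z) ^ 2 := pow_le_pow_left₀ (by linarith) (by linarith) 2
        _ = _ := by field_simp
    · have h1 := hw0 z
      have h2 := hQ z
      rw [hg, ← div_eq_mul_inv]
      simp only []
      refine div_le_div_of_nonneg_left (sq_nonneg _) (by positivity) ?_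
      calc w z ^ 3 = w z ^ 2 * w z := by ring
        _ ≤ _ := mul_le_mul_of_nonneg_right
          (pow_le_pow_left₀ h1.le (by simp only [hw]; linarith) 2) h1.le
  have hsq := sum_inv_sq_le hK0 hw1 hcount
  have hν0 : 0 ≤ K₀ * √M * ((ν : ℝ) + 2) := by positivity
  refine ⟨fun z => by rw [logTest, flatQ_neg, ← logTest], fun s => ?_, fun s => ?_, fun s => ?_⟩
  · calc ∑ z ∈ s, logTest a i j M ρ z ^ 2 ≤ ∑ z ∈ s, ρ ^ 2 * (w z ^ 2)⁻¹ := by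
          refine Finset.sum_le_sum fun z _ => ?_
          rw [← div_eq_mul_inv, ← div_pow]
          exact pow_le_pow_left₀ (logPot_nonneg hρ (hQ z)) (logPot_le hρ (hQ z)) 2
      _ ≤ ρ ^ 2 * (4 * (K₀ * √M)) := by
          rw [← Finset.mul_sum]
          exact mul_le_mul_of_nonneg_left (hsq s) (sq_nonneg _)
      _ ≤ _ := by
          have h1 : 0 ≤ K₀ * C * √M * ρ ^ 2 := by positivity
          have h2 : 4 * K₀ * (C + 1) * √M * ρ ^ 2 =
            ρ ^ 2 * (4 * (K₀ * √M)) + 4 * (K₀ * C * √M * ρ ^ 2) := by ring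
          linarith
  · calc _ ≤ ∑ z ∈ s, C * g z := Finset.sum_le_sum fun z _ => (H M ρ hM hρ z).1
      _ ≤ C * (2 * (K₀ * √M) * (ν + 2)) := by
          rw [← Finset.mul_sum]
          exact mul_le_mul_of_nonneg_left (hgsum s) hC
      _ ≤ _ := by
          have h1 : 0 ≤ C * (K₀ * √M * ((ν : ℝ) + 2)) := by positivity
          have h2 : 4 * K₀ * (C + 1) * √M * ((ν : ℝ) + 2) = C * (2 * (K₀ * √M) * (ν + 2)) +
            2 * (C * (K₀ * √M * ((ν : ℝ) + 2))) + 4 * (K₀ * √M * ((ν : ℝ) + 2)) := by ring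
          linarith
  · calc _ ≤ ∑ z ∈ s, (C * (w z ^ 2)⁻¹ + C / M * g z) :=
          Finset.sum_le_sum fun z _ => (H M ρ hM hρ z).2
      _ ≤ C * (4 * (K₀ * √M)) + C / M * (2 * (K₀ * √M) * (ν + 2)) := by
          rw [Finset.sum_add_distrib, ← Finset.mul_sum, ← Finset.mul_sum]
          exact add_le_add (mul_le_mul_of_nonneg_left (hsq s) hC)
            (mul_le_mul_of_nonneg_left (hgsum s) (by positivity))
      _ ≤ _ := by
          have h1 : 0 ≤ K₀ * √M := hK0
          have h2 : 0 ≤ (2 * C + 4) / M * (K₀ * √M * ((ν : ℝ) + 2)) := by positivity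
          have h3 : 4 * K₀ * (C + 1) / M * √M * ((ν : ℝ) + 2) =
            C / M * (2 * (K₀ * √M) * (ν + 2)) + (2 * C + 4) / M * (K₀ * √M * ((ν : ℝ) + 2)) := by
            ring
          have h4 : 4 * K₀ * (C + 1) * √M = C * (4 * (K₀ * √M)) + 4 * (K₀ * √M) := by ring
          rw [h3, h4]
          linarith

end LogTest

/-! ### The lower bound in dimension two -/

section LowerBoundTwo

variable {T : ℝ} {a : Fin 2 → ℝ} {i : Fin 2}

lemma le_logPot {ρ Q S : ℝ} (hρ : 0 < ρ) (hQ : 0 ≤ Q) (hQS : Q ≤ S) :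
    Real.log ρ - Real.log (1 + S) ≤ logPot ρ Q := by
  rw [logPot, Real.log_div (by linarith) (by linarith)]
  exact sub_le_sub (Real.log_le_log hρ (by linarith)) (Real.log_le_log (by linarith) (by linarith))

/-- With `L = |log lam|`, `ρ = lam^(-1/4)` and `M` of order `L`, the norm, gradient and drift costs
are all at most of order `√M · M`, that is `L^(3/2)`, while the test function is of order `L` at `e
i`. This gives `L² / L^(3/2)`. -/
theorem exists_lowerBound_two (hT : 0 < T) (hi : a i ≠ 0) :
    ∃ c : ℝ, 0 < c ∧ ∀ lam : ℝ, 0 < lam → lam ≤ 1 →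
      LowerBound T a i lam (c * |Real.log lam| ^ (1 / 2 : ℝ)) := by
  obtain ⟨j, hij⟩ : ∃ j : Fin 2, i ≠ j := ⟨i + 1, by omega⟩
  obtain ⟨C, hC, HC⟩ := exists_isTest_logTest hij hi
  obtain ⟨c, hc, H⟩ := exists_lower_bound ⟨i⟩ hT a
  set S := a i ^ 2 + a j ^ 2 with hS
  -- Above this threshold `log ρ - log (1 + S) = L / 4 - log (1 + S)` is at least `L / 8`; below it
  -- a constant bound from the simple test function is enough.
  set Λ : ℝ := max 1 (8 * Real.log (1 + S)) with hΛ
  have hΛ1 : 1 ≤ Λ := le_max_left _ _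
  have hΛS : 8 * Real.log (1 + S) ≤ Λ := le_max_right _ _
  clear_value Λ
  obtain ⟨c₀, hc₀, H₀⟩ := exists_lowerBound_of_scale hT hi (M := 3 + 2 * Λ) (by linarith)
  have hai : 0 < a i ^ 2 := by positivity
  refine ⟨min (c₀ / √Λ) (c * a i ^ 2 / (4800 * C)), by positivity, ?_⟩
  intro lam h0 h1
  obtain ⟨m, hm⟩ := exists_flow_scale_two h0 h1
  rw [← Real.sqrt_eq_rpow]
  obtain ⟨L, hL⟩ : ∃ L, L = |Real.log lam| := ⟨_, rfl⟩
  rw [← hL] at hm ⊢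
  have hL0 : 0 ≤ L := hL ▸ abs_nonneg _
  rcases le_total L Λ with hLΛ | hLΛ
  · refine (H₀ lam h0 h1 m (by linarith)).mono ?_
    calc min (c₀ / √Λ) (c * a i ^ 2 / (4800 * C)) * √L ≤ c₀ / √Λ * √Λ :=
          mul_le_mul (min_le_left _ _) (Real.sqrt_le_sqrt hLΛ) (Real.sqrt_nonneg _) (by positivity)
      _ = c₀ := div_mul_cancel₀ _ (Real.sqrt_pos.2 (by linarith)).ne'
  have hL1 : 1 ≤ L := hΛ1.trans hLΛ
  have hlam : lam = Real.exp (-L) := by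
    rw [hL, abs_of_nonpos (Real.log_nonpos h0.le h1), neg_neg, Real.exp_log h0]
  obtain ⟨ρ, hρ⟩ : ∃ ρ, ρ = Real.exp (L / 4) := ⟨_, rfl⟩
  have hρ1 : 1 ≤ ρ := by rw [hρ]; exact Real.one_le_exp (by linarith)
  have hlogρ : Real.log ρ = L / 4 := by rw [hρ, Real.log_exp]
  obtain ⟨n, hn, hn'⟩ := exists_nat_pow_near hρ1 one_lt_two
  have hnL : (n : ℝ) ≤ L / 2 := by
    have h2 := Real.log_le_log (by positivity) hn
    rw [Real.log_pow, hlogρ] at h2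
    have h3 := Real.log_two_gt_d9
    have h4 : (n : ℝ) * (1 / 2) ≤ n * Real.log 2 :=
      mul_le_mul_of_nonneg_left (by linarith) n.cast_nonneg
    linarith
  -- The anisotropy is the bound on the flow cost itself: then both parts of the drift energy are at
  -- most `C √M`, and the flow multiplies them by at most `M`.
  obtain ⟨M, hM⟩ : ∃ M, M = 3 + 2 * L := ⟨_, rfl⟩
  rw [← hM] at hm
  have hM1 : 1 ≤ M := by linarith
  have hM0 : 0 < M := by linarith
  have hν : ((n + 1 : ℕ) : ℝ) + 2 ≤ M := by push_cast; linarith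
  have ht := HC M ρ (n + 1) hM1 hρ1 hn'.le
  have hsM : 0 < √M := Real.sqrt_pos.2 hM0
  have hCM : 0 < C * √M := by positivity
  have hR : lam * (C * √M * ρ ^ 2) + C * √M * (((n + 1 : ℕ) : ℝ) + 2) +
      (flowEnergy 2 m + ((2 ^ m) ^ 2 * lam)⁻¹) *
        (C * √M + C / M * √M * (((n + 1 : ℕ) : ℝ) + 2)) < 5 * (C * √M * M) := by
    have b1 : lam * (C * √M * ρ ^ 2) ≤ C * √M := by
      have h2 : lam * ρ ^ 2 ≤ 1 := by
        rw [hlam, hρ, ← Real.exp_nat_mul, ← Real.exp_add, Real.exp_le_one_iff]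
        push_cast
        linarith
      calc lam * (C * √M * ρ ^ 2) = C * √M * (lam * ρ ^ 2) := by ring
        _ ≤ C * √M * 1 := mul_le_mul_of_nonneg_left h2 hCM.le
        _ = _ := mul_one _
    have b2 := mul_le_mul_of_nonneg_left hν hCM.le
    have b3 : C / M * √M * (((n + 1 : ℕ) : ℝ) + 2) ≤ C * √M := by
      calc C / M * √M * (((n + 1 : ℕ) : ℝ) + 2) ≤ C / M * √M * M :=
            mul_le_mul_of_nonneg_left hν (by positivity)
        _ = C * √M := by field_simp
    have b4 : (flowEnergy 2 m + ((2 ^ m) ^ 2 * lam)⁻¹) *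
        (C * √M + C / M * √M * (((n + 1 : ℕ) : ℝ) + 2)) ≤ M * (C * √M + C * √M) :=
      mul_le_mul hm (by linarith) (by positivity) hM0.le
    have b5 : C * √M * 1 ≤ C * √M * M := mul_le_mul_of_nonneg_left hM1 hCM.le
    have b6 : C * √M < C * √M * M := by
      refine lt_mul_of_one_lt_right hCM ?_
      linarith
    linarith
  refine (show LowerBound T a i lam _ from H i lam m _ _ _ _ _ h0 ht hR).mono ?_
  have hf : L / 8 ≤ logTest a i j M ρ (e i) := by
    have h2 := flatQ_neg_e_le (a := a) hij hM1 i
    rw [flatQ_neg] at h2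
    have h3 := le_logPot (by linarith : 0 < ρ) (flatQ_nonneg hM1 (e i)) h2
    rw [hlogρ] at h3
    rw [logTest]
    linarith
  have hf2 : L ^ 2 / 64 ≤ logTest a i j M ρ (e i) ^ 2 := by
    have := pow_le_pow_left₀ (by positivity) hf 2
    rw [div_pow] at this
    norm_num at this
    exact this
  have hsL : 0 < √L := Real.sqrt_pos.2 (by linarith)
  have hRL : 5 * (C * √M * M) ≤ 75 * C * (L * √L) := by
    have h2 : √M ≤ 3 * √L := by
      rw [show (3 : ℝ) = √9 by rw [show (9 : ℝ) = 3 ^ 2 by norm_num]; simp,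
        ← Real.sqrt_mul (by norm_num)]
      exact Real.sqrt_le_sqrt (by linarith)
    have h3 : M ≤ 5 * L := by linarith
    calc 5 * (C * √M * M) ≤ 5 * (C * (3 * √L) * (5 * L)) := by gcongr
      _ = _ := by ring
  have hLL : L = √L * √L := (Real.mul_self_sqrt hL0).symm
  calc min (c₀ / √Λ) (c * a i ^ 2 / (4800 * C)) * √L ≤ c * a i ^ 2 / (4800 * C) * √L :=
        mul_le_mul_of_nonneg_right (min_le_right _ _) hsL.le
    _ = c * (a i ^ 2 * (L ^ 2 / 64)) / (75 * C * (L * √L)) := by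
        rw [div_mul_eq_mul_div, div_eq_div_iff (by positivity) (by positivity)]
        linear_combination (-(75 * c * a i ^ 2 * C * L)) * hLL
    _ ≤ c * (a i ^ 2 * logTest a i j M ρ (e i) ^ 2) / (5 * (C * √M * M)) := by gcongr
    _ = _ := by rw [mul_pow]

end LowerBoundTwo

/-! ### The current as a Wick polynomial -/

section CurrentSums

variable {d : ℕ} {T lam : ℝ} {a : Fin d → ℝ} {i : Fin d}

open MvPolynomial (X pderiv monomial C)

lemma wick_X_mul (x : Site d) (P : Pol d) :
    wick T (X x * P) = X x * wick T P - T • wick T (pderiv x P) := by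
  rw [X_mul_wick, map_add, map_smul]; ring

lemma wick_X_sq (x : Site d) : wick T (X x ^ 2 : Pol d) = X x ^ 2 - C T := by
  have h : (X x ^ 2 : Pol d) = X x * (X x * 1) := by ring
  rw [h, wick_X_mul, wick_X_mul, mul_one, MvPolynomial.pderiv_X_self, wick_one]
  simp [MvPolynomial.smul_eq_C_mul]

lemma wick_X_sq_mul_X_sq {x y : Site d} (h : x ≠ y) :
    wick T (X x ^ 2 * X y ^ 2 : Pol d) = (X x ^ 2 - C T) * (X y ^ 2 - C T) := by
  have h1 : (X x ^ 2 * X y ^ 2 : Pol d) = X x * (X x * X y ^ 2) := by ring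
  have h2 : pderiv x (X y ^ 2 : Pol d) = 0 := by rw [pderiv_X_sq, if_neg h.symm, zero_smul]
  have h3 : pderiv x (X x * X y ^ 2 : Pol d) = X y ^ 2 := by
    rw [Derivation.leibniz, h2, MvPolynomial.pderiv_X_self]; simp
  rw [h1, wick_X_mul, h3, wick_X_mul, h2, wick_X_sq]
  simp [MvPolynomial.smul_eq_C_mul]
  ring

/-- Writing `E_x E_y` in terms of `E_x - T` and `E_y - T`, the normalization removes the mean and
turns the linear terms into the gradient `2 a_i T (E_y - E_x)`. This adds to the symmetric current
and gives the coefficient `2 (1 + a_i T)`. -/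
lemma pev_wick_curPol (s : Finset (Site d)) (p : Config d) :
    pev (wick T (curPol T a i s)) p = ∑ x ∈ s, normCurrent T a i (shift x p) := by
  rw [curPol, map_sum, pev_sum]
  refine Finset.sum_congr rfl fun x _ => ?_
  rw [map_add, map_smul, map_smul, map_sub, wick_X_sq, wick_X_sq,
    wick_X_sq_mul_X_sq (ne_add_e x i)]
  simp [normCurrent, current, energy, shift]
  rw [add_comm (e i) x]
  ring

lemma fock_one_curPol [Nonempty (Fin d)] (hT : 0 < T) (s : Finset (Site d)) :
    fock T 1 (curPol T a i s) = 0 := by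
  rw [curPol, fock_sum_right]
  refine Finset.sum_eq_zero fun x _ => ?_
  rw [fock_add_right, fock_smul_right, fock_smul_right, sub_eq_add_neg,
    fock_add_right, ← neg_one_smul ℝ, fock_smul_right, pow_two, pow_two, mul_assoc (X x),
    fock_one_X_mul hT, fock_one_X_mul hT, fock_one_X_mul hT]
  simp

lemma integral_sum_normCurrent [Nonempty (Fin d)] (hT : 0 < T) (s : Finset (Site d)) :
    ∫ p, ∑ x ∈ s, normCurrent T a i (shift x p) ∂gibbs d T = 0 := by
  rw [← fock_one_curPol (a := a) (i := i) hT s, fock]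
  refine integral_congr_ae (ae_of_all _ fun p => ?_)
  simp only [pev_wick_curPol, wick_one, pev_one, one_mul]

lemma shift_zero (p : Config d) : shift 0 p = p := by
  funext x; simp [shift]

lemma mean_normCurrent [Nonempty (Fin d)] (hT : 0 < T) : mean T (normCurrent T a i) = 0 := by
  have := integral_sum_normCurrent (a := a) (i := i) hT {0}
  simpa [shift_zero, mean] using this

lemma coeFn_toL2_curPol (s : Finset (Site d)) :
    (toL2 T (curPol T a i s) : Config d → ℝ) =ᵐ[gibbs d T]
      fun p => ∑ x ∈ s, normCurrent T a i (shift x p) :=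
  (coeFn_toL2 _).trans (ae_of_all _ fun p => pev_wick_curPol s p)

lemma coeFn_toL2_curPol_zero :
    (toL2 T (curPol T a i {0}) : Config d → ℝ) =ᵐ[gibbs d T] normCurrent T a i :=
  (coeFn_toL2_curPol {0}).trans (ae_of_all _ fun p => by simp [shift_zero])

lemma shiftL2_toL2_curPol (z : Site d) :
    shiftL2 z (toL2 T (curPol T a i {0})) = toL2 T (curPol T a i {z}) := by
  refine Lp.ext ((coeFn_shiftL2 z _).trans ((ae_shift coeFn_toL2_curPol_zero).trans ?_))
  exact EventuallyEq.trans (ae_of_all _ fun p => by simp) (coeFn_toL2_curPol {z}).symm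

lemma curPol_eq_sum (s : Finset (Site d)) : curPol T a i s = ∑ x ∈ s, curPol T a i {x} := by
  simp [curPol]

lemma coeFn_sum_shiftL2 (s : Finset (Site d)) (u : L2 d T) :
    ((∑ x ∈ s, shiftL2 x u : L2 d T) : Config d → ℝ) =ᵐ[gibbs d T]
      fun p => ∑ x ∈ s, u (shift x p) := by
  classical
  induction s using Finset.induction_on with
  | empty =>
    simp only [Finset.sum_empty]
    exact Lp.coeFn_zero _ _ _
  | insert x s hx ih =>
    rw [Finset.sum_insert hx]
    filter_upwards [Lp.coeFn_add (shiftL2 x u) (∑ x ∈ s, shiftL2 x u), ih, coeFn_shiftL2 x u]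
      with p h1 h2 h3
    rw [h1, Pi.add_apply, h2, h3, Finset.sum_insert hx]

end CurrentSums

/-! ### Solution of the resolvent equation and its box sums -/

section ResolventEquation

variable {d : ℕ} {T lam : ℝ} {a : Fin d → ℝ} {i : Fin d}

/-- The resolvent equation has a unique solution, and its box sums solve the equation for the
box sums of the current. -/
lemma exists_unique_isResolvent [Nonempty (Fin d)] (hdyn : DynamicsWellDefined d T a)
    (hlam : 0 < lam) (i : Fin d) : ∃ u : L2 d T,
      (∀ v : L2 d T, IsResolvent a lam (normCurrent T a i) v ↔ v = u) ∧
      ∃ g : L2 d T, ∀ k, IsBoxSolution T a i lam k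
        (∑ x ∈ box d k, shiftL2 x u, ∑ x ∈ box d k, shiftL2 x g) := by
  obtain ⟨P, hP, hgraph⟩ := hdyn
  obtain ⟨u, hu⟩ := hP.exists_resolvent hlam (toL2 T (curPol T a i {0}))
  set g := lam • u - toL2 T (curPol T a i {0}) with hg
  have hw : lam • u - g = toL2 T (curPol T a i {0}) := by rw [hg]; abel
  refine ⟨u, fun v => ⟨?_, ?_⟩, g, fun k => ⟨?_, ?_⟩⟩
  · rintro ⟨g', hg', hv⟩
    have h1 : lam • v - g' = toL2 T (curPol T a i {0}) :=
      Lp.ext (hv.trans coeFn_toL2_curPol_zero.symm)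
    have h2 := (hgraph _ _).2 (((hgraph _ _).1 hg').sub hu)
    have h3 : g' - g = lam • (v - u) := by
      rw [← hw] at h1
      rw [smul_sub, ← sub_eq_zero]
      rw [← sub_eq_zero] at h1
      rw [← neg_eq_zero, ← h1]
      abel
    -- Uniqueness by dissipativity: the difference of two solutions is an eigenvector with
    -- eigenvalue `lam > 0`, unless it vanishes.
    have h4 := inner_graph_nonpos h2
    simp only [h3, inner_smul_right, real_inner_self_eq_norm_sq] at h4
    have h5 : ‖v - u‖ ^ 2 ≤ 0 := by
      by_contra hc
      push Not at hc
      nlinarith [mul_pos hlam hc]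
    rw [← sub_eq_zero, ← norm_eq_zero]
    exact pow_eq_zero_iff two_ne_zero |>.1 (le_antisymm h5 (sq_nonneg _))
  · rintro rfl
    exact ⟨g, (hgraph _ _).2 hu, by rw [hw]; exact coeFn_toL2_curPol_zero⟩
  · refine (hgraph _ _).2 (IsGeneratorPair.sum _ fun x _ => (hgraph _ _).1 ?_)
    exact shiftL2_mem_closedGraph x ((hgraph _ _).2 hu)
  · rw [curPol_eq_sum, map_sum, Finset.smul_sum, ← Finset.sum_sub_distrib]
    refine Finset.sum_congr rfl fun x _ => ?_
    rw [← shiftL2_toL2_curPol, hg, map_sub, map_real_smul _ (continuous_shiftL2 x), sub_sub_cancel]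

/-- The box average is the squared resolvent norm per site. -/
lemma boxPairing_eq [Nonempty (Fin d)] (hT : 0 < T) {u g : L2 d T} {k : ℕ}
    (h : IsBoxSolution T a i lam k (∑ x ∈ box d k, shiftL2 x u, ∑ x ∈ box d k, shiftL2 x g)) :
    boxPairing T (normCurrent T a i) u k = ((2 * (k : ℝ) + 1) ^ d)⁻¹ *
      energyNorm lam (∑ x ∈ box d k, shiftL2 x u, ∑ x ∈ box d k, shiftL2 x g) := by
  rw [h.energyNorm_eq, boxPairing, mean_normCurrent hT, inner_eq_integral]
  congr 1
  set W := toL2 T (curPol T a i (box d k)) with hW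
  set U : L2 d T := ∑ x ∈ box d k, shiftL2 x u with hU
  -- Centring `u` only subtracts a multiple of the sum of the currents, which has mean zero.
  have h1 : ∀ᵐ p ∂gibbs d T, (∑ x ∈ box d k, (normCurrent T a i (shift x p) - 0)) *
      (∑ x ∈ box d k, (u (shift x p) - mean T u)) =
      W p * U p - (∑ x ∈ box d k, normCurrent T a i (shift x p)) *
        ((box d k).card * mean T u) := by
    filter_upwards [coeFn_toL2_curPol (T := T) (a := a) (i := i) (box d k),
      coeFn_sum_shiftL2 (box d k) u] with p h1 h2
    rw [h1, h2, Finset.sum_sub_distrib, Finset.sum_sub_distrib]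
    simp
    ring
  have h2 : Integrable (fun p => W p * U p) (gibbs d T) :=
    (Lp.memLp W).integrable_mul (Lp.memLp U)
  have h3 : Integrable (fun p => ∑ x ∈ box d k, normCurrent T a i (shift x p)) (gibbs d T) := by
    refine ((Lp.memLp W).integrable one_le_two).congr ?_
    exact coeFn_toL2_curPol _
  rw [mean, integral_congr_ae h1, integral_sub h2 (h3.mul_const _), integral_mul_const,
    integral_sum_normCurrent hT, zero_mul, sub_zero]

end ResolventEquation

/-! ### Box averages of an absolutely convergent series -/

section SeriesLimit

variable {d : ℕ} {T : ℝ}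

lemma tendsto_ratio_one (m : ℕ) :
    Tendsto (fun k : ℕ => ((2 * ((k : ℝ) - m) + 1) / (2 * (k : ℝ) + 1)) ^ d) atTop (𝓝 1) := by
  have h1 : Tendsto (fun k : ℕ => 1 - 2 * (m : ℝ) / (2 * (k : ℝ) + 1)) atTop (𝓝 (1 - 0)) :=
    tendsto_const_nhds.sub (tendsto_const_nhds.div_atTop
      (tendsto_atTop_add_const_right _ _ (tendsto_natCast_atTop_atTop.const_mul_atTop zero_lt_two)))
  rw [sub_zero] at h1
  have h2 := h1.pow d
  rw [one_pow] at h2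
  refine h2.congr fun k => ?_
  congr 1
  field_simp
  ring

lemma tendsto_card_box_inter (z : Site d) :
    Tendsto (fun k : ℕ => ((2 * (k : ℝ) + 1) ^ d)⁻¹ *
      ((box d k).filter fun x => x - z ∈ box d k).card) atTop (𝓝 1) := by
  obtain ⟨m, hm⟩ : ∃ m : ℕ, ∀ l, |z l| ≤ m := by
    refine ⟨∑ l, (z l).natAbs, fun l => ?_⟩
    rw [Int.abs_eq_natAbs]
    exact_mod_cast Finset.single_le_sum (f := fun l => (z l).natAbs) (fun _ _ => Nat.zero_le _)
      (Finset.mem_univ l)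
  refine tendsto_of_tendsto_of_tendsto_of_le_of_le' (tendsto_ratio_one (d := d) m) tendsto_const_nhds ?_ ?_
  · filter_upwards [eventually_ge_atTop m] with k hk
    have h1 : box d (k - m) ⊆ (box d k).filter fun x => x - z ∈ box d k := by
      intro x hx
      rw [mem_box] at hx
      rw [Finset.mem_filter, mem_box, mem_box]
      refine ⟨fun l => ?_, fun l => ?_⟩ <;> have h1 := hx l <;> have h2 := abs_le.1 (hm l)
      · omega
      · rw [Pi.sub_apply]; omega
    have h2 := Nat.cast_le (α := ℝ).2 (Finset.card_le_card h1)
    rw [card_box, Nat.cast_sub hk] at h2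
    rw [div_pow, div_eq_inv_mul]
    exact mul_le_mul_of_nonneg_left h2 (by positivity)
  · refine Eventually.of_forall fun k => ?_
    rw [inv_mul_le_iff₀ (by positivity), mul_one, ← card_box]
    exact_mod_cast Finset.card_filter_le _ _

/-- The box average is the series with weights equal to the overlap of the box with its translate by
`z`, relative to its volume. The weights lie in `[0, 1]` and tend to `1`, so dominated convergence
applies. Hence bounds on box averages also bound the sum of the series. -/
lemma tendsto_box_average {S : Site d → ℝ} {s : ℝ} (hS : HasSum S s) :
    Tendsto (fun k : ℕ => ((2 * (k : ℝ) + 1) ^ d)⁻¹ * ∑ x ∈ box d k, ∑ y ∈ box d k, S (x - y))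
      atTop (𝓝 s) := by
  classical
  have h1 : ∀ k : ℕ, ((2 * (k : ℝ) + 1) ^ d)⁻¹ * ∑ x ∈ box d k, ∑ y ∈ box d k, S (x - y) =
      ∑' z, (((2 * (k : ℝ) + 1) ^ d)⁻¹ * ((box d k).filter fun x => x - z ∈ box d k).card) * S z := by
    intro k
    have h2 : ∀ x ∈ box d k, HasSum (fun z => if x - z ∈ box d k then S z else 0)
        (∑ y ∈ box d k, S (x - y)) := by
      intro x _
      rw [← (Equiv.subLeft x).hasSum_iff]
      have h3 : ∑ y ∈ box d k, S (x - y) = ∑ y ∈ box d k,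
          ((fun z => if x - z ∈ box d k then S z else 0) ∘ Equiv.subLeft x) y :=
        Finset.sum_congr rfl fun y hy => by simp [hy]
      rw [h3]
      exact hasSum_sum_of_ne_finset_zero fun y hy => by simp [hy]
    have h4 := (hasSum_sum h2).mul_left (((2 * (k : ℝ) + 1) ^ d)⁻¹)
    rw [← h4.tsum_eq]
    refine tsum_congr fun z => ?_
    rw [← Finset.sum_filter, Finset.sum_const, nsmul_eq_mul, mul_assoc]
  simp only [h1]
  rw [← hS.tsum_eq]
  refine tendsto_tsum_of_dominated_convergence (bound := fun z => |S z|) hS.summable.abs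
    (fun z => ?_) (Eventually.of_forall fun k z => ?_)
  · simpa using (tendsto_card_box_inter z).mul_const (S z)
  · rw [Real.norm_eq_abs, abs_mul]
    refine mul_le_of_le_one_left (abs_nonneg _) ?_
    rw [abs_of_nonneg (by positivity), inv_mul_le_iff₀ (by positivity), mul_one, ← card_box]
    exact_mod_cast Finset.card_filter_le _ _

end SeriesLimit

/-! ### From box estimates to the bounds on the pairing -/

section Pairing

variable {d : ℕ} {T lam : ℝ} {a : Fin d → ℝ} {i : Fin d} {u g : L2 d T}

lemma integral_comp_shift (z : Site d) {f : Config d → ℝ}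
    (hf : AEStronglyMeasurable f (gibbs d T)) :
    ∫ p, f (shift z p) ∂gibbs d T = ∫ p, f p ∂gibbs d T := by
  have h := measurePreserving_shift (T := T) z
  conv_rhs => rw [← h.map_eq]
  rw [integral_map h.measurable.aemeasurable (by rw [h.map_eq]; exact hf)]

/-- Stationarity under shifts: the correlation depends only on `x - y`. -/
lemma inner_shiftL2_eq_shiftCov [Nonempty (Fin d)] (hT : 0 < T) (x y : Site d) :
    inner ℝ (toL2 T (curPol T a i {x})) (shiftL2 y u) = shiftCov T (normCurrent T a i) u (x - y) := by
  rw [shiftCov, mean_normCurrent hT, zero_mul, sub_zero, inner_eq_integral, mean]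
  have h1 : (fun p => toL2 T (curPol T a i {x}) p * shiftL2 y u p) =ᵐ[gibbs d T]
      fun p => (fun p' => normCurrent T a i (shift (x - y) p') * u p') (shift y p) := by
    filter_upwards [coeFn_toL2_curPol (T := T) (a := a) (i := i) {x}, coeFn_shiftL2 y u]
      with p h1 h2
    rw [h1, h2, Finset.sum_singleton, shift_shift, sub_add_cancel]
  have h2 : AEStronglyMeasurable (fun p' => normCurrent T a i (shift (x - y) p') * u p')
      (gibbs d T) := by
    refine (((Lp.aestronglyMeasurable (toL2 T (curPol T a i {x - y}))).congr
      (coeFn_toL2_curPol {x - y})).congr (ae_of_all _ fun p => ?_)).mul (Lp.aestronglyMeasurable u)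
    simp
  rw [integral_congr_ae h1, integral_comp_shift y h2]

lemma boxPairing_eq_sum [Nonempty (Fin d)] (hT : 0 < T) {k : ℕ}
    (h : IsBoxSolution T a i lam k (∑ x ∈ box d k, shiftL2 x u, ∑ x ∈ box d k, shiftL2 x g)) :
    boxPairing T (normCurrent T a i) u k = ((2 * (k : ℝ) + 1) ^ d)⁻¹ *
      ∑ x ∈ box d k, ∑ y ∈ box d k, shiftCov T (normCurrent T a i) u (x - y) := by
  rw [boxPairing_eq hT h, h.energyNorm_eq, curPol_eq_sum, map_sum, sum_inner]
  simp only [inner_sum, inner_shiftL2_eq_shiftCov hT]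

lemma PairingGE.of_lowerBound [Nonempty (Fin d)] (hT : 0 < T)
    (h : ∀ k, IsBoxSolution T a i lam k (∑ x ∈ box d k, shiftL2 x u, ∑ x ∈ box d k, shiftL2 x g))
    {b : ℝ} (hb : LowerBound T a i lam b) : PairingGE T (normCurrent T a i) u b := by
  have h1 : ∀ᶠ k : ℕ in atTop, b ≤ boxPairing T (normCurrent T a i) u k := by
    filter_upwards [hb] with k hk
    rw [boxPairing_eq hT (h k), le_inv_mul_iff₀ (by positivity)]
    exact hk _ (h k)
  refine ⟨le_liminf_of_le (by isBoundedDefault) (h1.mono fun k hk => EReal.coe_le_coe_iff.2 hk),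
    fun s hs => ge_of_tendsto (tendsto_box_average hs) (h1.mono fun k hk => ?_)⟩
  rwa [← boxPairing_eq_sum hT (h k)]

lemma PairingLE.of_upperBound [Nonempty (Fin d)] (hT : 0 < T)
    (h : ∀ k, IsBoxSolution T a i lam k (∑ x ∈ box d k, shiftL2 x u, ∑ x ∈ box d k, shiftL2 x g))
    {b : ℝ} (hb : ∀ k q, IsBoxSolution T a i lam k q → energyNorm lam q ≤ (2 * (k : ℝ) + 1) ^ d * b) :
    PairingLE T (normCurrent T a i) u b := by
  have h1 : ∀ᶠ k : ℕ in atTop, boxPairing T (normCurrent T a i) u k ≤ b := by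
    refine Eventually.of_forall fun k => ?_
    rw [boxPairing_eq hT (h k), inv_mul_le_iff₀ (by positivity)]
    exact hb k _ (h k)
  refine ⟨limsup_le_of_le (by isBoundedDefault) (h1.mono fun k hk => EReal.coe_le_coe_iff.2 hk),
    fun s hs => le_of_tendsto (tendsto_box_average hs) (h1.mono fun k hk => ?_)⟩
  rwa [← boxPairing_eq_sum hT (h k)]

/-- The bounds of the main theorem for one direction, on the box level. -/
lemma exists_bounds (hT : 0 < T) (a : Fin d → ℝ) (i : Fin d) :
    ∃ C : ℝ, 0 < C ∧ ∀ C' : ℝ, 0 < C' → C' ≤ C → ∀ lam : ℝ, 0 < lam →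
      (a i ≠ 0 → lam ≤ 1 →
        (d = 1 → LowerBound T a i lam (C' * lam ^ (-(1 / 4) : ℝ))) ∧
        (d = 2 → LowerBound T a i lam (C' * |Real.log lam| ^ (1 / 2 : ℝ))) ∧
        (3 ≤ d → LowerBound T a i lam C')) ∧
      (3 ≤ d → ∀ k q, IsBoxSolution T a i lam k q →
        energyNorm lam q ≤ (2 * (k : ℝ) + 1) ^ d * C'⁻¹) := by
  have low : ∃ C : ℝ, 0 < C ∧ ∀ lam : ℝ, 0 < lam → a i ≠ 0 → lam ≤ 1 →
      (d = 1 → LowerBound T a i lam (C * lam ^ (-(1 / 4) : ℝ))) ∧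
      (d = 2 → LowerBound T a i lam (C * |Real.log lam| ^ (1 / 2 : ℝ))) ∧
      (3 ≤ d → LowerBound T a i lam C) := by
    by_cases hi : a i = 0
    · exact ⟨1, one_pos, fun lam _ h => absurd hi h⟩
    by_cases h1 : d = 1
    · subst h1
      obtain ⟨c, hc, H⟩ := exists_lowerBound_one hT hi
      exact ⟨c, hc, fun lam h0 _ h1 => ⟨fun _ => H lam h0 h1, by omega, by omega⟩⟩
    by_cases h2 : d = 2
    · subst h2
      obtain ⟨c, hc, H⟩ := exists_lowerBound_two hT hi
      exact ⟨c, hc, fun lam h0 _ h1 => ⟨by omega, fun _ => H lam h0 h1, by omega⟩⟩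
    · obtain ⟨c, hc, H⟩ := exists_lowerBound_of_scale hT hi (M := 5) (by norm_num)
      refine ⟨c, hc, fun lam h0 _ h1 => ⟨by omega, by omega, fun h3 => ?_⟩⟩
      obtain ⟨m, hm⟩ := exists_flow_scale h3 h0
      exact H lam h0 h1 m hm
  have up : ∃ C : ℝ, 0 < C ∧ ∀ lam : ℝ, 0 < lam → 3 ≤ d → ∀ k q, IsBoxSolution T a i lam k q →
      energyNorm lam q ≤ (2 * (k : ℝ) + 1) ^ d * C := by
    by_cases h3 : 3 ≤ d
    · obtain ⟨c, hc, H⟩ := exists_upper_bound h3 hT a i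
      exact ⟨c, hc, fun lam h0 _ k q hq => H lam k q h0 hq⟩
    · exact ⟨1, one_pos, fun lam _ h => absurd h h3⟩
  obtain ⟨c, hc, hlow⟩ := low
  obtain ⟨c', hc', hup⟩ := up
  -- A single constant appears as `C` below and as `C⁻¹` above, hence the minimum. Every smaller
  -- constant is allowed too, so that the directions can share one.
  refine ⟨min c c'⁻¹, by positivity, fun C' h0 hC' lam hlam => ⟨fun hi h1 => ?_, fun h3 k q hq => ?_⟩⟩
  · have hle : C' ≤ c := hC'.trans (min_le_left _ _)
    obtain ⟨b1, b2, b3⟩ := hlow lam hlam hi h1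
    exact ⟨fun h => (b1 h).mono (mul_le_mul_of_nonneg_right hle (by positivity)),
      fun h => (b2 h).mono (mul_le_mul_of_nonneg_right hle (by positivity)),
      fun h => (b3 h).mono hle⟩
  · refine (hup lam hlam h3 k q hq).trans (mul_le_mul_of_nonneg_left ?_ (by positivity))
    rw [le_inv_comm₀ hc' h0]
    exact hC'.trans (min_le_right _ _)

end Pairing

end AEM

theorem theorem1 (d : ℕ) (T : ℝ) (hT : 0 < T) (a : Fin d → ℝ)
    (hdyn : AEM.DynamicsWellDefined d T a) :
    ∃ C : ℝ, 0 < C ∧ ∀ i : Fin d, ∀ lam : ℝ, 0 < lam →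
      ∃ u : AEM.L2 d T,
        (∀ v : AEM.L2 d T, AEM.IsResolvent a lam (AEM.normCurrent T a i) v ↔ v = u) ∧
        (a i ≠ 0 → lam ≤ 1 →
          (d = 1 → AEM.PairingGE T (AEM.normCurrent T a i) u (C * lam ^ (-(1 / 4) : ℝ))) ∧
          (d = 2 → AEM.PairingGE T (AEM.normCurrent T a i) u (C * |Real.log lam| ^ (1 / 2 : ℝ))) ∧
          (3 ≤ d → AEM.PairingGE T (AEM.normCurrent T a i) u C)) ∧
        (3 ≤ d → AEM.PairingLE T (AEM.normCurrent T a i) u C⁻¹) := by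
  -- For `d = 0` there are no directions and the claim is empty.
  cases isEmpty_or_nonempty (Fin d) with
  | inl h => exact ⟨1, one_pos, fun i => h.elim i⟩
  | inr hne =>
    choose c hc H using fun i => AEM.exists_bounds hT a i
    obtain ⟨i₀, hi₀⟩ := Finite.exists_min c
    refine ⟨c i₀, hc i₀, fun i lam hlam => ?_⟩
    obtain ⟨u, hu, g, hg⟩ := AEM.exists_unique_isResolvent hdyn hlam i
    obtain ⟨hlow, hup⟩ := H i (c i₀) (hc i₀) (hi₀ i) lam hlam
    refine ⟨u, hu, fun hi h1 => ?_, fun h3 => AEM.PairingLE.of_upperBound hT hg (hup h3)⟩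
    obtain ⟨b1, b2, b3⟩ := hlow hi h1
    exact ⟨fun h => AEM.PairingGE.of_lowerBound hT hg (b1 h),
      fun h => AEM.PairingGE.of_lowerBound hT hg (b2 h),
      fun h => AEM.PairingGE.of_lowerBound hT hg (b3 h)⟩
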